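/- Let $ABCDE$ be the TH-pentagon: the convex pentagon that is the union of two equilateral triangles $ABD$ and $BCD$ of side length $1$ and of the isosceles triangle $ADE$ with apex $E$, lying on the other side of $AD$ from $B$, whose area is one third of the area of $ABD$ (its angles at $A,B,C,D,E$ are $90^\circ,120^\circ,60^\circ,150^\circ,120^\circ$). For $a,b,c>0$ let $F(a,b,c)$ be the closed region bounded by the 18-sided polygon, invariant under the rotation by $60^\circ$ about its centre, whose interior angles are, in counterclockwise order, $240^\circ,120^\circ,120^\circ$ (repeated six times) and whose successive side lengths, starting at a vertex with angle $240^\circ$, are $a,b,c$ (repeated six times). The HFL2-unit is $F(2,2,2)$, the HFL3-unit is $F(3,3,3)$ and the skewed HF-unit is $F(2,2,1)$. A filling of a region is a set of congruent copies of the TH-pentagon (reflected copies allowed, placed anywhere in the plane) with pairwise disjoint interiors whose union is the region. Two fillings of a region are regarded as the same if an isometry of the plane (a rotation or reflection of the region) carries the tiles of one onto the tiles of the other. Then: 1. every filling of the HFL2-unit consists of $72$ TH-pentagons, and there are exactly $15$ fillings of it up to rotation and reflection; 2. every filling of the HFL3-unit consists of $162$ TH-pentagons, and there are exactly $2$ fillings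 of it up to rotation and reflection; 3. every filling of the skewed HF-unit consists of $54$ TH-pentagons, and there are exactly $2$ fillings of it up to rotation and reflection. -/

import Mathlib

noncomputable section

namespace THPentagon

/-- The sixth root of unity `cos 60° + i sin 60°`; the Euclidean plane is modelled by `ℂ`. -/
def ω : ℂ := ⟨1 / 2, √3 / 2⟩

/-- The TH-pentagon `ABCDE` with `B = 0`, `A = 1`, `D = ω`, `C = ω ^ 2` and `E = 2 (1 + ω) / 3`.
The triangles `ABD` and `BCD` are equilateral with side length `1`. The point `E` is the centre
of the equilateral triangle on the other side of `AD` (with third vertex `1 + ω`), so that `ADE`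
is isosceles with apex `E` and has one third of the area of `ABD`. The angles at `A`, `B`, `C`,
`D`, `E` are 90°, 120°, 60°, 150°, 120°. -/
def thPentagon : Set ℂ := convexHull ℝ {1, 0, ω ^ 2, ω, 2 * (1 + ω) / 3}

/-- A set of tiles `F` fills the region `R`: every tile is the image of the TH-pentagon under an
isometry of the plane (reflected copies are allowed), distinct tiles have disjoint interiors, and
the union of the tiles is `R`. -/
def IsFilling (R : Set ℂ) (F : Set (Set ℂ)) : Prop :=
  (∀ S ∈ F, ∃ e : ℂ ≃ᵢ ℂ, e '' thPentagon = S) ∧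
  F.PairwiseDisjoint interior ∧
  ⋃₀ F = R

/-- Two fillings of `R` are identified when an isometry of the plane carries the tiles of the one
onto the tiles of the other (such an isometry maps `R` onto itself). -/
def fillingSetoid (R : Set ℂ) : Setoid {F : Set (Set ℂ) // IsFilling R F} where
  r F G := ∃ e : ℂ ≃ᵢ ℂ, (fun S : Set ℂ => e '' S) '' F.1 = G.1
  iseqv :=
    { refl := fun F => ⟨IsometryEquiv.refl ℂ, by
        have h : (fun S : Set ℂ => IsometryEquiv.refl ℂ '' S) = id := funext fun S => Set.image_id S
        rw [h, Set.image_id]⟩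
      symm := by
        rintro F G ⟨e, h⟩
        refine ⟨e.symm, ?_⟩
        rw [← h, Set.image_image]
        simp [Set.image_image]
      trans := by
        rintro F G H ⟨e, h⟩ ⟨f, k⟩
        refine ⟨e.trans f, ?_⟩
        rw [← k, ← h, Set.image_image]
        simp only [Set.image_image]
        rfl }

/-- The patterns of `R`: its fillings up to isometry. -/
def Pattern (R : Set ℂ) : Type := Quotient (fillingSetoid R)

/-- The vertices, in counterclockwise order and with period 18 in `k`, of the closed 18-sided
polygon centred at `0` that is invariant under the rotation by 60°, whose interior angles are
240°, 120°, 120° (repeated six times), and whose side lengths are `a`, `b`, `c` (repeated six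
times), a side of length `a` following each vertex with angle 240°. The vertices number `0`, `1`,
`2`, `3` are `P = (b + c) - (a + b) ω`, `P + a`, `P + a + b ω`, `P + a + b ω + c ω ^ 2 = ω P`. -/
def flowerVertex (a b c : ℝ) (k : ℕ) : ℂ :=
  ω ^ (k / 3) *
    ((b + c) - (a + b) * ω +
      if k % 3 = 0 then 0 else if k % 3 = 1 then (a : ℂ) else a + b * ω)

/-- The region enclosed by that polygon. It is star-shaped with respect to its centre `0`, hence
it is the union of the 18 triangles spanned by the centre and the sides. -/
def flower (a b c : ℝ) : Set ℂ :=
  ⋃ k ∈ Finset.range 18, convexHull ℝ {0, flowerVertex a b c k, flowerVertex a b c (k + 1)}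

/-- The hexagonal flower unit with side length `n` (the unit of length is the side `AB` of the
TH-pentagon). -/
def hexFlower (n : ℝ) : Set ℂ := flower n n n

/-- The skewed hexagonal flower unit. -/
def skewedHexFlower : Set ℂ := flower 2 2 1

end THPentagon

end

noncomputable section

namespace THPentagon

open Filter Topology ComplexConjugate

/-- The twelfth root of unity `cos 30° + i sin 30°`. -/
def ζ : ℂ := ⟨√3 / 2, 1 / 2⟩

lemma sqrt_three_mul_self : √3 * √3 = 3 := Real.mul_self_sqrt (by norm_num)

lemma sqrt_three_pos : 0 < √3 := Real.sqrt_pos.2 (by norm_num)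

lemma ζ_sq : ζ ^ 2 = ω := by
  rw [pow_two]
  apply Complex.ext <;> simp [ζ, ω] <;> nlinarith [sqrt_three_mul_self]

lemma ζ_cube : ζ ^ 3 = Complex.I := by
  rw [pow_succ, ζ_sq]
  apply Complex.ext <;> simp [ζ, ω] <;> nlinarith [sqrt_three_mul_self]

lemma ζ_pow_six : ζ ^ 6 = -1 := by
  rw [show 6 = 3 * 2 by rfl, pow_mul, ζ_cube, Complex.I_sq]

lemma ζ_pow_twelve : ζ ^ 12 = 1 := by
  rw [show 12 = 6 * 2 by rfl, pow_mul, ζ_pow_six]; norm_num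

lemma ζ_pow_four : ζ ^ 4 = ζ ^ 2 - 1 := by
  rw [show ζ ^ 4 = ζ ^ 3 * ζ by ring, ζ_cube, ζ_sq]
  apply Complex.ext <;> simp [ζ, ω]; norm_num

lemma ζ_mul_conj : ζ * conj ζ = 1 := by
  rw [Complex.mul_conj]
  norm_cast
  simp only [Complex.normSq_apply, ζ]
  nlinarith [sqrt_three_mul_self]

lemma ζ_pow_mul_conj (n : ℕ) : ζ ^ n * conj (ζ ^ n) = 1 := by
  rw [map_pow, ← mul_pow, ζ_mul_conj, one_pow]

lemma ζ_pow_ne_zero (n : ℕ) : ζ ^ n ≠ 0 := fun h => by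
  simpa [h] using ζ_pow_mul_conj n

lemma conj_ζ_pow (n : ℕ) : conj (ζ ^ n) = ζ ^ (12 - n % 12) := by
  have h : ζ ^ n * ζ ^ (12 - n % 12) = 1 := by
    rw [← pow_add, show n + (12 - n % 12) = 12 * (n / 12 + 1) by omega, pow_mul, ζ_pow_twelve,
      one_pow]
  exact mul_left_cancel₀ (ζ_pow_ne_zero n) ((ζ_pow_mul_conj n).trans h.symm)

lemma ζ_pow_mod (n : ℕ) : ζ ^ (n % 12) = ζ ^ n := by
  conv_rhs => rw [← Nat.mod_add_div n 12, pow_add, pow_mul, ζ_pow_twelve, one_pow, mul_one]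

lemma norm_ζ_pow (n : ℕ) : ‖ζ ^ n‖ = 1 := by
  have h := congrArg norm (ζ_pow_mul_conj n)
  rw [norm_mul, RCLike.norm_conj, norm_one] at h
  nlinarith [norm_nonneg (ζ ^ n)]

lemma ζ_pow_im_table : (ζ ^ 0).im = 0 ∧ (ζ ^ 1).im = 1 / 2 ∧ (ζ ^ 2).im = √3 / 2 ∧
    (ζ ^ 3).im = 1 ∧ (ζ ^ 4).im = √3 / 2 ∧ (ζ ^ 5).im = 1 / 2 := by
  refine ⟨by simp, by simp [ζ], by simp [ζ_sq, ω], by simp [ζ_cube], ?_, ?_⟩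
  · rw [ζ_pow_four, ζ_sq]; simp [ω]
  · rw [show ζ ^ 5 = ζ ^ 3 * ζ ^ 2 by ring, ζ_cube, ζ_sq]; simp [ω]

lemma ζ_pow_im_nonneg {r : ℕ} (h : r ≤ 6) : 0 ≤ (ζ ^ r).im := by
  obtain ⟨h0, h1, h2, h3, h4, h5⟩ := ζ_pow_im_table
  interval_cases r <;> simp_all [ζ_pow_six] <;> positivity

lemma ζ_pow_im_pos {r : ℕ} (h0 : 0 < r) (h : r < 6) : 0 < (ζ ^ r).im := by
  obtain ⟨h0, h1, h2, h3, h4, h5⟩ := ζ_pow_im_table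
  interval_cases r <;> simp_all

/-! ### Points with exact coordinates -/

/-- The point `(c0 + c1 ζ + c2 ζ² + c3 ζ³) / √3`. -/
structure Pt where
  c0 : ℤ
  c1 : ℤ
  c2 : ℤ
  c3 : ℤ

namespace Pt

def toC (p : Pt) : ℂ := (p.c0 + p.c1 * ζ + p.c2 * ζ ^ 2 + p.c3 * ζ ^ 3) / (√3 : ℝ)

def add (p q : Pt) : Pt := ⟨p.c0 + q.c0, p.c1 + q.c1, p.c2 + q.c2, p.c3 + q.c3⟩

def sub (p q : Pt) : Pt := ⟨p.c0 - q.c0, p.c1 - q.c1, p.c2 - q.c2, p.c3 - q.c3⟩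

/-- Rotation by 30° about the origin. -/
def turn (p : Pt) : Pt := ⟨-p.c3, p.c0, p.c1 + p.c3, p.c2⟩

/-- Rotation by `n * 30°` about the origin. -/
def rot (p : Pt) : ℕ → Pt
  | 0 => p
  | n + 1 => (p.rot n).turn

/-- An integer with the sign of the imaginary part of the point. -/
def imSign (p : Pt) : ℤ := (p.c1 + 2 * p.c3) * |p.c1 + 2 * p.c3| + 3 * (p.c2 * |p.c2|)

lemma toC_add (p q : Pt) : (p.add q).toC = p.toC + q.toC := by
  simp only [toC, add]; push_cast; ring

lemma toC_sub (p q : Pt) : (p.sub q).toC = p.toC - q.toC := by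
  simp only [toC, sub]; push_cast; ring

lemma toC_turn (p : Pt) : p.turn.toC = ζ * p.toC := by
  simp only [toC, turn]; push_cast
  have h := ζ_pow_four
  rw [mul_div_assoc']
  congr 1
  linear_combination (-(p.c3 : ℂ)) * h

lemma toC_rot (p : Pt) (n : ℕ) : (p.rot n).toC = ζ ^ n * p.toC := by
  induction n with
  | zero => simp [rot]
  | succ n ih => rw [rot, toC_turn, ih]; ring

lemma toC_im (p : Pt) : p.toC.im = ((p.c1 + 2 * p.c3 : ℤ) + (p.c2 : ℤ) * √3) / (2 * √3) := by
  have h := sqrt_three_pos.ne'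
  rw [toC, Complex.div_ofReal_im, ζ_sq, ζ_cube]
  simp [ζ, ω]
  field_simp
  ring

end Pt

lemma sign_sqrt_three (a b : ℤ) :
    (0 < a * |a| + 3 * (b * |b|) → 0 < (a : ℝ) + b * √3) ∧
    (a * |a| + 3 * (b * |b|) = 0 → (a : ℝ) + b * √3 = 0) ∧
    (a * |a| + 3 * (b * |b|) < 0 → (a : ℝ) + b * √3 < 0) := by
  have mono : StrictMono fun x : ℝ => x * |x| := by
    intro x y hxy
    rcases le_total 0 x with hx | hx <;> rcases le_total 0 y with hy | hy <;>
      simp only [abs_of_nonneg, abs_of_nonpos, hx, hy]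
    · nlinarith
    · nlinarith
    · rcases hx.lt_or_eq with h | h
      · nlinarith
      · subst h; nlinarith
    · nlinarith
  have hb : (-(b * √3)) * |(-(b * √3))| = -(3 * ((b : ℝ) * |(b : ℝ)|)) := by
    rw [abs_neg, abs_mul, abs_of_pos sqrt_three_pos]
    linear_combination (-(b : ℝ) * |(b : ℝ)|) * sqrt_three_mul_self
  have key : (((a * |a| + 3 * (b * |b|) : ℤ)) : ℝ) =
      (a : ℝ) * |(a : ℝ)| - (-(b * √3)) * |(-(b * √3))| := by
    rw [hb]; push_cast; ring
  refine ⟨fun h => ?_, fun h => ?_, fun h => ?_⟩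
  · have h' : (0 : ℝ) < ((a * |a| + 3 * (b * |b|) : ℤ) : ℝ) := by exact_mod_cast h
    rw [key] at h'
    have := mono.lt_iff_lt.1 (sub_pos.1 h')
    linarith
  · rw [h] at key
    have := mono.injective (show (fun x : ℝ => x * |x|) a = (fun x : ℝ => x * |x|) (-(b * √3)) by
      simp only; push_cast at key; linarith)
    linarith
  · have h' : ((a * |a| + 3 * (b * |b|) : ℤ) : ℝ) < 0 := by exact_mod_cast h
    rw [key] at h'
    have := mono.lt_iff_lt.1 (sub_neg.1 h')
    linarith

lemma Pt.imSign_pos {p : Pt} (h : 0 < p.imSign) : 0 < p.toC.im := by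
  rw [Pt.toC_im]
  exact div_pos ((sign_sqrt_three _ _).1 h) (by have := sqrt_three_pos; positivity)

lemma Pt.imSign_zero {p : Pt} (h : p.imSign = 0) : p.toC.im = 0 := by
  rw [Pt.toC_im, (sign_sqrt_three _ _).2.1 h, zero_div]

lemma Pt.imSign_neg {p : Pt} (h : p.imSign < 0) : p.toC.im < 0 := by
  rw [Pt.toC_im]
  exact div_neg_of_neg_of_pos ((sign_sqrt_three _ _).2.2 h) (by have := sqrt_three_pos; positivity)

/-! ### Polygons as intersections of half-planes -/

/-- An oriented line: a point on it and its direction `ζ ^ d`. -/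
abbrev Line := Pt × ℕ

/-- The signed distance of `z` from the line, positive on its left. -/
def Line.val (l : Line) (z : ℂ) : ℝ := ((z - l.1.toC) * conj (ζ ^ l.2)).im

/-- The closed convex polygon to the left of the given lines. -/
def polySet (P : List Line) : Set ℂ := {z | ∀ l ∈ P, 0 ≤ Line.val l z}

/-- The open convex polygon to the left of the given lines. -/
def polyInt (P : List Line) : Set ℂ := {z | ∀ l ∈ P, 0 < Line.val l z}

lemma Line.val_add (l : Line) (z w : ℂ) : l.val (z + w) = l.val z + (w * conj (ζ ^ l.2)).im := by
  rw [Line.val, Line.val, ← Complex.add_im]; ring_nf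

lemma Line.val_add_smul (l : Line) (z w : ℂ) (t : ℝ) :
    l.val (z + t * w) = l.val z + t * (w * conj (ζ ^ l.2)).im := by
  rw [Line.val_add, mul_assoc, Complex.im_ofReal_mul]

lemma Line.continuous_val (l : Line) : Continuous l.val := by
  unfold Line.val; fun_prop

lemma polyInt_subset (P : List Line) : polyInt P ⊆ polySet P := fun _ h l hl => (h l hl).le

lemma isClosed_polySet (P : List Line) : IsClosed (polySet P) := by
  simp only [polySet, Set.ofPred_forall]
  exact isClosed_iInter fun l => isClosed_iInter fun _ =>
    isClosed_le continuous_const l.continuous_val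

lemma isOpen_polyInt (P : List Line) : IsOpen (polyInt P) := by
  have : polyInt P = ⋂ l ∈ {l | l ∈ P}, {z | 0 < Line.val l z} := by
    ext; simp [polyInt]
  rw [this]
  exact (List.finite_toSet P).isOpen_biInter fun l _ => isOpen_lt continuous_const l.continuous_val

lemma polyInt_subset_interior (P : List Line) : polyInt P ⊆ interior (polySet P) :=
  interior_maximal (polyInt_subset P) (isOpen_polyInt P)

lemma Line.val_combo (l : Line) (z w : ℂ) (t : ℝ) :
    l.val (z + t * (w - z)) = (1 - t) * l.val z + t * l.val w := by
  have h : (w - z) * conj (ζ ^ l.2) = (w - l.1.toC) * conj (ζ ^ l.2) - (z - l.1.toC) * conj (ζ ^ l.2) := by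
    ring
  rw [Line.val_add_smul, h, Complex.sub_im, Line.val, Line.val]
  ring

lemma polySet_subset_closure {P : List Line} {q : ℂ} (hq : q ∈ polyInt P) :
    polySet P ⊆ closure (polyInt P) := by
  intro z hz
  have hlim : Tendsto (fun t : ℝ => z + t * (q - z)) (𝓝[>] 0) (𝓝 z) := by
    have : Continuous (fun t : ℝ => z + t * (q - z)) := by fun_prop
    have h := this.tendsto 0
    simp only [Complex.ofReal_zero, zero_mul, add_zero] at h
    exact h.mono_left nhdsWithin_le_nhds
  refine mem_closure_of_tendsto hlim ?_
  filter_upwards [Ioo_mem_nhdsGT (zero_lt_one' ℝ)] with t ht l hl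
  rw [Line.val_combo]
  have := hz l hl
  have := hq l hl
  have := ht.1
  have := ht.2
  have : 0 ≤ 1 - t := by linarith
  positivity

lemma convex_polySet (P : List Line) : Convex ℝ (polySet P) := by
  intro z hz w hw a b ha hb hab l hl
  have h : a • z + b • w = z + (b : ℝ) * (w - z) := by
    simp only [Complex.real_smul]
    have : (a : ℂ) = 1 - b := by
      rw [← Complex.ofReal_one, ← hab]; push_cast; ring
    rw [this]; ring
  rw [h, Line.val_combo]
  have := hz l hl
  have := hw l hl
  have : 0 ≤ 1 - b := by linarith
  positivity

/-! ### Germs of polygons at a point -/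

/-- The open cone of the directions between `ζ ^ j` and `ζ ^ (j + 1)`. -/
def sector (j : ℕ) : Set ℂ := {w | ∃ s t : ℝ, 0 < s ∧ 0 < t ∧ w = ζ ^ j * (s + t * ζ)}

/-- Whether the polygon contains the germ at `p` of the sector with index `j`. -/
def covers (P : List Line) (p : Pt) (j : ℕ) : Bool :=
  P.all fun l =>
    (0 < ((p.sub l.1).rot (12 - l.2 % 12)).imSign) ||
    (((p.sub l.1).rot (12 - l.2 % 12)).imSign == 0 && (j + (12 - l.2 % 12)) % 12 < 6)

lemma Line.val_toC (l : Line) (p : Pt) :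
    l.val p.toC = ((p.sub l.1).rot (12 - l.2 % 12)).toC.im := by
  rw [Line.val, Pt.toC_rot, Pt.toC_sub, conj_ζ_pow, mul_comm]

lemma sector_mul_im {j d : ℕ} {w : ℂ} (hw : w ∈ sector j) :
    ((j + (12 - d % 12)) % 12 < 6 → 0 < (w * conj (ζ ^ d)).im) ∧
    (¬ (j + (12 - d % 12)) % 12 < 6 → (w * conj (ζ ^ d)).im < 0) := by
  obtain ⟨s, t, hs, ht, rfl⟩ := hw
  have h1 : ζ ^ j * (s + t * ζ) * conj (ζ ^ d) =
      s * ζ ^ ((j + (12 - d % 12)) % 12) + t * ζ ^ ((j + (12 - d % 12)) % 12 + 1) := by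
    rw [conj_ζ_pow, pow_succ, ζ_pow_mod, pow_add]; ring
  rw [h1]
  have hr : (j + (12 - d % 12)) % 12 < 12 := Nat.mod_lt _ (by norm_num)
  generalize (j + (12 - d % 12)) % 12 = r at *
  have him : ∀ n : ℕ, (s * ζ ^ n + t * ζ ^ (n + 1)).im = s * (ζ ^ n).im + t * (ζ ^ (n + 1)).im := by
    intro n; simp only [Complex.add_im, Complex.im_ofReal_mul]
  have key : ∀ n : ℕ, n < 6 → 0 < s * (ζ ^ n).im + t * (ζ ^ (n + 1)).im := by
    intro n hn
    rcases Nat.eq_zero_or_pos n with rfl | hn0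
    · have := mul_pos ht (ζ_pow_im_pos (r := 0 + 1) (by norm_num) (by norm_num))
      simpa using this
    · exact add_pos_of_pos_of_nonneg (mul_pos hs (ζ_pow_im_pos hn0 hn))
        (mul_nonneg ht.le (ζ_pow_im_nonneg (by omega)))
  rw [him]
  refine ⟨key r, fun h => ?_⟩
  obtain ⟨n, rfl⟩ : ∃ n, r = 6 + n := ⟨r - 6, by omega⟩
  have := key n (by omega)
  rw [add_assoc, pow_add, pow_add, ζ_pow_six, neg_one_mul, neg_one_mul, Complex.neg_im,
    Complex.neg_im]
  linarith

lemma covers_iff {P : List Line} {p : Pt} {j : ℕ} : covers P p j = true ↔ ∀ l ∈ P,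
    0 < ((p.sub l.1).rot (12 - l.2 % 12)).imSign ∨
    (((p.sub l.1).rot (12 - l.2 % 12)).imSign = 0 ∧ (j + (12 - l.2 % 12)) % 12 < 6) := by
  simp [covers]

lemma eventually_mem_of_covers {P : List Line} {p : Pt} {j : ℕ} (h : covers P p j = true) {w : ℂ}
    (hw : w ∈ sector j) : ∀ᶠ t : ℝ in 𝓝[>] 0, p.toC + t * w ∈ polyInt P := by
  have : ∀ l ∈ {l | l ∈ P}, ∀ᶠ t : ℝ in 𝓝[>] 0, 0 < l.val (p.toC + t * w) := by
    intro l hl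
    rcases covers_iff.1 h l hl with h | ⟨h, h'⟩
    · have hp : 0 < l.val p.toC := by rw [Line.val_toC]; exact Pt.imSign_pos h
      have hc : Continuous (fun t : ℝ => l.val (p.toC + t * w)) := by
        unfold Line.val; fun_prop
      have := (hc.tendsto 0).eventually_const_lt (u := 0) (by simpa using hp)
      exact this.filter_mono nhdsWithin_le_nhds
    · filter_upwards [self_mem_nhdsWithin] with t ht
      rw [Line.val_add_smul, Line.val_toC, Pt.imSign_zero h, zero_add]
      exact mul_pos ht ((sector_mul_im hw).1 h')
  exact (eventually_all_finite (List.finite_toSet P)).2 this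

lemma eventually_notMem_of_not_covers {P : List Line} {p : Pt} {j : ℕ}
    (h : covers P p j = false) {w : ℂ} (hw : w ∈ sector j) :
    ∀ᶠ t : ℝ in 𝓝[>] 0, p.toC + t * w ∉ polySet P := by
  have h' : ¬ covers P p j = true := by simp [h]
  rw [covers_iff] at h'
  push Not at h'
  obtain ⟨l, hl, h1, h2⟩ := h'
  suffices ∀ᶠ t : ℝ in 𝓝[>] 0, l.val (p.toC + t * w) < 0 by
    filter_upwards [this] with t ht hmem
    exact absurd (hmem l hl) (not_le.2 ht)
  rcases h1.lt_or_eq with h1 | h1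
  · have hp : l.val p.toC < 0 := by rw [Line.val_toC]; exact Pt.imSign_neg h1
    have hc : Continuous (fun t : ℝ => l.val (p.toC + t * w)) := by
      unfold Line.val; fun_prop
    have := (hc.tendsto 0).eventually_lt_const (u := 0) (by simpa using hp)
    exact this.filter_mono nhdsWithin_le_nhds
  · filter_upwards [self_mem_nhdsWithin] with t ht
    rw [Line.val_add_smul, Line.val_toC, Pt.imSign_zero h1, zero_add]
    exact mul_neg_of_pos_of_neg ht ((sector_mul_im hw).2 (not_lt.2 (h2 h1)))

/-! ### The TH-pentagon and its congruent copies -/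

/-- The TH-pentagon and its mirror image, in counterclockwise order. -/
def base : Bool → List Line
  | false => [(⟨0, 0, 0, 0⟩, 0), (⟨0, 2, 0, -1⟩, 3), (⟨0, 2, 0, 0⟩, 5), (⟨0, 1, 0, 1⟩, 6),
      (⟨0, -1, 0, 2⟩, 10)]
  | true => [(⟨0, 0, 0, 0⟩, 8), (⟨0, -1, 0, -1⟩, 0), (⟨0, 1, 0, -2⟩, 1), (⟨0, 2, 0, -2⟩, 3),
      (⟨0, 2, 0, -1⟩, 6)]

lemma Pt.toC_re (p : Pt) : p.toC.re = ((2 * p.c0 + p.c2 : ℤ) + (p.c1 : ℤ) * √3) / (2 * √3) := by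
  have h := sqrt_three_pos.ne'
  rw [Pt.toC, Complex.div_ofReal_re, ζ_sq, ζ_cube]
  simp [ζ, ω]
  field_simp
  ring

lemma ζ_pow_re_im : ((ζ ^ 0).re = 1 ∧ (ζ ^ 0).im = 0) ∧ ((ζ ^ 1).re = √3 / 2 ∧ (ζ ^ 1).im = 1 / 2) ∧
    ((ζ ^ 3).re = 0 ∧ (ζ ^ 3).im = 1) ∧ ((ζ ^ 5).re = -(√3 / 2) ∧ (ζ ^ 5).im = 1 / 2) ∧
    ((ζ ^ 6).re = -1 ∧ (ζ ^ 6).im = 0) ∧ ((ζ ^ 8).re = -(1 / 2) ∧ (ζ ^ 8).im = -(√3 / 2)) ∧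
    ((ζ ^ 10).re = 1 / 2 ∧ (ζ ^ 10).im = -(√3 / 2)) := by
  refine ⟨by simp, by simp [ζ], by simp [ζ_cube], ?_, by simp [ζ_pow_six], ?_, ?_⟩
  · rw [show ζ ^ 5 = ζ ^ 3 * ζ ^ 2 by ring, ζ_cube, ζ_sq]; simp [ω]
  · rw [show ζ ^ 8 = ζ ^ 6 * ζ ^ 2 by ring, ζ_pow_six, ζ_sq]; simp [ω]
  · rw [show ζ ^ 10 = ζ ^ 6 * ζ ^ 4 by ring, ζ_pow_six, ζ_pow_four, ζ_sq]; simp [ω]; norm_num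

lemma Line.val_eq (l : Line) (z : ℂ) :
    l.val z = (z.im - l.1.toC.im) * (ζ ^ l.2).re - (z.re - l.1.toC.re) * (ζ ^ l.2).im := by
  simp only [Line.val, Complex.mul_im, Complex.sub_re, Complex.sub_im, Complex.conj_re,
    Complex.conj_im]
  ring

lemma base_false_val (z : ℂ) : (base false).map (fun l => l.val z) =
    [z.im, 1 - z.re, 1 - z.re / 2 - √3 / 2 * z.im, √3 / 2 - z.im, √3 / 2 * z.re + z.im / 2] := by
  obtain ⟨⟨a0, b0⟩, -, ⟨a3, b3⟩, ⟨a5, b5⟩, ⟨a6, b6⟩, -, a10, b10⟩ := ζ_pow_re_im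
  have h := sqrt_three_pos.ne'
  have h3 : √3 ^ 2 = 3 := by rw [pow_two, sqrt_three_mul_self]
  simp only [base, List.map_cons, List.map_nil, Line.val_eq, Pt.toC_im, Pt.toC_re, a0, b0, a3, b3,
    a5, b5, a6, b6, a10, b10, List.cons.injEq, and_true]
  push_cast
  refine ⟨?_, ?_, ?_, ?_, ?_⟩ <;> field_simp <;> ring_nf <;> (try rw [h3]) <;> ring

lemma base_true_val (z : ℂ) : (base true).map (fun l => l.val z) =
    [√3 / 2 * z.re - z.im / 2, √3 / 2 + z.im, 1 - z.re / 2 + √3 / 2 * z.im, 1 - z.re, -z.im] := by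
  obtain ⟨⟨a0, b0⟩, ⟨a1, b1⟩, ⟨a3, b3⟩, -, ⟨a6, b6⟩, ⟨a8, b8⟩, -⟩ := ζ_pow_re_im
  have h := sqrt_three_pos.ne'
  have h3 : √3 ^ 2 = 3 := by rw [pow_two, sqrt_three_mul_self]
  simp only [base, List.map_cons, List.map_nil, Line.val_eq, Pt.toC_im, Pt.toC_re, a0, b0, a1, b1,
    a3, b3, a6, b6, a8, b8, List.cons.injEq, and_true]
  push_cast
  refine ⟨?_, ?_, ?_, ?_, ?_⟩ <;> field_simp <;> ring_nf <;> (try rw [h3]) <;> ring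

lemma forall_base {f : Bool} {z : ℂ} {P : ℝ → Prop} :
    (∀ l ∈ base f, P (l.val z)) ↔ ∀ x ∈ (base f).map (fun l => l.val z), P x :=
  List.forall_mem_map.symm

lemma mem_polySet_base_false {z : ℂ} : z ∈ polySet (base false) ↔
    0 ≤ z.im ∧ 0 ≤ 1 - z.re ∧ 0 ≤ 1 - z.re / 2 - √3 / 2 * z.im ∧ 0 ≤ √3 / 2 - z.im ∧
      0 ≤ √3 / 2 * z.re + z.im / 2 := by
  rw [polySet, Set.mem_ofPred_eq, forall_base (P := fun x => 0 ≤ x), base_false_val]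
  simp only [List.forall_mem_cons, List.not_mem_nil, false_imp_iff, implies_true, and_true]

lemma mem_polySet_base_true {z : ℂ} : z ∈ polySet (base true) ↔ conj z ∈ polySet (base false) := by
  rw [mem_polySet_base_false, polySet, Set.mem_ofPred_eq, forall_base (P := fun x => 0 ≤ x),
    base_true_val]
  simp only [List.forall_mem_cons, List.not_mem_nil, false_imp_iff, implies_true, and_true,
    Complex.conj_re, Complex.conj_im]
  constructor
  · rintro ⟨h1, h2, h3, h4, h5⟩
    refine ⟨?_, ?_, ?_, ?_, ?_⟩ <;> linarith
  · rintro ⟨h1, h2, h3, h4, h5⟩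
    refine ⟨?_, ?_, ?_, ?_, ?_⟩ <;> linarith

lemma _root_.Convex.triple_mem {s : Set ℂ} (hs : Convex ℝ s) {x y z : ℂ} (hx : x ∈ s) (hy : y ∈ s)
    (hz : z ∈ s) {a b c : ℝ} (ha : 0 ≤ a) (hb : 0 ≤ b) (hc : 0 ≤ c) (habc : a + b + c = 1) :
    a * x + b * y + c * z ∈ s := by
  have := hs.sum_mem (t := Finset.univ) (w := ![a, b, c]) (z := ![x, y, z])
    (by intro i _; fin_cases i <;> simpa) (by simp [Fin.sum_univ_three, habc])
    (by intro i _; fin_cases i <;> simpa)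
  simpa [Fin.sum_univ_three] using this

lemma thPentagon_eq : thPentagon = polySet (base false) := by
  have h0 := sqrt_three_pos
  have h3 := sqrt_three_mul_self
  apply Set.Subset.antisymm
  · refine convexHull_min ?_ (convex_polySet _)
    rintro z (rfl | rfl | rfl | rfl | rfl) <;> rw [mem_polySet_base_false]
    · simp; refine ⟨?_, ?_⟩ <;> nlinarith
    · simp; positivity
    · rw [pow_two]; simp [ω]; refine ⟨?_, ?_, ?_, ?_, ?_⟩ <;> nlinarith
    · simp only [ω]; refine ⟨?_, ?_, ?_, ?_, ?_⟩ <;> nlinarith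
    · have h1 : (2 * (1 + ω) / 3).re = 1 := by
        rw [show (3 : ℂ) = (3 : ℝ) by norm_num, Complex.div_ofReal_re]; simp [ω]; norm_num
      have h2 : (2 * (1 + ω) / 3).im = √3 / 3 := by
        rw [show (3 : ℂ) = (3 : ℝ) by norm_num, Complex.div_ofReal_im]; simp [ω]; ring
      rw [h1, h2]
      refine ⟨?_, ?_, ?_, ?_, ?_⟩ <;> nlinarith
  · intro z hz
    rw [mem_polySet_base_false] at hz
    obtain ⟨h1, h2, h3', h4, h5⟩ := hz
    obtain ⟨x, y, hx, hy⟩ : ∃ x y : ℝ, z.re = x + y / 2 ∧ z.im = √3 / 2 * y :=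
      ⟨z.re - z.im / √3, 2 * z.im / √3, by field_simp; ring, by field_simp⟩
    have hzz : z = x + y * ω := by
      apply Complex.ext <;> simp [ω, hx, hy] <;> ring
    have e1 : 0 ≤ y := by
      rw [hy] at h1; exact nonneg_of_mul_nonneg_right h1 (by positivity)
    have e2 : 0 ≤ 1 - x - y / 2 := by linarith
    have e3 : 0 ≤ 2 - x - 2 * y := by
      rw [hx, hy] at h3'; nlinarith
    have e4 : y ≤ 1 := by
      rw [hy] at h4; nlinarith
    have e5 : 0 ≤ x + y := by
      rw [hx, hy] at h5
      have : √3 / 2 * (x + y / 2) + √3 / 2 * y / 2 = √3 / 2 * (x + y) := by ring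
      rw [this] at h5
      exact nonneg_of_mul_nonneg_right h5 (by positivity)
    have hc := convex_convexHull ℝ ({1, 0, ω ^ 2, ω, 2 * (1 + ω) / 3} : Set ℂ)
    have hs := subset_convexHull ℝ ({1, 0, ω ^ 2, ω, 2 * (1 + ω) / 3} : Set ℂ)
    have hA := hs (show (1 : ℂ) ∈ _ by simp)
    have hB := hs (show (0 : ℂ) ∈ _ by simp)
    have hC := hs (show ω ^ 2 ∈ _ by simp)
    have hD := hs (show ω ∈ _ by simp)
    have hE := hs (show 2 * (1 + ω) / 3 ∈ _ by simp)
    have hω : ω ^ 2 = ω - 1 := by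
      rw [← ζ_sq, ← pow_mul]; exact ζ_pow_four
    rcases le_total x 0 with hx0 | hx0
    · have := hc.triple_mem hB hC hD (a := 1 - y) (b := -x) (c := x + y)
        (by linarith) (by linarith) (by linarith) (by ring)
      refine Set.mem_of_eq_of_mem ?_ this
      rw [hzz, hω]; push_cast; ring
    · rcases le_total (x + y) 1 with hxy | hxy
      · have := hc.triple_mem hB hA hD (a := 1 - x - y) (b := x) (c := y)
          (by linarith) (by linarith) (by linarith) (by ring)
        refine Set.mem_of_eq_of_mem ?_ this
        rw [hzz]; push_cast; ring
      · have := hc.triple_mem hA hD hE (a := 2 - x - 2 * y) (b := 2 - 2 * x - y)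
          (c := 3 * (x + y - 1))
          (by linarith) (by linarith) (by linarith) (by ring)
        refine Set.mem_of_eq_of_mem ?_ this
        rw [hzz]; push_cast; ring

/-- A congruent copy of the TH-pentagon: the image under `z ↦ pos + ζ ^ rot * z`, after a
reflection in the real axis if `flip` is true. -/
structure Placement where
  pos : Pt
  rot : ℕ
  flip : Bool

namespace Placement

def poly (g : Placement) : List Line :=
  (base g.flip).map fun l => (g.pos.add (l.1.rot g.rot), l.2 + g.rot)

def map (g : Placement) (z : ℂ) : ℂ := g.pos.toC + ζ ^ g.rot * if g.flip then conj z else z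

end Placement

/-- The image of the pentagon or its mirror image under `z ↦ b + a z`. -/
def movedSet (f : Bool) (a b : ℂ) : Set ℂ := {z | conj a * (z - b) ∈ polySet (base f)}

def movedInt (f : Bool) (a b : ℂ) : Set ℂ := {z | conj a * (z - b) ∈ polyInt (base f)}

lemma Placement.val_poly (g : Placement) (l : Line) (z : ℂ) :
    Line.val (g.pos.add (l.1.rot g.rot), l.2 + g.rot) z =
      l.val (conj (ζ ^ g.rot) * (z - g.pos.toC)) := by
  simp only [Line.val, Pt.toC_add, Pt.toC_rot, pow_add, map_mul]
  congr 1
  have := ζ_pow_mul_conj g.rot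
  linear_combination (-l.1.toC * conj (ζ ^ l.2)) * this

lemma Placement.polySet_poly (g : Placement) :
    polySet g.poly = movedSet g.flip (ζ ^ g.rot) g.pos.toC := by
  ext z
  simp only [polySet, movedSet, Placement.poly, List.forall_mem_map, Placement.val_poly]
  rfl

lemma unit_mul_conj {a : ℂ} (ha : ‖a‖ = 1) : a * conj a = 1 := by
  rw [Complex.mul_conj, Complex.normSq_eq_norm_sq, ha]; norm_num

lemma image_thPentagon {f : Bool} {a b : ℂ} (ha : ‖a‖ = 1) :
    (fun z => b + a * if f then conj z else z) '' thPentagon = movedSet f a b := by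
  have h := unit_mul_conj ha
  ext z
  simp only [Set.mem_image, movedSet, Set.mem_ofPred_eq, thPentagon_eq]
  have key : ∀ w : ℂ, conj a * (b + a * w - b) = w := fun w => by
    linear_combination w * h
  constructor
  · rintro ⟨w, hw, rfl⟩
    rw [key]
    cases f
    · simpa using hw
    · simpa [mem_polySet_base_true] using hw
  · intro hz
    refine ⟨if f then conj (conj a * (z - b)) else conj a * (z - b), ?_, ?_⟩
    · cases f
      · simpa using hz
      · simpa [mem_polySet_base_true] using hz
    · cases f
      · simp only [Bool.false_eq_true, if_false]
        linear_combination (z - b) * h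
      · simp only [if_true, Complex.conj_conj]
        linear_combination (z - b) * h

lemma Placement.image (g : Placement) : g.map '' thPentagon = polySet g.poly := by
  rw [Placement.polySet_poly, ← image_thPentagon (norm_ζ_pow _)]
  rfl

lemma exists_isometry_form (e : ℂ ≃ᵢ ℂ) : ∃ (f : Bool) (a b : ℂ), ‖a‖ = 1 ∧
    ∀ z, e z = b + a * if f then conj z else z := by
  have h : ∃ L : ℂ ≃ₗᵢ[ℝ] ℂ, ∀ z, e z = L z + e 0 := by
    refine ⟨e.toRealLinearIsometryEquiv, fun z => ?_⟩
    simp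
  obtain ⟨L, hL⟩ := h
  obtain ⟨a, ha⟩ := linear_isometry_complex L
  rcases ha with rfl | rfl
  · exact ⟨false, a, e 0, Circle.norm_coe a, fun z => by rw [hL]; simp [add_comm]⟩
  · exact ⟨true, a, e 0, Circle.norm_coe a, fun z => by rw [hL]; simp [add_comm]⟩

/-! ### The corner lemma -/

lemma im_mul_sector (γ : ℂ) (s t : ℝ) :
    (γ * (ζ ^ 11 * (s + t * ζ))).im = s * (γ.im * √3 / 2 - γ.re / 2) + t * γ.im ∧
    (γ * (ζ ^ 5 * (s + t * ζ))).im = -(s * (γ.im * √3 / 2 - γ.re / 2) + t * γ.im) := by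
  have h5 : ζ ^ 5 = ⟨-(√3 / 2), 1 / 2⟩ := by
    obtain ⟨-, -, -, ⟨a5, b5⟩, -⟩ := ζ_pow_re_im
    exact Complex.ext a5 b5
  have h11 : ζ ^ 11 = -ζ ^ 5 := by rw [show ζ ^ 11 = ζ ^ 6 * ζ ^ 5 by ring, ζ_pow_six]; ring
  have h3 := sqrt_three_mul_self
  have key : (γ * (ζ ^ 5 * (s + t * ζ))).im = -(s * (γ.im * √3 / 2 - γ.re / 2) + t * γ.im) := by
    rw [h5]
    simp [ζ]
    linear_combination (-t * γ.im / 4) * h3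
  refine ⟨?_, key⟩
  rw [h11, neg_mul, mul_neg, Complex.neg_im, key, neg_neg]

lemma no_halfplane {γ : ℂ} (hγ : ‖γ‖ = 1)
    (h1 : ∀ s t : ℝ, 0 < s → 0 < t → (γ * (ζ ^ 11 * (s + t * ζ))).im ≤ 0)
    (h2 : ∀ s t : ℝ, 0 < s → 0 < t → (γ * (ζ ^ 5 * (s + t * ζ))).im ≤ 0) : False := by
  simp only [(im_mul_sector _ _ _).1, (im_mul_sector _ _ _).2] at h1 h2
  have a1 := h1 1 1 one_pos one_pos
  have a2 := h2 1 1 one_pos one_pos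
  have b1 := h1 1 2 one_pos two_pos
  have b2 := h2 1 2 one_pos two_pos
  have him : γ.im = 0 := by linarith
  have hre : γ.re = 0 := by rw [him] at a1 a2; linarith
  have : γ = 0 := Complex.ext hre him
  simp [this] at hγ

lemma unit_eq_of_im_eq_zero {γ : ℂ} (hγ : ‖γ‖ = 1) (h : γ.im = 0) : γ = 1 ∨ γ = -1 := by
  have h1 : γ.re * γ.re + γ.im * γ.im = 1 := by
    have := Complex.normSq_apply γ
    rw [Complex.normSq_eq_norm_sq, hγ] at this
    linarith
  have : (γ.re - 1) * (γ.re + 1) = 0 := by rw [h] at h1; linarith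
  rcases mul_eq_zero.1 this with h2 | h2
  · left; apply Complex.ext <;> simp [h]; linarith
  · right; apply Complex.ext <;> simp [h]; linarith

lemma wedge_edge {γ : ℂ} (hγ : ‖γ‖ = 1) {r : ℕ} (hr0 : 0 < r) (hr : r < 5)
    (h1 : 0 ≤ (γ * ζ ^ r).im) (h2 : 0 ≤ γ.im)
    (h : ∀ s t : ℝ, 0 < s → 0 < t → (γ * ζ ^ r * (ζ ^ 11 * (s + t * ζ))).im ≤ 0 ∨
      (γ * (ζ ^ 11 * (s + t * ζ))).im ≤ 0) : γ = 1 := by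
  have hn : ‖γ * ζ ^ r‖ = 1 := by rw [norm_mul, norm_ζ_pow, hγ, one_mul]
  have bound : ∀ {δ : ℂ}, ‖δ‖ = 1 → -1 ≤ δ.im * √3 / 2 - δ.re / 2 := by
    intro δ hδ
    have h1 := Complex.normSq_apply δ
    rw [Complex.normSq_eq_norm_sq, hδ] at h1
    nlinarith [sq_nonneg (δ.im + √3 / 2), sq_nonneg (δ.re - 1 / 2), sqrt_three_mul_self]
  have zero : (γ * ζ ^ r).im = 0 ∨ γ.im = 0 := by
    by_contra hne
    push Not at hne
    have p1 := h1.lt_of_ne' hne.1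
    have p2 := h2.lt_of_ne' hne.2
    have hs : 0 < min (γ * ζ ^ r).im γ.im / 2 := by positivity
    have l1 := min_le_left (γ * ζ ^ r).im γ.im
    have l2 := min_le_right (γ * ζ ^ r).im γ.im
    rcases h _ 1 hs one_pos with h | h <;> rw [(im_mul_sector _ _ _).1] at h
    · nlinarith [mul_le_mul_of_nonneg_left (bound hn) hs.le]
    · nlinarith [mul_le_mul_of_nonneg_left (bound hγ) hs.le]
  have pos := ζ_pow_im_pos hr0 (by omega : r < 6)
  rcases zero with h0 | h0
  · exfalso
    rcases unit_eq_of_im_eq_zero hn h0 with h3 | h3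
    · have : γ = conj (ζ ^ r) := by
        have := ζ_pow_mul_conj r
        linear_combination conj (ζ ^ r) * h3 - γ * this
      rw [this, Complex.conj_im] at h2
      linarith
    · have hγ' : γ = -conj (ζ ^ r) := by
        have := ζ_pow_mul_conj r
        linear_combination conj (ζ ^ r) * h3 - γ * this
      have h4 : γ * ζ ^ 11 = ζ ^ (5 - r) := by
        have e : ζ ^ (5 - r) * ζ ^ r = ζ ^ 5 := by rw [← pow_add]; congr 1; omega
        have := ζ_pow_mul_conj r
        have h11 : ζ ^ 11 = -ζ ^ 5 := by rw [show ζ ^ 11 = ζ ^ 6 * ζ ^ 5 by ring, ζ_pow_six]; ring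
        rw [hγ', h11, ← e]
        linear_combination ζ ^ (5 - r) * this
      rcases h 1 1 one_pos one_pos with h | h
      · rw [h3, (im_mul_sector _ _ _).1] at h
        norm_num at h
      · have e : γ * (ζ ^ 11 * ((1 : ℝ) + (1 : ℝ) * ζ)) = ζ ^ (5 - r) + ζ ^ (5 - r + 1) := by
          rw [← mul_assoc, h4, pow_succ]; push_cast; ring
        rw [e, Complex.add_im] at h
        have := ζ_pow_im_pos (r := 5 - r) (by omega) (by omega)
        have := ζ_pow_im_pos (r := 5 - r + 1) (by omega) (by omega)
        linarith
  · rcases unit_eq_of_im_eq_zero hγ h0 with h3 | h3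
    · exact h3
    · rw [h3, neg_one_mul, Complex.neg_im] at h1
      linarith

/-- `m` follows `l` as a side of a polygon with an exterior angle of at most 120° at the corner. -/
def IsCorner (l m : Line) : Prop :=
  l.val m.1.toC = 0 ∧ ∃ r, 0 < r ∧ r < 5 ∧ ζ ^ m.2 = ζ ^ l.2 * ζ ^ r

lemma IsCorner.eq {l m : Line} (h : IsCorner l m) {q : ℂ} (hl : l.val q = 0) (hm : m.val q = 0) :
    q = m.1.toC := by
  obtain ⟨h0, r, hr0, hr, hlm⟩ := h
  have e1 : ((q - m.1.toC) * conj (ζ ^ l.2)).im = 0 := by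
    have := l.val_add m.1.toC (q - m.1.toC)
    rw [add_sub_cancel, hl, h0] at this
    linarith
  have e2 : ((q - m.1.toC) * conj (ζ ^ l.2) * conj (ζ ^ r)).im = 0 := by
    have : m.val q = ((q - m.1.toC) * conj (ζ ^ m.2)).im := rfl
    rw [hlm, map_mul, ← mul_assoc, hm] at this
    exact this.symm
  have hpos := ζ_pow_im_pos hr0 (by omega : r < 6)
  have e3 : (q - m.1.toC) * conj (ζ ^ l.2) = 0 := by
    refine Complex.ext ?_ e1
    rw [Complex.mul_im, e1, Complex.conj_im] at e2
    have : ((q - m.1.toC) * conj (ζ ^ l.2)).re * (ζ ^ r).im = 0 := by linarith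
    exact (mul_eq_zero.1 this).resolve_right hpos.ne'
  have := (mul_eq_zero.1 e3).resolve_right (by simpa using ζ_pow_ne_zero l.2)
  linear_combination this

lemma polygon_trichotomy {l₀ l₁ l₂ l₃ l₄ : Line} {q : ℂ}
    (c₀ : IsCorner l₀ l₁) (c₁ : IsCorner l₁ l₂) (c₂ : IsCorner l₂ l₃) (c₃ : IsCorner l₃ l₄)
    (c₄ : IsCorner l₄ l₀) (n₀ : ¬ (l₀.val q = 0 ∧ l₂.val q = 0)) (n₁ : ¬ (l₀.val q = 0 ∧ l₃.val q = 0))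
    (n₂ : ¬ (l₁.val q = 0 ∧ l₃.val q = 0)) (n₃ : ¬ (l₁.val q = 0 ∧ l₄.val q = 0))
    (n₄ : ¬ (l₂.val q = 0 ∧ l₄.val q = 0)) :
    (∀ l ∈ [l₀, l₁, l₂, l₃, l₄], l.val q ≠ 0) ∨
    (∃ l ∈ [l₀, l₁, l₂, l₃, l₄], ∀ m ∈ [l₀, l₁, l₂, l₃, l₄], m.val q = 0 → m = l) ∨
    (∃ l ∈ [l₀, l₁, l₂, l₃, l₄], ∃ m ∈ [l₀, l₁, l₂, l₃, l₄], IsCorner l m ∧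
      l.val q = 0 ∧ m.val q = 0 ∧ ∀ k ∈ [l₀, l₁, l₂, l₃, l₄], k.val q = 0 → k = l ∨ k = m) := by
  have pair : ∀ l m : Line, l ∈ [l₀, l₁, l₂, l₃, l₄] → m ∈ [l₀, l₁, l₂, l₃, l₄] → IsCorner l m →
      l.val q = 0 → m.val q = 0 →
      (∀ k ∈ [l₀, l₁, l₂, l₃, l₄], k.val q = 0 → k = l ∨ k = m) →
      ∃ l ∈ [l₀, l₁, l₂, l₃, l₄], ∃ m ∈ [l₀, l₁, l₂, l₃, l₄], IsCorner l m ∧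
        l.val q = 0 ∧ m.val q = 0 ∧ ∀ k ∈ [l₀, l₁, l₂, l₃, l₄], k.val q = 0 → k = l ∨ k = m :=
    fun l m hl hm h1 h2 h3 h4 => ⟨l, hl, m, hm, h1, h2, h3, h4⟩
  simp only [List.forall_mem_cons (l := _ :: _), List.forall_mem_singleton] at pair ⊢
  by_cases h₀ : l₀.val q = 0
  · have h₂ : l₂.val q ≠ 0 := fun h => n₀ ⟨h₀, h⟩
    have h₃ : l₃.val q ≠ 0 := fun h => n₁ ⟨h₀, h⟩
    by_cases h₁ : l₁.val q = 0
    · have h₄ : l₄.val q ≠ 0 := fun h => n₃ ⟨h₁, h⟩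
      exact Or.inr (Or.inr (pair l₀ l₁ (by simp) (by simp) c₀ h₀ h₁ (by simp [h₂, h₃, h₄])))
    · by_cases h₄ : l₄.val q = 0
      · exact Or.inr (Or.inr (pair l₄ l₀ (by simp) (by simp) c₄ h₄ h₀ (by simp [h₁, h₂, h₃])))
      · exact Or.inr (Or.inl ⟨l₀, by simp, by simp [h₁, h₂, h₃, h₄]⟩)
  · by_cases h₁ : l₁.val q = 0
    · have h₃ : l₃.val q ≠ 0 := fun h => n₂ ⟨h₁, h⟩
      have h₄ : l₄.val q ≠ 0 := fun h => n₃ ⟨h₁, h⟩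
      by_cases h₂ : l₂.val q = 0
      · exact Or.inr (Or.inr (pair l₁ l₂ (by simp) (by simp) c₁ h₁ h₂ (by simp [h₀, h₃, h₄])))
      · exact Or.inr (Or.inl ⟨l₁, by simp, by simp [h₀, h₂, h₃, h₄]⟩)
    · by_cases h₂ : l₂.val q = 0
      · have h₄ : l₄.val q ≠ 0 := fun h => n₄ ⟨h₂, h⟩
        by_cases h₃ : l₃.val q = 0
        · exact Or.inr (Or.inr (pair l₂ l₃ (by simp) (by simp) c₂ h₂ h₃ (by simp [h₀, h₁, h₄])))
        · exact Or.inr (Or.inl ⟨l₂, by simp, by simp [h₀, h₁, h₃, h₄]⟩)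
      · by_cases h₃ : l₃.val q = 0
        · by_cases h₄ : l₄.val q = 0
          · exact Or.inr (Or.inr (pair l₃ l₄ (by simp) (by simp) c₃ h₃ h₄ (by simp [h₀, h₁, h₂])))
          · exact Or.inr (Or.inl ⟨l₃, by simp, by simp [h₀, h₁, h₂, h₄]⟩)
        · by_cases h₄ : l₄.val q = 0
          · exact Or.inr (Or.inl ⟨l₄, by simp, by simp [h₀, h₁, h₂, h₃]⟩)
          · exact Or.inl ⟨h₀, h₁, h₂, h₃, h₄⟩

lemma trichotomy {f : Bool} {q : ℂ} (hq : q ∈ polySet (base f)) :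
    (∀ l ∈ base f, l.val q ≠ 0) ∨
    (∃ l ∈ base f, ∀ m ∈ base f, m.val q = 0 → m = l) ∨
    (∃ l ∈ base f, ∃ m ∈ base f, IsCorner l m ∧ l.val q = 0 ∧ m.val q = 0 ∧
      ∀ k ∈ base f, k.val q = 0 → k = l ∨ k = m) := by
  have corner : ∀ (l m : Line) (r : ℕ), ((m.1.sub l.1).rot (12 - l.2 % 12)).imSign = 0 → 0 < r →
      r < 5 → (m.2 = l.2 + r ∨ m.2 + 12 = l.2 + r) → IsCorner l m := by
    intro l m r h hr0 hr hlm
    refine ⟨by rw [Line.val_toC, Pt.imSign_zero h], r, hr0, hr, ?_⟩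
    rw [← pow_add]
    rcases hlm with h | h <;> rw [← h]
    rw [pow_add, ζ_pow_twelve, mul_one]
  have h0 := sqrt_three_pos
  have h3 := sqrt_three_mul_self
  rw [polySet, Set.mem_ofPred_eq] at hq
  cases f
  · have hv := base_false_val q
    simp only [base] at hq hv ⊢
    simp only [List.map_cons, List.map_nil, List.cons.injEq, and_true] at hv
    simp only [List.forall_mem_cons, List.not_mem_nil, false_imp_iff, implies_true, and_true] at hq
    obtain ⟨e0, e1, e2, e3, e4⟩ := hv
    rw [e0, e1, e2, e3, e4] at hq
    obtain ⟨p0, p1, p2, p3, p4⟩ := hq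
    refine polygon_trichotomy
      (corner _ _ 3 (by decide) (by norm_num) (by norm_num) (by norm_num))
      (corner _ _ 2 (by decide) (by norm_num) (by norm_num) (by norm_num))
      (corner _ _ 1 (by decide) (by norm_num) (by norm_num) (by norm_num))
      (corner _ _ 4 (by decide) (by norm_num) (by norm_num) (by norm_num))
      (corner _ _ 2 (by decide) (by norm_num) (by norm_num) (by norm_num)) ?_ ?_ ?_ ?_ ?_ <;>
      simp only [e0, e1, e2, e3, e4] <;> rintro ⟨a, b⟩ <;> nlinarith
  · have hv := base_true_val q
    simp only [base] at hq hv ⊢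
    simp only [List.map_cons, List.map_nil, List.cons.injEq, and_true] at hv
    simp only [List.forall_mem_cons, List.not_mem_nil, false_imp_iff, implies_true, and_true] at hq
    obtain ⟨e0, e1, e2, e3, e4⟩ := hv
    rw [e0, e1, e2, e3, e4] at hq
    obtain ⟨p0, p1, p2, p3, p4⟩ := hq
    refine polygon_trichotomy
      (corner _ _ 4 (by decide) (by norm_num) (by norm_num) (by norm_num))
      (corner _ _ 1 (by decide) (by norm_num) (by norm_num) (by norm_num))
      (corner _ _ 2 (by decide) (by norm_num) (by norm_num) (by norm_num))
      (corner _ _ 3 (by decide) (by norm_num) (by norm_num) (by norm_num))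
      (corner _ _ 2 (by decide) (by norm_num) (by norm_num) (by norm_num)) ?_ ?_ ?_ ?_ ?_ <;>
      simp only [e0, e1, e2, e3, e4] <;> rintro ⟨a, b⟩ <;> nlinarith

/-- A congruent copy of the pentagon that contains directions arbitrarily close to `ζ ^ k` at `p`
on the left, but no germs of the sectors with indices `k - 1` and `k + 5`, has a corner at `p`
whose first edge has the direction `ζ ^ k`. -/
lemma corner_core {f : Bool} {a b p : ℂ} {k : ℕ} (ha : ‖a‖ = 1)
    (h1 : ∃ᶠ n : ℕ in atTop, ∀ᶠ t : ℝ in 𝓝[>] 0,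
      p + t * (ζ ^ k * (1 + ((1 / ((n : ℝ) + 1) : ℝ) : ℂ) * ζ)) ∈ movedSet f a b)
    (h2 : ∀ w ∈ sector (k + 11), ∃ᶠ t : ℝ in 𝓝[>] 0, p + t * w ∉ movedInt f a b)
    (h3 : ∀ w ∈ sector (k + 5), ∃ᶠ t : ℝ in 𝓝[>] 0, p + t * w ∉ movedInt f a b) :
    ∃ m ∈ base f, a = ζ ^ k * conj (ζ ^ m.2) ∧ b = p - a * m.1.toC := by
  have hunit := unit_mul_conj ha
  set q : ℂ := conj a * (p - b) with hqdef
  have hmove : ∀ (w : ℂ) (t : ℝ), conj a * (p + t * w - b) = q + t * (conj a * w) := by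
    intro w t; rw [hqdef]; ring
  have hlim : ∀ w : ℂ, Tendsto (fun t : ℝ => q + t * w) (𝓝[>] 0) (𝓝 q) := by
    intro w
    have hc : Continuous (fun t : ℝ => q + t * w) := by fun_prop
    have h := hc.tendsto 0
    simp only [Complex.ofReal_zero, zero_mul, add_zero] at h
    exact h.mono_left nhdsWithin_le_nhds
  have hq : q ∈ polySet (base f) := by
    obtain ⟨n, hn⟩ := h1.exists
    refine (isClosed_polySet _).mem_of_tendsto
      (hlim (conj a * (ζ ^ k * (1 + ((1 / ((n : ℝ) + 1) : ℝ) : ℂ) * ζ)))) (hn.mono fun t ht => ?_)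
    rw [movedSet, Set.mem_ofPred_eq, hmove] at ht
    exact ht
  have nonneg : ∀ l ∈ base f, l.val q = 0 → 0 ≤ (conj a * ζ ^ k * conj (ζ ^ l.2)).im := by
    intro l hl hl0
    have hc : Tendsto (fun n : ℕ =>
        (conj a * (ζ ^ k * (1 + ((1 / ((n : ℝ) + 1) : ℝ) : ℂ) * ζ)) * conj (ζ ^ l.2)).im) atTop
        (𝓝 (conj a * (ζ ^ k * (1 + ((0 : ℝ) : ℂ) * ζ)) * conj (ζ ^ l.2)).im) := by
      have hc : Continuous (fun x : ℝ =>
        (conj a * (ζ ^ k * (1 + (x : ℂ) * ζ)) * conj (ζ ^ l.2)).im) := by fun_prop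
      exact (hc.tendsto 0).comp tendsto_one_div_add_atTop_nhds_zero_nat
    simp only [Complex.ofReal_zero, zero_mul, add_zero, mul_one, ← mul_assoc] at hc
    refine isClosed_Ici.mem_of_frequently_of_tendsto (s := Set.Ici 0) (h1.mono fun n hn => ?_) hc
    obtain ⟨t, ht, ht0⟩ := (hn.and self_mem_nhdsWithin).exists
    rw [movedSet, Set.mem_ofPred_eq, hmove] at ht
    have := ht l hl
    rw [Line.val_add_smul, hl0, zero_add] at this
    have := nonneg_of_mul_nonneg_right this ht0
    simpa only [mul_assoc, Set.mem_Ici] using this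
  have blocked : ∀ w : ℂ, (∃ᶠ t : ℝ in 𝓝[>] 0, p + t * w ∉ movedInt f a b) →
      ∃ l ∈ base f, l.val q = 0 ∧ (conj a * w * conj (ζ ^ l.2)).im ≤ 0 := by
    intro w hw
    by_contra hne
    push Not at hne
    refine hw ?_
    have : ∀ l ∈ {l | l ∈ base f}, ∀ᶠ t : ℝ in 𝓝[>] 0, 0 < l.val (q + t * (conj a * w)) := by
      intro l hl
      rcases (hq l hl).lt_or_eq with h | h
      · have hc : Continuous (fun t : ℝ => l.val (q + t * (conj a * w))) := by
          unfold Line.val; fun_prop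
        have := (hc.tendsto 0).eventually_const_lt (u := 0) (by simpa using h)
        exact this.filter_mono nhdsWithin_le_nhds
      · filter_upwards [self_mem_nhdsWithin] with t ht
        rw [Line.val_add_smul, ← h, zero_add]
        exact mul_pos ht (hne l hl h.symm)
    filter_upwards [(eventually_all_finite (List.finite_toSet (base f))).2 this] with t ht
    rw [not_not, movedInt, Set.mem_ofPred_eq, hmove]
    exact ht
  have sec : ∀ (i : ℕ) (s t : ℝ) (l : Line), conj a * (ζ ^ (k + i) * (s + t * ζ)) * conj (ζ ^ l.2) =
      conj a * ζ ^ k * conj (ζ ^ l.2) * (ζ ^ i * (s + t * ζ)) := by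
    intro i s t l; rw [pow_add]; ring
  have norm1 : ∀ l : Line, ‖conj a * ζ ^ k * conj (ζ ^ l.2)‖ = 1 := by
    intro l
    rw [norm_mul, norm_mul, RCLike.norm_conj, RCLike.norm_conj, norm_ζ_pow, norm_ζ_pow, ha]
    norm_num
  rcases trichotomy hq with h | ⟨l, hl, h⟩ | ⟨l, hl, m, hm, hc, hl0, hm0, h⟩
  · obtain ⟨l, hl, h0, -⟩ := blocked _ (h2 _ ⟨1, 1, one_pos, one_pos, rfl⟩)
    exact absurd h0 (h l hl)
  · refine (no_halfplane (norm1 l) (fun s t hs ht => ?_) fun s t hs ht => ?_).elim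
    · obtain ⟨l', hl', h0, h'⟩ := blocked _ (h2 _ ⟨s, t, hs, ht, rfl⟩)
      rwa [h l' hl' h0, sec] at h'
    · obtain ⟨l', hl', h0, h'⟩ := blocked _ (h3 _ ⟨s, t, hs, ht, rfl⟩)
      rwa [h l' hl' h0, sec] at h'
  · have hv := hc.eq hl0 hm0
    obtain ⟨-, r, hr0, hr, hlm⟩ := hc
    have hlm' : conj (ζ ^ l.2) = conj (ζ ^ m.2) * ζ ^ r := by
      rw [hlm, map_mul, mul_assoc, mul_comm (conj (ζ ^ r)), ζ_pow_mul_conj, mul_one]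
    have hγ : conj a * ζ ^ k * conj (ζ ^ m.2) = 1 := by
      refine wedge_edge (norm1 m) hr0 hr ?_ (nonneg m hm hm0) fun s t hs ht => ?_
      · rw [mul_assoc, ← hlm']
        exact nonneg l hl hl0
      · obtain ⟨l', hl', h0, h'⟩ := blocked _ (h2 _ ⟨s, t, hs, ht, rfl⟩)
        rw [sec] at h'
        rw [mul_assoc (conj a * ζ ^ k), ← hlm']
        rcases h l' hl' h0 with rfl | rfl
        · exact Or.inl h'
        · exact Or.inr h'
    refine ⟨m, hm, ?_, ?_⟩
    · linear_combination (-a) * hγ + ζ ^ k * conj (ζ ^ m.2) * hunit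
    · rw [← hv, hqdef]
      linear_combination (p - b) * hunit

/-! ### The cells of the triangular lattice -/

/-- The cell `(m, n, k)` stands for the oriented lattice edge from `m + n ω` in the direction
`ω ^ k`, and for the triangle spanned by this edge and the centre of the unit triangle on its
left. -/
abbrev Cell := ℤ × ℤ × Fin 6

def unitX : Fin 6 → ℤ := ![1, 0, -1, -1, 0, 1]

def unitY : Fin 6 → ℤ := ![0, 1, 1, 0, -1, -1]

namespace Cell

/-- The next edge of the unit triangle on the left. -/
def next (c : Cell) : Cell := (c.1 + unitX c.2.2, c.2.1 + unitY c.2.2, c.2.2 + 2)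

/-- The same edge with the opposite orientation. -/
def rev (c : Cell) : Cell := (c.1 + unitX c.2.2, c.2.1 + unitY c.2.2, c.2.2 + 3)

/-- The three cells of a unit triangle. -/
def tri (c : Cell) : List Cell := [c, c.next, c.next.next]

end Cell

def lat (m n : ℤ) : Pt := ⟨0, 2 * m + n, 0, n - m⟩

lemma toC_lat (m n : ℤ) : (lat m n).toC = m + n * ω := by
  have h := sqrt_three_pos.ne'
  have h3 : √3 ^ 2 = 3 := by rw [pow_two, sqrt_three_mul_self]
  apply Complex.ext
  · rw [Pt.toC_re]
    simp [lat, ω]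
    field_simp
  · rw [Pt.toC_im]
    simp [lat, ω]
    field_simp
    rw [h3]
    ring

lemma ζ_pow_two_mul (n : ℕ) : ζ ^ (2 * n) = ω ^ n := by rw [pow_mul, ζ_sq]

lemma ω_sq : ω ^ 2 = ω - 1 := by rw [← ζ_sq, ← pow_mul]; exact ζ_pow_four

lemma ω_pow_six : ω ^ 6 = 1 := by rw [← ζ_pow_two_mul, ζ_pow_twelve]

lemma ω_pow_mod (n : ℕ) : ω ^ (n % 6) = ω ^ n := by
  conv_rhs => rw [← Nat.mod_add_div n 6, pow_add, pow_mul, ω_pow_six, one_pow, mul_one]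

lemma ω_pow_mul_conj (n : ℕ) : ω ^ n * conj (ω ^ n) = 1 := by
  rw [← ζ_pow_two_mul, ζ_pow_mul_conj]

lemma conj_ω : conj ω = 1 - ω := by
  apply Complex.ext <;> simp [ω]; norm_num

lemma unit_eq (k : Fin 6) : (unitX k : ℂ) + unitY k * ω = ω ^ (k : ℕ) := by
  have h2 := ω_sq
  fin_cases k <;> simp [unitX, unitY]
  · rw [h2]; ring
  · linear_combination (-ω - 1) * h2
  · linear_combination (-ω ^ 2 - ω) * h2
  · linear_combination (-ω ^ 3 - ω ^ 2 + 1) * h2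

/-- Coordinates with respect to the basis `1`, `ω`. -/
def coX (z : ℂ) : ℝ := z.re - z.im / √3

def coY (z : ℂ) : ℝ := 2 * z.im / √3

lemma eq_coX_add_coY (z : ℂ) : z = coX z + coY z * ω := by
  have h := sqrt_three_pos.ne'
  apply Complex.ext <;> simp [coX, coY, ω] <;> field_simp <;> ring

lemma coX_combo (x y : ℝ) : coX (x + y * ω) = x := by
  have h := sqrt_three_pos.ne'
  simp [coX, ω]; field_simp; ring

lemma coY_combo (x y : ℝ) : coY (x + y * ω) = y := by
  have h := sqrt_three_pos.ne'
  simp [coY, ω]; field_simp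

/-- The coordinates of the plane in which the edge `c` becomes the segment from `0` to `1`. -/
def frame (c : Cell) (z : ℂ) : ℂ := (z - (c.1 + c.2.1 * ω)) * conj (ω ^ (c.2.2 : ℕ))

def locX (c : Cell) (z : ℂ) : ℝ := coX (frame c z)

def locY (c : Cell) (z : ℂ) : ℝ := coY (frame c z)

lemma frame_eq (c : Cell) (z : ℂ) : frame c z = locX c z + locY c z * ω := eq_coX_add_coY _

lemma frame_eq_iff {c : Cell} {z : ℂ} {x y : ℝ} (h : frame c z = x + y * ω) :
    locX c z = x ∧ locY c z = y := by
  rw [locX, locY, h]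
  exact ⟨coX_combo x y, coY_combo x y⟩

lemma ω_pow_fin_add (k j : Fin 6) : ω ^ ((k + j : Fin 6) : ℕ) = ω ^ (k : ℕ) * ω ^ (j : ℕ) := by
  rw [Fin.val_add, ω_pow_mod, pow_add]

lemma frame_tip (c : Cell) (z : ℂ) (j : Fin 6) :
    frame (c.1 + unitX c.2.2, c.2.1 + unitY c.2.2, c.2.2 + j) z =
      (frame c z - 1) * conj (ω ^ (j : ℕ)) := by
  simp only [frame, ω_pow_fin_add, map_mul]
  have h1 := unit_eq c.2.2
  have h2 := ω_pow_mul_conj c.2.2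
  push_cast
  linear_combination (-conj (ω ^ (c.2.2 : ℕ)) * conj (ω ^ (j : ℕ))) * h1 - conj (ω ^ (j : ℕ)) * h2

lemma loc_next (c : Cell) (z : ℂ) :
    locX c.next z = locY c z ∧ locY c.next z = 1 - locX c z - locY c z := by
  refine frame_eq_iff ?_
  rw [Cell.next, frame_tip, frame_eq c z, map_pow, conj_ω]
  push_cast
  have h := ω_sq
  simp only [Fin.val_two]
  linear_combination (locX c z - 1 + locY c z * ω - locY c z) * h

lemma loc_rev (c : Cell) (z : ℂ) :
    locX c.rev z = 1 - locX c z ∧ locY c.rev z = - locY c z := by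
  refine frame_eq_iff ?_
  have h3 : ω ^ ((3 : Fin 6) : ℕ) = -1 := by
    rw [← ζ_pow_two_mul]; exact ζ_pow_six
  rw [Cell.rev, frame_tip, frame_eq c z, h3]
  simp
  ring

/-- The lines that bound a cell. -/
def cellPoly (c : Cell) : List Line :=
  [(lat c.1 c.2.1, 2 * c.2.2),
   (lat (c.1 + unitX c.2.2) (c.2.1 + unitY c.2.2), 2 * c.2.2 + 5),
   ((lat c.1 c.2.1).add ((⟨0, 1, 0, 0⟩ : Pt).rot (2 * c.2.2)), 2 * c.2.2 + 7)]

def cellSet (c : Cell) : Set ℂ := polySet (cellPoly c)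

def cellInt (c : Cell) : Set ℂ := polyInt (cellPoly c)

lemma im_combo (x y : ℝ) : ((x : ℂ) + y * ω).im = √3 / 2 * y := by
  simp [ω]; ring

lemma cellPoly_val (c : Cell) (z : ℂ) : (cellPoly c).map (fun l => l.val z) =
    [√3 / 2 * locY c z, (1 - locX c z - 2 * locY c z) / 2, (locX c z - locY c z) / 2] := by
  have h3 := sqrt_three_mul_self
  have h0 := sqrt_three_pos.ne'
  have hf := frame_eq c z
  have hc := ω_pow_mul_conj c.2.2
  have hu := unit_eq c.2.2
  have c5 : conj (ζ ^ 5) = -ζ := by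
    rw [conj_ζ_pow]; norm_num; rw [show ζ ^ 7 = ζ ^ 6 * ζ by ring, ζ_pow_six]; ring
  have c7 : conj (ζ ^ 7) = ζ ^ 5 := by rw [conj_ζ_pow]
  have z5 : ζ ^ 5 = ⟨-(√3 / 2), 1 / 2⟩ := by
    obtain ⟨-, -, -, ⟨a5, b5⟩, -⟩ := ζ_pow_re_im
    exact Complex.ext a5 b5
  simp only [cellPoly, List.map_cons, List.map_nil, List.cons.injEq, and_true, Line.val,
    toC_lat, Pt.toC_add, Pt.toC_rot, pow_add, map_mul, ζ_pow_two_mul, c5, c7]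
  refine ⟨?_, ?_, ?_⟩
  · have : (z - (c.1 + c.2.1 * ω)) * conj (ω ^ (c.2.2 : ℕ)) = frame c z := rfl
    rw [this, hf, im_combo]
  · have : (z - (((c.1 + unitX c.2.2 : ℤ) : ℂ) + ((c.2.1 + unitY c.2.2 : ℤ) : ℂ) * ω)) *
        (conj (ω ^ (c.2.2 : ℕ)) * -ζ) = (1 - (locX c z + locY c z * ω)) * ζ := by
      rw [← hf, frame]
      push_cast
      linear_combination ζ * conj (ω ^ (c.2.2 : ℕ)) * hu + ζ * hc
    rw [this]
    simp [ζ, ω]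
    linear_combination (-locY c z / 4) * h3
  · have e : (⟨0, 1, 0, 0⟩ : Pt).toC = ζ / (√3 : ℝ) := by simp [Pt.toC]
    have : (z - (c.1 + c.2.1 * ω + ω ^ (c.2.2 : ℕ) * (⟨0, 1, 0, 0⟩ : Pt).toC)) *
        (conj (ω ^ (c.2.2 : ℕ)) * ζ ^ 5) =
        (locX c z + locY c z * ω) * ζ ^ 5 + ((1 / √3 : ℝ) : ℂ) := by
      rw [← hf, frame, e]
      push_cast
      linear_combination (-ζ / √3 * ζ ^ 5) * hc - 1 / √3 * ζ_pow_six
    rw [this, z5]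
    simp [ω]
    linear_combination (-locY c z / 4) * h3

lemma mem_cellSet {c : Cell} {z : ℂ} : z ∈ cellSet c ↔
    0 ≤ locY c z ∧ locY c z ≤ locX c z ∧ locX c z + 2 * locY c z ≤ 1 := by
  rw [cellSet, polySet, Set.mem_ofPred_eq, ← List.forall_mem_map (f := fun l => Line.val l z)
    (P := fun x => 0 ≤ x), cellPoly_val]
  simp only [List.forall_mem_cons, List.not_mem_nil, false_imp_iff, implies_true, and_true]
  have := sqrt_three_pos
  rw [mul_nonneg_iff_of_pos_left (by positivity)]
  constructor <;> rintro ⟨h1, h2, h3⟩ <;> refine ⟨?_, ?_, ?_⟩ <;> linarith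

lemma mem_cellInt {c : Cell} {z : ℂ} : z ∈ cellInt c ↔
    0 < locY c z ∧ locY c z < locX c z ∧ locX c z + 2 * locY c z < 1 := by
  rw [cellInt, polyInt, Set.mem_ofPred_eq, ← List.forall_mem_map (f := fun l => Line.val l z)
    (P := fun x => 0 < x), cellPoly_val]
  simp only [List.forall_mem_cons, List.not_mem_nil, false_imp_iff, implies_true, and_true]
  have := sqrt_three_pos
  rw [mul_pos_iff_of_pos_left (by positivity)]
  constructor <;> rintro ⟨h1, h2, h3⟩ <;> refine ⟨?_, ?_, ?_⟩ <;> linarith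

lemma cell_center_mem (c : Cell) : ∃ q, q ∈ cellInt c := by
  have h : ∃ z, frame c z = ((1 / 2 : ℝ) : ℂ) + ((1 / 6 : ℝ) : ℂ) * ω := by
    refine ⟨c.1 + c.2.1 * ω + ω ^ (c.2.2 : ℕ) * (((1 / 2 : ℝ) : ℂ) + ((1 / 6 : ℝ) : ℂ) * ω), ?_⟩
    have := ω_pow_mul_conj c.2.2
    rw [frame]
    linear_combination (((1 / 2 : ℝ) : ℂ) + ((1 / 6 : ℝ) : ℂ) * ω) * this
  obtain ⟨z, hz⟩ := h
  obtain ⟨hx, hy⟩ := frame_eq_iff hz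
  refine ⟨z, ?_⟩
  rw [mem_cellInt, hx, hy]
  norm_num

lemma cellSet_subset_closure (c : Cell) : cellSet c ⊆ closure (cellInt c) := by
  obtain ⟨q, hq⟩ := cell_center_mem c
  exact polySet_subset_closure hq

/-- The closed unit triangle to the left of an edge. -/
def triangle (c : Cell) : Set ℂ := {z | 0 ≤ locX c z ∧ 0 ≤ locY c z ∧ locX c z + locY c z ≤ 1}

lemma mem_triangle {c : Cell} {z : ℂ} : z ∈ triangle c ↔ ∃ d ∈ c.tri, z ∈ cellSet d := by
  simp only [Cell.tri, List.exists_mem_cons_iff, List.not_mem_nil, false_and, exists_false,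
    or_false, mem_cellSet, loc_next, triangle, Set.mem_ofPred_eq]
  constructor
  · rintro ⟨h1, h2, h3⟩
    rcases le_total (locY c z) (locX c z) with h | h
    · rcases le_total (locX c z + 2 * locY c z) 1 with h' | h'
      · exact Or.inl ⟨h2, h, h'⟩
      · exact Or.inr (Or.inl ⟨by linarith, by linarith, by linarith⟩)
    · rcases le_total (2 * locX c z + locY c z) 1 with h' | h'
      · exact Or.inr (Or.inr ⟨by linarith, by linarith, by linarith⟩)
      · exact Or.inr (Or.inl ⟨by linarith, by linarith, by linarith⟩)
  · rintro (⟨h1, h2, h3⟩ | ⟨h1, h2, h3⟩ | ⟨h1, h2, h3⟩) <;>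
      exact ⟨by linarith, by linarith, by linarith⟩

/-! ### Lattice tiles -/

/-- The tile `(c, b)` is the copy of the TH-pentagon whose part `ADE` is the cell `c`; the edge `c`
runs from `D` to `A` if `b` is false, and from `A` to `D` if `b` is true. -/
abbrev Tile := Cell × Bool

namespace Tile

/-- An edge of the unit triangle that corresponds to `BCD`. -/
def wing (t : Tile) : Cell := if t.2 then t.1.rev.next.next.rev else t.1.rev.next.rev

/-- The cells that make up a tile. -/
def cells (t : Tile) : List Cell := t.1 :: (t.1.rev.tri ++ t.wing.tri)

def placement (t : Tile) : Placement :=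
  ⟨lat (t.1.1 - unitX (t.1.2.2 + 2)) (t.1.2.1 - unitY (t.1.2.2 + 2)),
    2 * (t.1.2.2 + if t.2 then 2 else 1), t.2⟩

end Tile

def tileSet (t : Tile) : Set ℂ := polySet t.placement.poly

lemma mem_base_false {z : ℂ} : z ∈ polySet (base false) ↔
    0 ≤ coY z ∧ 2 * coX z + coY z ≤ 2 ∧ coX z + 2 * coY z ≤ 2 ∧ coY z ≤ 1 ∧
      0 ≤ coX z + coY z := by
  obtain ⟨x, hx⟩ : ∃ x, x = coX z := ⟨_, rfl⟩
  obtain ⟨y, hy⟩ : ∃ y, y = coY z := ⟨_, rfl⟩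
  have h := sqrt_three_pos
  have h3 := sqrt_three_mul_self
  have him : z.im = √3 / 2 * y := by rw [hy, coY]; field_simp
  have hre : z.re = x + y / 2 := by rw [hx, hy, coX, coY]; field_simp; ring
  rw [mem_polySet_base_false, him, hre, ← hx, ← hy]
  have e1 : 1 - (x + y / 2) / 2 - √3 / 2 * (√3 / 2 * y) = (2 - x - 2 * y) / 2 := by
    linear_combination (-y / 4) * h3
  have e2 : √3 / 2 - √3 / 2 * y = √3 / 2 * (1 - y) := by ring
  have e3 : √3 / 2 * (x + y / 2) + √3 / 2 * y / 2 = √3 / 2 * (x + y) := by ring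
  rw [e1, e2, e3, mul_nonneg_iff_of_pos_left (by positivity),
    mul_nonneg_iff_of_pos_left (by positivity), mul_nonneg_iff_of_pos_left (by positivity)]
  constructor <;> rintro ⟨h1, h2, h3, h4, h5⟩ <;> refine ⟨?_, ?_, ?_, ?_, ?_⟩ <;> linarith

lemma coX_conj (z : ℂ) : coX (conj z) = coX z + coY z := by
  simp [coX, coY]; ring

lemma coY_conj (z : ℂ) : coY (conj z) = -coY z := by
  simp [coY]; ring

lemma mem_tileSet_false {c : Cell} {z : ℂ} : z ∈ tileSet (c, false) ↔
    0 ≤ locX c z ∧ locX c z ≤ 1 ∧ -1 ≤ locY c z ∧ locX c z + 2 * locY c z ≤ 1 ∧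
      locY c z ≤ locX c z := by
  have key : conj (ζ ^ (2 * ((c.2.2 : ℕ) + 1))) *
      (z - (lat (c.1 - unitX (c.2.2 + 2)) (c.2.1 - unitY (c.2.2 + 2))).toC) =
      ((locX c z + locY c z : ℝ) : ℂ) + ((1 - locX c z : ℝ) : ℂ) * ω := by
    have h1 := unit_eq (c.2.2 + 2)
    rw [ω_pow_fin_add, Fin.val_two] at h1
    have h2 := ω_pow_mul_conj c.2.2
    have h3 := frame_eq c z
    rw [frame] at h3
    have h4 := ω_sq
    rw [ζ_pow_two_mul, pow_succ, map_mul, conj_ω, toC_lat]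
    push_cast
    linear_combination (1 - ω) * h3 + (1 - ω) * conj (ω ^ (c.2.2 : ℕ)) * h1 +
      (1 - ω) * ω ^ 2 * h2 + (-locY c z - ω) * h4
  rw [tileSet, Placement.polySet_poly, movedSet, Set.mem_ofPred_eq]
  simp only [Tile.placement, Bool.false_eq_true, if_false]
  rw [key, mem_base_false, coX_combo, coY_combo]
  constructor <;> rintro ⟨h1, h2, h3, h4, h5⟩ <;> refine ⟨?_, ?_, ?_, ?_, ?_⟩ <;> linarith

lemma mem_tileSet_true {c : Cell} {z : ℂ} : z ∈ tileSet (c, true) ↔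
    0 ≤ locX c z + locY c z ∧ locX c z + locY c z ≤ 1 ∧ -1 ≤ locY c z ∧
      locX c z + 2 * locY c z ≤ 1 ∧ locY c z ≤ locX c z := by
  have key : conj (ζ ^ (2 * ((c.2.2 : ℕ) + 2))) *
      (z - (lat (c.1 - unitX (c.2.2 + 2)) (c.2.1 - unitY (c.2.2 + 2))).toC) =
      ((1 + locY c z : ℝ) : ℂ) + ((-locX c z - locY c z : ℝ) : ℂ) * ω := by
    have h1 := unit_eq (c.2.2 + 2)
    rw [ω_pow_fin_add, Fin.val_two] at h1
    have h2 := ω_pow_mul_conj c.2.2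
    have h3 := frame_eq c z
    rw [frame] at h3
    have h4 := ω_sq
    have h5 : ω ^ 2 * (1 - ω) ^ 2 = 1 := by linear_combination (ω ^ 2 - ω - 1) * h4
    rw [ζ_pow_two_mul, pow_add, map_mul, map_pow conj ω 2, conj_ω, toC_lat]
    push_cast
    linear_combination (1 - ω) ^ 2 * h3 + (1 - ω) ^ 2 * conj (ω ^ (c.2.2 : ℕ)) * h1 +
      (1 - ω) ^ 2 * ω ^ 2 * h2 + (locX c z + locY c z * ω - locY c z) * h4 + h5
  rw [tileSet, Placement.polySet_poly, movedSet, Set.mem_ofPred_eq]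
  simp only [Tile.placement, if_true]
  rw [key, mem_polySet_base_true, mem_base_false, coX_conj, coY_conj, coX_combo, coY_combo]
  constructor <;> rintro ⟨h1, h2, h3, h4, h5⟩ <;> refine ⟨?_, ?_, ?_, ?_, ?_⟩ <;> linarith

lemma mem_tileSet {t : Tile} {z : ℂ} : z ∈ tileSet t ↔ ∃ d ∈ t.cells, z ∈ cellSet d := by
  have split : (∃ d ∈ t.cells, z ∈ cellSet d) ↔
      z ∈ cellSet t.1 ∨ z ∈ triangle t.1.rev ∨ z ∈ triangle t.wing := by
    simp only [Tile.cells, List.exists_mem_cons_iff, List.mem_append, mem_triangle]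
    constructor
    · rintro (h | ⟨d, h | h, hd⟩)
      · exact Or.inl h
      · exact Or.inr (Or.inl ⟨d, h, hd⟩)
      · exact Or.inr (Or.inr ⟨d, h, hd⟩)
    · rintro (h | ⟨d, h, hd⟩ | ⟨d, h, hd⟩)
      · exact Or.inl h
      · exact Or.inr ⟨d, Or.inl h, hd⟩
      · exact Or.inr ⟨d, Or.inr h, hd⟩
  rw [split]
  obtain ⟨c, b⟩ := t
  cases b
  · rw [mem_tileSet_false]
    simp only [Tile.wing, triangle, mem_cellSet, loc_next, loc_rev, Set.mem_ofPred_eq,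
      Bool.false_eq_true, if_false]
    constructor
    · rintro ⟨h1, h2, h3, h4, h5⟩
      rcases le_total 0 (locY c z) with h | h
      · exact Or.inl ⟨by linarith, by linarith, by linarith⟩
      · rcases le_total 0 (locX c z + locY c z) with h' | h'
        · exact Or.inr (Or.inl ⟨by linarith, by linarith, by linarith⟩)
        · exact Or.inr (Or.inr ⟨by linarith, by linarith, by linarith⟩)
    · rintro (⟨h1, h2, h3⟩ | ⟨h1, h2, h3⟩ | ⟨h1, h2, h3⟩) <;> refine ⟨?_, ?_, ?_, ?_, ?_⟩ <;>
        linarith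
  · rw [mem_tileSet_true]
    simp only [Tile.wing, triangle, mem_cellSet, loc_next, loc_rev, Set.mem_ofPred_eq,
      if_true]
    constructor
    · rintro ⟨h1, h2, h3, h4, h5⟩
      rcases le_total 0 (locY c z) with h | h
      · exact Or.inl ⟨by linarith, by linarith, by linarith⟩
      · rcases le_total (locX c z) 1 with h' | h'
        · exact Or.inr (Or.inl ⟨by linarith, by linarith, by linarith⟩)
        · exact Or.inr (Or.inr ⟨by linarith, by linarith, by linarith⟩)
    · rintro (⟨h1, h2, h3⟩ | ⟨h1, h2, h3⟩ | ⟨h1, h2, h3⟩) <;> refine ⟨?_, ?_, ?_, ?_, ?_⟩ <;>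
        linarith

lemma loc_table (m n : ℤ) (k : Fin 6) (z : ℂ) :
    (locX (m, n, k) z, locY (m, n, k) z) =
      (![(coX z - m, coY z - n), (coX z - m + (coY z - n), -(coX z - m)),
        (coY z - n, -(coX z - m) - (coY z - n)), (-(coX z - m), -(coY z - n)),
        (-(coX z - m) - (coY z - n), coX z - m), (-(coY z - n), coX z - m + (coY z - n))] :
          Fin 6 → ℝ × ℝ) k := by
  have hz := eq_coX_add_coY z
  have h2 := ω_sq
  have key : ∀ x y : ℝ, frame (m, n, k) z = x + y * ω →
      (locX (m, n, k) z, locY (m, n, k) z) = (x, y) := fun x y h => by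
    rw [(frame_eq_iff h).1, (frame_eq_iff h).2]
  fin_cases k <;> refine key _ _ ?_ <;> simp only [frame, map_pow, conj_ω] <;> push_cast <;>
    simp
  · linear_combination hz
  · linear_combination (1 - ω) * hz + (-(coY z - n) : ℂ) * h2
  · linear_combination (1 - ω) ^ 2 * hz +
      ((coX z - m) + (coY z - n) * (ω - 1) : ℂ) * h2
  · have h3 : (1 - ω) ^ 3 = -1 := by linear_combination (2 - ω) * h2
    linear_combination (1 - ω) ^ 3 * hz + ((coX z - m) + (coY z - n) * ω : ℂ) * h3
  · have h3 : (1 - ω) ^ 4 = ω - 1 := by linear_combination (ω ^ 2 - 3 * ω + 2) * h2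
    linear_combination (1 - ω) ^ 4 * hz + ((coX z - m) + (coY z - n) * ω : ℂ) * h3 +
      (coY z - n : ℂ) * h2
  · have h3 : (1 - ω) ^ 5 = ω := by
      linear_combination (-ω ^ 3 + 4 * ω ^ 2 - 5 * ω + 1) * h2
    linear_combination (1 - ω) ^ 5 * hz + ((coX z - m) + (coY z - n) * ω : ℂ) * h3 +
      (coY z - n : ℂ) * h2

/-- The unit parallelogram that contains a cell. -/
def Cell.floorX (c : Cell) : ℤ := c.1 + ![0, -1, -1, -1, 0, 0] c.2.2

def Cell.floorY (c : Cell) : ℤ := c.2.1 + ![0, 0, 0, -1, -1, -1] c.2.2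

lemma floor_of_mem_cellInt {c : Cell} {z : ℂ} (h : z ∈ cellInt c) :
    ⌊coX z⌋ = c.floorX ∧ ⌊coY z⌋ = c.floorY := by
  obtain ⟨m, n, k⟩ := c
  rw [mem_cellInt] at h
  have ht := loc_table m n k z
  rw [Int.floor_eq_iff, Int.floor_eq_iff]
  fin_cases k <;> simp [Cell.floorX, Cell.floorY, Prod.ext_iff] at ht h ⊢ <;> obtain ⟨h1, h2⟩ := ht <;>
    rw [h1, h2] at h <;> obtain ⟨h3, h4, h5⟩ := h <;>
    refine ⟨⟨?_, ?_⟩, ?_, ?_⟩ <;> linarith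

lemma cellInt_inj {c d : Cell} {z : ℂ} (hc : z ∈ cellInt c) (hd : z ∈ cellInt d) : c = d := by
  obtain ⟨x1, y1⟩ := floor_of_mem_cellInt hc
  obtain ⟨x2, y2⟩ := floor_of_mem_cellInt hd
  rw [x1] at x2
  rw [y1] at y2
  clear x1 y1
  obtain ⟨m, n, k⟩ := c
  obtain ⟨m', n', k'⟩ := d
  rw [mem_cellInt] at hc hd
  have ht := loc_table m n k z
  have ht' := loc_table m' n' k' z
  fin_cases k <;> fin_cases k' <;>
    simp [Cell.floorX, Cell.floorY, Prod.ext_iff] at ht ht' x2 y2 hc hd ⊢ <;>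
    (try exact ⟨by omega, by omega⟩) <;> exfalso <;>
    obtain ⟨h1, h2⟩ := ht <;> obtain ⟨h1', h2'⟩ := ht' <;>
    rw [h1, h2] at hc <;> rw [h1', h2'] at hd <;> obtain ⟨h3, h4, h5⟩ := hc <;>
    obtain ⟨h3', h4', h5'⟩ := hd <;>
    have e1 := congrArg (Int.cast : ℤ → ℝ) x2 <;> have e2 := congrArg (Int.cast : ℤ → ℝ) y2 <;>
    push_cast at e1 e2 <;> linarith

/-! ### Copies of the pentagon that do not fit into the lattice -/

lemma exists_germ {ι : Type*} {A : Set ι} (hA : A.Finite) (S : ι → Set ℂ)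
    (hconv : ∀ i ∈ A, Convex ℝ (S i)) (hclosed : ∀ i ∈ A, IsClosed (S i)) (p : ℂ) (w : ℕ → ℂ)
    (h : ∀ n, ∀ᶠ t : ℝ in 𝓝[>] 0, ∃ i ∈ A, p + t * w n ∈ S i) :
    ∃ i ∈ A, ∃ᶠ n in atTop, ∀ᶠ t : ℝ in 𝓝[>] 0, p + t * w n ∈ S i := by
  have step : ∀ n, ∃ i ∈ A, ∀ᶠ t : ℝ in 𝓝[>] 0, p + t * w n ∈ S i := by
    intro n
    by_contra! hcon
    have hcon' : ∀ i ∈ A, ∀ᶠ t : ℝ in 𝓝[>] 0, p + t * w n ∉ S i := by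
      intro i hi
      by_contra hfreq
      refine hcon i hi (Eventually.mono ?_ fun t h => not_not.2 h)
      have hfreq : ∃ᶠ t : ℝ in 𝓝[>] 0, p + t * w n ∈ S i := hfreq
      have hp : p ∈ S i := by
        have hlim : Tendsto (fun t : ℝ => p + t * w n) (𝓝[>] 0) (𝓝 p) := by
          have hc : Continuous (fun t : ℝ => p + t * w n) := by fun_prop
          have h := hc.tendsto 0
          simp only [Complex.ofReal_zero, zero_mul, add_zero] at h
          exact h.mono_left nhdsWithin_le_nhds
        exact (hclosed i hi).mem_of_frequently_of_tendsto hfreq hlim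
      obtain ⟨t₀, ht₀, hpos⟩ := (hfreq.and_eventually self_mem_nhdsWithin).exists
      have hpos : 0 < t₀ := hpos
      filter_upwards [Ioo_mem_nhdsGT hpos] with t ht
      have := hconv i hi hp ht₀ (a := 1 - t / t₀) (b := t / t₀)
        (by rw [sub_nonneg, div_le_one hpos]; exact ht.2.le) (div_nonneg ht.1.le hpos.le) (by ring)
      refine Set.mem_of_eq_of_mem ?_ this
      simp only [Complex.real_smul]
      push_cast
      have : (t₀ : ℂ) ≠ 0 := by exact_mod_cast hpos.ne'
      field_simp
      ring
    obtain ⟨t, ⟨i, hi, hmem⟩, hnot⟩ := ((h n).and ((eventually_all_finite hA).2 hcon')).exists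
    exact hnot i hi hmem
  by_contra! hcon
  have : ∀ᶠ n in (atTop : Filter ℕ), ∀ i ∈ A, ¬ ∀ᶠ t : ℝ in 𝓝[>] 0, p + t * w n ∈ S i :=
    (eventually_all_finite hA).2 fun i hi => by
      have := hcon i hi
      simpa only [not_eventually] using this
  obtain ⟨n, hn⟩ := this.exists
  obtain ⟨i, hi, hi'⟩ := step n
  exact hn i hi hi'

/-- The finite set `A` of congruent copies of the pentagon, none of which fits into the lattice,
fills the cells in `U`. -/
structure OffLattice (A : Set (Set ℂ)) (U : Set Cell) : Prop where
  finite : A.Finite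
  copy : ∀ S ∈ A, ∃ (f : Bool) (a b : ℂ), ‖a‖ = 1 ∧ S = movedSet f a b
  disjoint : A.PairwiseDisjoint interior
  off : ∀ S ∈ A, ∀ t, S ≠ tileSet t
  cover : ∀ c ∈ U, cellSet c ⊆ ⋃₀ A
  out : ∀ c ∉ U, ∀ S ∈ A, Disjoint (cellInt c) (interior S)

/-- The copy of the pentagon or its mirror image that has a corner at `p` where the edge with
direction `ζ ^ k` corresponds to `l`. -/
def place (f : Bool) (p : Pt) (k : ℕ) (l : Line) : Placement :=
  ⟨p.sub (l.1.rot ((k + (12 - l.2 % 12)) % 12)), (k + (12 - l.2 % 12)) % 12, f⟩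

def placements (p : Pt) (k : ℕ) : List Placement :=
  (base false).map (place false p k) ++ (base true).map (place true p k)

instance : DecidableEq Pt := fun p q =>
  decidable_of_iff (p.c0 = q.c0 ∧ p.c1 = q.c1 ∧ p.c2 = q.c2 ∧ p.c3 = q.c3) (by
    cases p; cases q; simp)

/-- Reasons why a placement at a corner is impossible: it fits into the lattice, or it overlaps
with a tile or a cell near a point `p` in the sector `j`; `keep` gives no reason. -/
inductive Reason
  | lattice (t : Tile)
  | tile (i : ℕ) (p : Pt) (j : ℕ)
  | cell (i : ℕ) (p : Pt) (j : ℕ)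
  | keep

/-- Steps of the search: place a tile at a corner, decide whether a cell belongs to the filled
cells, conclude that it does since a tile overlaps with it. -/
inductive Step
  | corner (p : Pt) (k : ℕ) (rs : List Reason)
  | split (c : Cell)
  | forced (c : Cell) (i : ℕ) (p : Pt) (j : ℕ)

/-- Tiles and cells known to be present, and cells known to be absent. -/
structure Known where
  tiles : List Placement
  ins : List Cell
  outs : List Cell

def tileCovers (T : List Placement) (i : ℕ) (p : Pt) (j : ℕ) : Bool :=
  match T[i]? with
  | some g => covers g.poly p j
  | none => false

def cellCovers (C : List Cell) (i : ℕ) (p : Pt) (j : ℕ) : Bool :=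
  match C[i]? with
  | some c => covers (cellPoly c) p j
  | none => false

namespace Known

def blocked (K : Known) (p : Pt) (j : ℕ) : Bool :=
  K.tiles.any (fun g => covers g.poly p j) || K.outs.any (fun c => covers (cellPoly c) p j)

def excluded (K : Known) (g : Placement) : Reason → Bool
  | .lattice t => decide (g.flip = t.placement.flip) && g.rot % 12 == t.placement.rot % 12 &&
      decide (g.pos = t.placement.pos)
  | .tile i p j => tileCovers K.tiles i p j && covers g.poly p j
  | .cell i p j => cellCovers K.outs i p j && covers g.poly p j
  | .keep => false

def children (K : Known) : List Placement → List Reason → List Known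
  | [], _ => []
  | g :: gs, [] => ⟨g :: K.tiles, K.ins, K.outs⟩ :: K.children gs []
  | g :: gs, r :: rs => bif K.excluded g r then K.children gs rs
      else ⟨g :: K.tiles, K.ins, K.outs⟩ :: K.children gs rs

end Known

def refutes : List Step → List Known → Bool
  | [], Ks => Ks.isEmpty
  | _ :: _, [] => true
  | .corner p k rs :: ss, K :: Ks =>
      !K.tiles.any (fun g => covers g.poly p k) && K.ins.any (fun c => covers (cellPoly c) p k) &&
        K.blocked p (k + 11) && K.blocked p (k + 5) &&
        refutes ss (K.children (placements p k) rs ++ Ks)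
  | .split c :: ss, K :: Ks =>
      refutes ss (⟨K.tiles, c :: K.ins, K.outs⟩ :: ⟨K.tiles, K.ins, c :: K.outs⟩ :: Ks)
  | .forced c i p j :: ss, K :: Ks =>
      tileCovers K.tiles i p j && covers (cellPoly c) p j &&
        refutes ss (⟨K.tiles, c :: K.ins, K.outs⟩ :: Ks)

namespace OffLattice

variable {A : Set (Set ℂ)} {U : Set Cell}

/-- The known facts hold. -/
structure Holds (A : Set (Set ℂ)) (U : Set Cell) (K : Known) : Prop where
  tiles : ∀ g ∈ K.tiles, polySet g.poly ∈ A
  ins : ∀ c ∈ K.ins, c ∈ U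
  outs : ∀ c ∈ K.outs, c ∉ U

lemma sector_nonempty (j : ℕ) : ∃ w, w ∈ sector j := ⟨_, 1, 1, one_pos, one_pos, rfl⟩

lemma false_of_tile_cell (h : OffLattice A U) {g : Placement} (hg : polySet g.poly ∈ A) {c : Cell}
    (hc : c ∉ U) {p : Pt} {j : ℕ} (h1 : covers g.poly p j = true)
    (h2 : covers (cellPoly c) p j = true) : False := by
  obtain ⟨w, hw⟩ := sector_nonempty j
  obtain ⟨t, ht1, ht2⟩ := ((eventually_mem_of_covers h1 hw).and (eventually_mem_of_covers h2 hw)).exists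
  exact Set.disjoint_left.1 (h.out c hc _ hg) ht2 (polyInt_subset_interior _ ht1)

lemma false_of_tile_tile (h : OffLattice A U) {g g' : Placement} (hg : polySet g.poly ∈ A)
    (hg' : polySet g'.poly ∈ A) (hne : polySet g.poly ≠ polySet g'.poly) {p : Pt} {j : ℕ}
    (h1 : covers g.poly p j = true) (h2 : covers g'.poly p j = true) : False := by
  obtain ⟨w, hw⟩ := sector_nonempty j
  obtain ⟨t, ht1, ht2⟩ := ((eventually_mem_of_covers h1 hw).and (eventually_mem_of_covers h2 hw)).exists
  exact Set.disjoint_left.1 (h.disjoint hg hg' hne) (polyInt_subset_interior _ ht1)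
    (polyInt_subset_interior _ ht2)

lemma tileCovers_spec {T : List Placement} {i : ℕ} {p : Pt} {j : ℕ}
    (h : tileCovers T i p j = true) : ∃ g ∈ T, covers g.poly p j = true := by
  unfold tileCovers at h
  split at h
  · exact ⟨_, List.mem_of_getElem? (by assumption), h⟩
  · cases h

lemma cellCovers_spec {T : List Cell} {i : ℕ} {p : Pt} {j : ℕ}
    (h : cellCovers T i p j = true) : ∃ g ∈ T, covers (cellPoly g) p j = true := by
  unfold cellCovers at h
  split at h
  · exact ⟨_, List.mem_of_getElem? (by assumption), h⟩
  · cases h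

lemma polySet_eq_tileSet {g : Placement} {t : Tile} (hf : g.flip = t.placement.flip)
    (hr : g.rot % 12 = t.placement.rot % 12) (hp : g.pos = t.placement.pos) :
    polySet g.poly = tileSet t := by
  rw [tileSet, Placement.polySet_poly, Placement.polySet_poly, hf, hp, ← ζ_pow_mod g.rot, hr,
    ζ_pow_mod]

lemma not_excluded (h : OffLattice A U) {K : Known} (hK : Holds A U K) {g : Placement}
    (hg : polySet g.poly ∈ A) (hne : ∀ g' ∈ K.tiles, polySet g.poly ≠ polySet g'.poly) (r : Reason) :
    K.excluded g r = false := by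
  rw [Bool.eq_false_iff]
  intro hr
  cases r with
  | lattice t =>
    simp only [Known.excluded, Bool.and_eq_true, decide_eq_true_eq, beq_iff_eq] at hr
    exact h.off _ hg t (polySet_eq_tileSet hr.1.1 hr.1.2 hr.2)
  | tile i p j =>
    simp only [Known.excluded, Bool.and_eq_true] at hr
    obtain ⟨g', hg', hc⟩ := tileCovers_spec hr.1
    exact h.false_of_tile_tile hg (hK.tiles g' hg') (hne g' hg') hr.2 hc
  | cell i p j =>
    simp only [Known.excluded, Bool.and_eq_true] at hr
    obtain ⟨c, hc, hc'⟩ := cellCovers_spec hr.1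
    exact h.false_of_tile_cell hg (hK.outs c hc) hr.2 hc'
  | keep => cases hr

lemma exists_child (h : OffLattice A U) {K : Known} (hK : Holds A U K) {g : Placement}
    (hg : polySet g.poly ∈ A) (hne : ∀ g' ∈ K.tiles, polySet g.poly ≠ polySet g'.poly)
    (gs : List Placement) (hgs : g ∈ gs) (rs : List Reason) :
    ∃ K' ∈ K.children gs rs, Holds A U K' := by
  have hnew : Holds A U ⟨g :: K.tiles, K.ins, K.outs⟩ :=
    ⟨by simpa using ⟨hg, hK.tiles⟩, hK.ins, hK.outs⟩
  induction gs generalizing rs with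
  | nil => cases hgs
  | cons g' gs ih =>
    rcases List.mem_cons.1 hgs with rfl | hmem
    · cases rs with
      | nil => exact ⟨_, List.mem_cons_self, hnew⟩
      | cons r rs =>
        rw [Known.children, h.not_excluded hK hg hne]
        exact ⟨_, List.mem_cons_self, hnew⟩
    · cases rs with
      | nil =>
        obtain ⟨K', hK', hh⟩ := ih hmem []
        exact ⟨K', List.mem_cons_of_mem _ hK', hh⟩
      | cons r rs =>
        obtain ⟨K', hK', hh⟩ := ih hmem rs
        refine ⟨K', ?_, hh⟩
        rw [Known.children]
        cases K.excluded g' r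
        · exact List.mem_cons_of_mem _ hK'
        · exact hK'

lemma copy_convex_closed (h : OffLattice A U) {S : Set ℂ} (hS : S ∈ A) :
    Convex ℝ S ∧ IsClosed S := by
  obtain ⟨f, a, b, -, rfl⟩ := h.copy S hS
  constructor
  · have : movedSet f a b = (fun z => conj a * (z - b)) ⁻¹' polySet (base f) := rfl
    intro x hx y hy s t hs ht hst
    have := convex_polySet (base f) hx hy hs ht hst
    change conj a * (s • x + t • y - b) ∈ polySet (base f)
    refine Set.mem_of_eq_of_mem ?_ this
    simp only [Complex.real_smul]
    have hst' : (s : ℂ) + t = 1 := by exact_mod_cast hst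
    linear_combination conj a * b * hst'
  · exact (isClosed_polySet (base f)).preimage (by fun_prop)

lemma movedInt_subset_interior (f : Bool) (a b : ℂ) : movedInt f a b ⊆ interior (movedSet f a b) :=
  interior_maximal (fun _ h => polyInt_subset _ h)
    ((isOpen_polyInt (base f)).preimage (by fun_prop))

lemma exists_placement (h : OffLattice A U) {K : Known} (hK : Holds A U K) {p : Pt} {k : ℕ}
    (h1 : K.tiles.any (fun g => covers g.poly p k) = false)
    (h2 : K.ins.any (fun c => covers (cellPoly c) p k) = true)
    (h3 : K.blocked p (k + 11) = true) (h4 : K.blocked p (k + 5) = true) :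
    ∃ g ∈ placements p k, polySet g.poly ∈ A ∧
      ∀ g' ∈ K.tiles, polySet g.poly ≠ polySet g'.poly := by
  set w : ℕ → ℂ := fun n => ζ ^ k * (1 + ((1 / ((n : ℝ) + 1) : ℝ) : ℂ) * ζ) with hw
  have hwk : ∀ n, w n ∈ sector k := fun n =>
    ⟨1, 1 / ((n : ℝ) + 1), one_pos, by positivity, by simp [hw]⟩
  obtain ⟨c, hc, hcov⟩ := List.any_eq_true.1 h2
  obtain ⟨S, hS, hgerm⟩ := exists_germ h.finite id (fun S hS => (h.copy_convex_closed hS).1)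
    (fun S hS => (h.copy_convex_closed hS).2) p.toC w fun n => by
      filter_upwards [eventually_mem_of_covers hcov (hwk n)] with t ht
      exact h.cover c (hK.ins c hc) (polyInt_subset _ ht)
  have hne : ∀ g' ∈ K.tiles, S ≠ polySet g'.poly := by
    rintro g' hg' rfl
    obtain ⟨n, hn⟩ := hgerm.exists
    have hnc : covers g'.poly p k = false := by
      have := List.any_eq_false.1 h1 g' hg'
      simpa using this
    obtain ⟨t, ht1, ht2⟩ := (hn.and (eventually_notMem_of_not_covers hnc (hwk n))).exists
    exact ht2 ht1
  obtain ⟨f, a, b, ha, rfl⟩ := h.copy S hS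
  have hblock : ∀ j, K.blocked p j = true → ∀ v ∈ sector j,
      ∃ᶠ t : ℝ in 𝓝[>] 0, p.toC + t * v ∉ movedInt f a b := by
    intro j hj v hv
    refine Eventually.frequently ?_
    rcases Bool.or_eq_true_iff.1 hj with hj | hj
    · obtain ⟨g', hg', hcov'⟩ := List.any_eq_true.1 hj
      filter_upwards [eventually_mem_of_covers hcov' hv] with t ht hmem
      exact Set.disjoint_left.1 (h.disjoint hS (hK.tiles g' hg') (hne g' hg'))
        (movedInt_subset_interior f a b hmem) (polyInt_subset_interior _ ht)
    · obtain ⟨d, hd, hcov'⟩ := List.any_eq_true.1 hj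
      filter_upwards [eventually_mem_of_covers hcov' hv] with t ht hmem
      exact Set.disjoint_left.1 (h.out d (hK.outs d hd) _ hS) ht
        (movedInt_subset_interior f a b hmem)
  obtain ⟨l, hl, hal, hbl⟩ := corner_core ha hgerm (hblock _ h3) (hblock _ h4)
  have hrot : a = ζ ^ ((k + (12 - l.2 % 12)) % 12) := by
    rw [ζ_pow_mod, pow_add, ← conj_ζ_pow, hal]
  have heq : movedSet f a b = polySet (place f p k l).poly := by
    rw [Placement.polySet_poly]
    simp only [place, Pt.toC_sub, Pt.toC_rot]
    rw [← hrot, ← hbl]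
  refine ⟨place f p k l, ?_, heq ▸ hS, heq ▸ hne⟩
  cases f
  · exact List.mem_append_left _ (List.mem_map_of_mem hl)
  · exact List.mem_append_right _ (List.mem_map_of_mem hl)

lemma refutes_sound (h : OffLattice A U) (ss : List Step) (Ks : List Known)
    (hr : refutes ss Ks = true) : ∀ K ∈ Ks, ¬ Holds A U K := by
  induction ss generalizing Ks with
  | nil =>
    cases Ks with
    | nil => simp
    | cons => cases hr
  | cons s ss ih =>
    cases Ks with
    | nil => simp
    | cons K Ks =>
      rw [List.forall_mem_cons]
      cases s with
      | corner p k rs =>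
        simp only [refutes, Bool.and_eq_true, Bool.not_eq_true'] at hr
        obtain ⟨⟨⟨⟨h1, h2⟩, h3⟩, h4⟩, h5⟩ := hr
        have := List.forall_mem_append.1 (ih _ h5)
        refine ⟨fun hK => ?_, this.2⟩
        obtain ⟨g, hg, hgA, hne⟩ := h.exists_placement hK h1 h2 h3 h4
        obtain ⟨K', hK', hh⟩ := h.exists_child hK hgA hne _ hg rs
        exact this.1 K' hK' hh
      | split c =>
        have := ih _ hr
        simp only [List.forall_mem_cons] at this
        refine ⟨fun hK => ?_, this.2.2⟩
        by_cases hc : c ∈ U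
        · exact this.1 ⟨hK.tiles, List.forall_mem_cons.2 ⟨hc, hK.ins⟩, hK.outs⟩
        · exact this.2.1 ⟨hK.tiles, hK.ins, List.forall_mem_cons.2 ⟨hc, hK.outs⟩⟩
      | forced c i p j =>
        simp only [refutes, Bool.and_eq_true] at hr
        have := ih _ hr.2
        simp only [List.forall_mem_cons] at this
        refine ⟨fun hK => ?_, this.2⟩
        refine this.1 ⟨hK.tiles, ?_, hK.outs⟩
        rw [List.forall_mem_cons]
        refine ⟨?_, hK.ins⟩
        by_contra hc
        obtain ⟨g, hg, hcov⟩ := tileCovers_spec hr.1.1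
        exact h.false_of_tile_cell (hK.tiles g hg) hc hcov hr.1.2

end OffLattice

/-- The cells on the left of the imaginary axis that meet it near `0`. -/
def leftCells : List Cell :=
  [(-1, 0, 0), (-1, 1, 5), (0, -1, 0), (0, -1, 1), (0, 0, 2), (0, 0, 3), (0, 0, 4), (0, 1, 3),
    (1, -2, 4), (1, -1, 3)]

lemma refutes_0 : refutes
  [.corner ⟨0, 0, 0, -1⟩ 11 [.keep, .keep, .lattice ((1, -1, 2), false), .cell 0 ⟨0, 0, 0, 0⟩ 5, .keep, .keep, .keep, .cell 0 ⟨0, -1, 0, 1⟩ 10, .lattice ((1, -1, 2), true), .keep],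
    .forced (0, 0, 1) 0 ⟨-1, 0, 2, -1⟩ 9,
    .corner ⟨0, 0, 0, 1⟩ 9 [.tile 0 ⟨1, 0, -2, 1⟩ 0, .tile 0 ⟨0, 0, 0, 0⟩ 0, .lattice ((0, 0, 1), false), .tile 0 ⟨1, 0, -2, 1⟩ 1, .tile 0 ⟨1, 0, -2, 1⟩ 0, .tile 0 ⟨1, 0, -2, 1⟩ 1, .tile 0 ⟨3, 0, -3, 1⟩ 3, .tile 0 ⟨0, 1, 0, -1⟩ 2, .lattice ((0, 0, 1), true), .tile 0 ⟨1, 0, -2, 1⟩ 0],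
    .corner ⟨0, 0, 0, -1⟩ 2 [.cell 0 ⟨0, -1, 0, 1⟩ 8, .cell 0 ⟨0, 0, 0, 0⟩ 5, .cell 0 ⟨0, 0, 0, 0⟩ 5, .cell 0 ⟨0, -1, 0, 1⟩ 8, .cell 0 ⟨0, -1, 0, 1⟩ 10, .cell 0 ⟨0, -2, 0, 1⟩ 0, .cell 0 ⟨0, -1, 0, 1⟩ 10, .cell 0 ⟨0, 0, 0, 0⟩ 5, .cell 0 ⟨0, -2, 0, 1⟩ 0, .cell 0 ⟨0, -1, 0, 1⟩ 9],
    .corner ⟨0, 0, 0, -1⟩ 1 [.cell 0 ⟨0, 0, 0, 0⟩ 5, .cell 0 ⟨0, -1, 0, 1⟩ 10, .cell 0 ⟨0, 0, 0, 0⟩ 5, .cell 0 ⟨0, 0, 0, 0⟩ 5, .cell 7 ⟨0, 1, 0, 1⟩ 6, .cell 0 ⟨0, 0, 0, 0⟩ 5, .keep, .cell 0 ⟨0, -1, 0, 1⟩ 8, .cell 0 ⟨0, 0, 0, 0⟩ 5, .cell 0 ⟨0, 0, 0, 0⟩ 5],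
    .forced (0, 0, 1) 0 ⟨-1, 0, 2, -1⟩ 0,
    .corner ⟨-1, 0, 2, -1⟩ 1 [.cell 1 ⟨-1, 0, 2, -1⟩ 3, .cell 1 ⟨-1, 0, 2, -1⟩ 3, .cell 1 ⟨-1, 0, 2, -1⟩ 3, .cell 1 ⟨-1, 0, 2, -1⟩ 3, .cell 7 ⟨0, 1, 0, 1⟩ 6, .cell 1 ⟨-1, 0, 2, -1⟩ 3, .cell 7 ⟨0, 1, 0, 1⟩ 6, .cell 1 ⟨-1, 0, 2, -1⟩ 3, .cell 1 ⟨-1, 0, 2, -1⟩ 3, .cell 1 ⟨-1, 0, 2, -1⟩ 3],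
    .forced (0, 0, 1) 0 ⟨-1, 0, 2, -1⟩ 9,
    .corner ⟨-1, 0, 2, -1⟩ 0 [.cell 1 ⟨-1, 0, 2, -1⟩ 3, .cell 7 ⟨0, 1, 0, 1⟩ 6, .cell 1 ⟨-1, 0, 2, -1⟩ 3, .cell 1 ⟨-1, 0, 2, -1⟩ 3, .cell 7 ⟨0, 1, 0, 1⟩ 6, .cell 1 ⟨-1, 0, 2, -1⟩ 3, .cell 7 ⟨0, 1, 0, 1⟩ 6, .cell 1 ⟨-1, 0, 2, -1⟩ 3, .cell 1 ⟨-1, 0, 2, -1⟩ 3, .cell 7 ⟨0, 1, 0, 1⟩ 6],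
    .corner ⟨0, 0, 0, -1⟩ 1 [.cell 0 ⟨0, 0, 0, 0⟩ 5, .cell 0 ⟨0, -1, 0, 1⟩ 10, .cell 0 ⟨0, 0, 0, 0⟩ 5, .cell 0 ⟨0, 0, 0, 0⟩ 5, .cell 7 ⟨0, 1, 0, 1⟩ 6, .cell 0 ⟨0, 0, 0, 0⟩ 5, .keep, .cell 0 ⟨0, -1, 0, 1⟩ 8, .cell 0 ⟨0, 0, 0, 0⟩ 5, .cell 0 ⟨0, 0, 0, 0⟩ 5],
    .forced (0, 0, 1) 0 ⟨-1, 0, 2, -1⟩ 0,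
    .corner ⟨-1, 0, 2, -1⟩ 1 [.cell 1 ⟨-1, 0, 2, -1⟩ 3, .cell 1 ⟨-1, 0, 2, -1⟩ 3, .cell 1 ⟨-1, 0, 2, -1⟩ 3, .cell 1 ⟨-1, 0, 2, -1⟩ 3, .cell 7 ⟨0, 1, 0, 1⟩ 6, .cell 1 ⟨-1, 0, 2, -1⟩ 3, .cell 7 ⟨0, 1, 0, 1⟩ 6, .cell 1 ⟨-1, 0, 2, -1⟩ 3, .cell 1 ⟨-1, 0, 2, -1⟩ 3, .cell 1 ⟨-1, 0, 2, -1⟩ 3],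
    .corner ⟨0, 0, 0, -1⟩ 2 [.cell 0 ⟨0, -1, 0, 1⟩ 8, .cell 0 ⟨0, 0, 0, 0⟩ 5, .cell 0 ⟨0, 0, 0, 0⟩ 5, .cell 0 ⟨0, -1, 0, 1⟩ 8, .cell 0 ⟨0, -1, 0, 1⟩ 10, .cell 0 ⟨0, -2, 0, 1⟩ 0, .cell 0 ⟨0, -1, 0, 1⟩ 10, .cell 0 ⟨0, 0, 0, 0⟩ 5, .cell 0 ⟨0, -2, 0, 1⟩ 0, .cell 0 ⟨0, -1, 0, 1⟩ 9]]
  [⟨[], [(1, -1, 2)], leftCells⟩] = true := by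
  decide +kernel

lemma refutes_1 : refutes
  [.corner ⟨0, 0, 0, 0⟩ 10 [.lattice ((1, 0, 4), false), .keep, .keep, .lattice ((0, 0, 1), false), .lattice ((1, 0, 5), false), .lattice ((0, 1, 5), true), .lattice ((2, -1, 3), true), .cell 8 ⟨0, 0, 0, 1⟩ 1, .keep, .lattice ((0, 0, 0), true)],
    .forced (1, 0, 4) 0 ⟨2, 0, -1, 0⟩ 1,
    .corner ⟨1, 0, -1, 0⟩ 10 [.tile 0 ⟨1, 0, -1, 0⟩ 0, .tile 0 ⟨2, 0, 0, 0⟩ 7, .tile 0 ⟨1, 0, 0, 0⟩ 8, .tile 0 ⟨1, 1, -1, 1⟩ 7, .keep, .tile 0 ⟨1, 0, -1, 0⟩ 0, .keep, .tile 0 ⟨2, 0, 0, 0⟩ 5, .tile 0 ⟨1, 0, -1, 0⟩ 0, .tile 0 ⟨1, 0, -1, 0⟩ 0],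
    .corner ⟨2, 0, -1, 0⟩ 0 [.tile 1 ⟨2, 0, -1, 0⟩ 1, .tile 1 ⟨1, 0, 1, 0⟩ 9, .tile 1 ⟨1, 0, 0, 0⟩ 0, .tile 1 ⟨2, -1, -1, 1⟩ 0, .tile 1 ⟨2, 0, -1, 0⟩ 1, .tile 1 ⟨2, 0, -1, 0⟩ 1, .tile 1 ⟨2, 0, -1, 0⟩ 1, .tile 1 ⟨1, 0, 1, 0⟩ 7, .tile 1 ⟨2, 0, -1, 0⟩ 1, .tile 1 ⟨2, 0, -1, 0⟩ 1],
    .corner ⟨2, 0, -1, 0⟩ 0 [.tile 1 ⟨2, 0, -1, 0⟩ 1, .tile 1 ⟨1, 0, 1, 0⟩ 9, .tile 1 ⟨1, 0, 0, 0⟩ 0, .tile 1 ⟨2, -1, -1, 1⟩ 0, .tile 1 ⟨2, 0, -1, 0⟩ 1, .tile 1 ⟨2, 0, -1, 0⟩ 1, .tile 1 ⟨2, 0, -1, 0⟩ 1, .tile 1 ⟨1, 0, 1, 0⟩ 7, .tile 1 ⟨2, 0, -1, 0⟩ 1, .tile 1 ⟨2, 0, -1, 0⟩ 1],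
    .corner ⟨1, 0, -1, 0⟩ 10 [.tile 0 ⟨1, 0, -1, 0⟩ 0, .tile 0 ⟨2, 0, 0, 0⟩ 7, .tile 0 ⟨1, 0, 0, 0⟩ 8, .tile 0 ⟨1, 0, -1, 1⟩ 0, .tile 0 ⟨1, 0, -1, 0⟩ 11, .tile 0 ⟨1, 0, -1, 0⟩ 0, .tile 0 ⟨1, 0, -1, 0⟩ 11, .tile 0 ⟨2, 0, 0, 0⟩ 5, .tile 0 ⟨1, 0, -1, 0⟩ 0, .tile 0 ⟨1, 0, -1, 0⟩ 0],
    .forced (0, 1, 4) 0 ⟨0, 0, 0, 0⟩ 1,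
    .split (0, 0, 1),
    .corner ⟨0, 0, 0, 0⟩ 2 [.lattice ((-1, 1, 0), false), .cell 2 ⟨0, 0, 0, 0⟩ 3, .cell 1 ⟨-1, 0, 0, 0⟩ 0, .lattice ((0, 0, 3), false), .lattice ((-1, 1, 1), false), .lattice ((-1, 0, 1), true), .lattice ((-1, 2, 5), true), .cell 1 ⟨0, 0, 0, 0⟩ 5, .cell 1 ⟨0, 0, 0, 0⟩ 5, .lattice ((0, 0, 2), true)],
    .corner ⟨0, 0, 1, 0⟩ 1 [.cell 0 ⟨0, 0, 1, 0⟩ 2, .cell 0 ⟨0, 0, 1, 0⟩ 2, .cell 0 ⟨0, 0, 1, 0⟩ 2, .cell 0 ⟨0, 0, 1, 0⟩ 2, .cell 0 ⟨0, 0, 1, 0⟩ 2, .cell 0 ⟨0, 0, 1, 0⟩ 2, .cell 0 ⟨0, 0, 1, 0⟩ 2, .cell 0 ⟨0, 0, 1, 0⟩ 2, .cell 0 ⟨0, 0, 1, 0⟩ 2, .cell 0 ⟨0, 0, 1, 0⟩ 2]]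
  [⟨[], [(0, 0, 5)], (1, -1, 2) :: leftCells⟩] = true := by
  decide +kernel

lemma refutes_2 : refutes
  [.split (1, -1, 1),
    .corner ⟨0, 0, 0, 0⟩ 11 [.cell 9 ⟨0, 0, 0, 1⟩ 1, .lattice ((1, 0, 3), false), .keep, .cell 3 ⟨-1, 0, 1, 0⟩ 0, .keep, .cell 9 ⟨0, 1, 0, 1⟩ 6, .keep, .lattice ((1, 0, 3), true), .cell 9 ⟨0, 0, 0, 1⟩ 1, .keep],
    .forced (0, 0, 1) 0 ⟨0, 0, 0, 1⟩ 9,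
    .corner ⟨0, 0, 0, 1⟩ 0 [.cell 9 ⟨0, 0, 0, 1⟩ 1, .cell 9 ⟨0, 0, 0, 1⟩ 1, .cell 9 ⟨0, 0, 0, 1⟩ 1, .cell 9 ⟨0, -1, 0, 2⟩ 11, .cell 9 ⟨0, 0, 0, 1⟩ 1, .cell 9 ⟨0, 0, 0, 1⟩ 1, .cell 9 ⟨0, 0, 0, 1⟩ 1, .cell 9 ⟨0, 0, 0, 1⟩ 1, .cell 9 ⟨0, 0, 0, 1⟩ 1, .cell 9 ⟨0, 0, 0, 1⟩ 1],
    .forced (1, 0, 4) 0 ⟨2, 0, -1, 0⟩ 1,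
    .corner ⟨0, 1, 0, -1⟩ 9 [.tile 0 ⟨0, 1, 0, -1⟩ 0, .tile 0 ⟨0, 1, 0, -1⟩ 11, .lattice ((1, -1, 1), false), .tile 0 ⟨1, 1, 1, -1⟩ 6, .keep, .tile 0 ⟨0, 1, 0, -1⟩ 0, .keep, .tile 0 ⟨0, 1, 0, -1⟩ 0, .lattice ((1, -1, 1), true), .tile 0 ⟨0, 1, 0, -1⟩ 11],
    .forced (1, -1, 0) 0 ⟨2, 1, -1, -1⟩ 5,
    .corner ⟨2, 0, -1, 0⟩ 11 [.tile 1 ⟨2, 0, -1, 0⟩ 1, .tile 1 ⟨2, 1, -1, 1⟩ 8, .tile 1 ⟨2, 0, -1, 1⟩ 9, .tile 1 ⟨3, 0, 0, 0⟩ 5, .keep, .tile 1 ⟨2, 0, -1, 0⟩ 1, .keep, .tile 1 ⟨2, 1, -1, 1⟩ 6, .tile 1 ⟨2, 0, -1, 0⟩ 1, .tile 1 ⟨2, 0, -1, 0⟩ 1],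
    .corner ⟨2, 1, -1, -1⟩ 10 [.tile 0 ⟨2, 1, -1, -1⟩ 0, .tile 0 ⟨3, 1, 0, -1⟩ 7, .tile 0 ⟨2, 1, 0, -1⟩ 8, .tile 0 ⟨2, 1, -1, 0⟩ 0, .tile 0 ⟨2, 1, -1, -1⟩ 11, .tile 0 ⟨2, 1, -1, -1⟩ 0, .tile 0 ⟨2, 1, -1, -1⟩ 11, .tile 0 ⟨3, 1, 0, -1⟩ 5, .tile 0 ⟨2, 1, -1, -1⟩ 0, .tile 0 ⟨2, 1, -1, -1⟩ 0],
    .corner ⟨2, 1, -1, -1⟩ 10 [.tile 0 ⟨2, 1, -1, -1⟩ 0, .tile 0 ⟨3, 1, 0, -1⟩ 7, .tile 0 ⟨2, 1, 0, -1⟩ 8, .tile 0 ⟨2, 3, -1, -2⟩ 4, .tile 0 ⟨2, 3, -1, -2⟩ 6, .tile 0 ⟨2, 1, -1, -1⟩ 0, .tile 0 ⟨2, 3, -1, -2⟩ 6, .tile 0 ⟨3, 1, 0, -1⟩ 5, .tile 0 ⟨2, 1, -1, -1⟩ 0, .tile 0 ⟨2, 1, -1, -1⟩ 0],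
    .forced (2, -2, 2) 0 ⟨1, 1, -2, -1⟩ 0,
    .split (1, -1, 4),
    .split (1, -2, 1),
    .corner ⟨0, 1, 0, -2⟩ 7 [.tile 0 ⟨0, 1, 0, -2⟩ 9, .lattice ((1, -2, 1), false), .tile 0 ⟨0, 2, 0, -3⟩ 5, .tile 0 ⟨2, 1, -1, -2⟩ 4, .cell 10 ⟨0, 1, -3, -2⟩ 0, .tile 0 ⟨0, 1, 0, -2⟩ 9, .cell 10 ⟨0, 1, -3, -2⟩ 1, .lattice ((1, -2, 1), true), .tile 0 ⟨0, 1, 0, -2⟩ 9, .tile 0 ⟨0, 1, 0, -2⟩ 9],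
    .corner ⟨0, 1, 0, -2⟩ 8 [.lattice ((2, -2, 3), false), .tile 0 ⟨2, 1, -1, -2⟩ 5, .tile 0 ⟨1, 1, 0, -2⟩ 6, .lattice ((1, -1, 0), false), .lattice ((2, -2, 4), false), .lattice ((2, -1, 4), true), .lattice ((2, -3, 2), true), .tile 0 ⟨2, 1, -1, -2⟩ 3, .tile 0 ⟨0, 1, 0, -2⟩ 9, .lattice ((1, -1, 5), true)],
    .corner ⟨1, 1, -2, -1⟩ 9 [.tile 0 ⟨1, 1, -2, -1⟩ 0, .tile 0 ⟨1, 1, -2, -1⟩ 10, .tile 0 ⟨1, 2, -2, -1⟩ 7, .tile 0 ⟨3, 1, -3, -1⟩ 3, .tile 0 ⟨3, 1, -3, -1⟩ 5, .tile 0 ⟨1, 1, -2, -1⟩ 0, .tile 0 ⟨3, 1, -3, -1⟩ 5, .tile 0 ⟨1, 1, -2, -1⟩ 0, .tile 0 ⟨1, 1, -2, -1⟩ 0, .tile 0 ⟨1, 1, -2, -1⟩ 10],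
    .forced (1, 0, 4) 0 ⟨2, 0, -1, 0⟩ 0,
    .corner ⟨0, 1, 0, -1⟩ 9 [.tile 0 ⟨0, 1, 0, -1⟩ 0, .tile 0 ⟨0, 3, 0, -2⟩ 6, .lattice ((1, -1, 1), false), .tile 0 ⟨1, 1, 1, -1⟩ 6, .keep, .tile 0 ⟨0, 1, 0, -1⟩ 0, .keep, .tile 0 ⟨0, 3, 0, -2⟩ 4, .lattice ((1, -1, 1), true), .tile 0 ⟨0, 1, 0, -1⟩ 11],
    .corner ⟨2, 0, -1, 0⟩ 11 [.tile 1 ⟨2, 0, -1, 0⟩ 0, .tile 1 ⟨2, 0, -1, 0⟩ 0, .tile 1 ⟨2, 0, -1, 1⟩ 9, .tile 1 ⟨3, 0, 0, 0⟩ 5, .tile 1 ⟨3, 0, 0, 0⟩ 7, .tile 1 ⟨2, 0, -1, 0⟩ 0, .tile 1 ⟨3, 0, 0, 0⟩ 7, .tile 1 ⟨2, 0, -1, 0⟩ 0, .tile 1 ⟨2, 0, -1, 0⟩ 0, .tile 1 ⟨2, 0, -1, 0⟩ 0],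
    .corner ⟨2, 0, -1, 0⟩ 11 [.tile 1 ⟨2, 0, -1, 0⟩ 0, .tile 1 ⟨2, 0, -1, 0⟩ 0, .tile 1 ⟨2, 0, -1, 1⟩ 9, .tile 1 ⟨3, 0, 0, 0⟩ 5, .tile 1 ⟨3, 0, 0, 0⟩ 7, .tile 1 ⟨2, 0, -1, 0⟩ 0, .tile 1 ⟨3, 0, 0, 0⟩ 7, .tile 1 ⟨2, 0, -1, 0⟩ 0, .tile 1 ⟨2, 0, -1, 0⟩ 0, .tile 1 ⟨2, 0, -1, 0⟩ 0],
    .forced (1, 0, 4) 0 ⟨2, 0, -1, 0⟩ 1,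
    .corner ⟨0, 1, 0, -1⟩ 9 [.tile 0 ⟨0, 1, 0, -1⟩ 0, .tile 0 ⟨0, 1, 0, -1⟩ 11, .lattice ((1, -1, 1), false), .tile 0 ⟨1, 1, 1, -1⟩ 6, .keep, .tile 0 ⟨0, 1, 0, -1⟩ 0, .keep, .tile 0 ⟨0, 1, 0, -1⟩ 0, .lattice ((1, -1, 1), true), .tile 0 ⟨0, 1, 0, -1⟩ 11],
    .forced (1, -1, 0) 0 ⟨2, 1, -1, -1⟩ 5,
    .corner ⟨2, 0, -1, 0⟩ 11 [.tile 1 ⟨2, 0, -1, 0⟩ 1, .tile 1 ⟨2, 0, -1, 0⟩ 1, .tile 1 ⟨2, 0, -1, 1⟩ 9, .tile 1 ⟨3, 0, 0, 0⟩ 5, .keep, .tile 1 ⟨2, 0, -1, 0⟩ 1, .keep, .tile 1 ⟨2, 0, -1, 0⟩ 1, .tile 1 ⟨2, 0, -1, 0⟩ 1, .tile 1 ⟨2, 0, -1, 0⟩ 1],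
    .corner ⟨2, 1, -1, -1⟩ 10 [.tile 0 ⟨2, 1, -1, -1⟩ 0, .tile 0 ⟨3, 1, 0, -1⟩ 7, .tile 0 ⟨2, 1, 0, -1⟩ 8, .tile 0 ⟨2, 1, -1, 0⟩ 0, .tile 0 ⟨2, 1, -1, -1⟩ 11, .tile 0 ⟨2, 1, -1, -1⟩ 0, .tile 0 ⟨2, 1, -1, -1⟩ 11, .tile 0 ⟨3, 1, 0, -1⟩ 5, .tile 0 ⟨2, 1, -1, -1⟩ 0, .tile 0 ⟨2, 1, -1, -1⟩ 0],
    .corner ⟨2, 1, -1, -1⟩ 10 [.tile 0 ⟨2, 1, -1, -1⟩ 0, .tile 0 ⟨3, 1, 0, -1⟩ 7, .tile 0 ⟨2, 1, 0, -1⟩ 8, .tile 0 ⟨2, 3, -1, -2⟩ 4, .tile 0 ⟨2, 3, -1, -2⟩ 6, .tile 0 ⟨2, 1, -1, -1⟩ 0, .tile 0 ⟨2, 3, -1, -2⟩ 6, .tile 0 ⟨3, 1, 0, -1⟩ 5, .tile 0 ⟨2, 1, -1, -1⟩ 0, .tile 0 ⟨2, 1, -1, -1⟩ 0],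
    .forced (2, -2, 2) 0 ⟨1, 1, -2, -1⟩ 0,
    .split (1, -1, 4),
    .split (1, -2, 1),
    .corner ⟨0, 1, 0, -2⟩ 7 [.tile 0 ⟨0, 1, 0, -2⟩ 9, .lattice ((1, -2, 1), false), .tile 0 ⟨0, 2, 0, -3⟩ 5, .tile 0 ⟨2, 1, -1, -2⟩ 4, .cell 10 ⟨0, 1, -3, -2⟩ 0, .tile 0 ⟨0, 1, 0, -2⟩ 9, .cell 10 ⟨0, 1, -3, -2⟩ 1, .lattice ((1, -2, 1), true), .tile 0 ⟨0, 1, 0, -2⟩ 9, .tile 0 ⟨0, 1, 0, -2⟩ 9],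
    .corner ⟨0, 1, 0, -2⟩ 8 [.lattice ((2, -2, 3), false), .tile 0 ⟨2, 1, -1, -2⟩ 5, .tile 0 ⟨1, 1, 0, -2⟩ 6, .lattice ((1, -1, 0), false), .lattice ((2, -2, 4), false), .lattice ((2, -1, 4), true), .lattice ((2, -3, 2), true), .tile 0 ⟨2, 1, -1, -2⟩ 3, .tile 0 ⟨0, 1, 0, -2⟩ 9, .lattice ((1, -1, 5), true)],
    .corner ⟨1, 1, -2, -1⟩ 9 [.tile 0 ⟨1, 1, -2, -1⟩ 0, .tile 0 ⟨1, 1, -2, -1⟩ 10, .tile 0 ⟨1, 2, -2, -1⟩ 7, .tile 0 ⟨3, 1, -3, -1⟩ 3, .tile 0 ⟨3, 1, -3, -1⟩ 5, .tile 0 ⟨1, 1, -2, -1⟩ 0, .tile 0 ⟨3, 1, -3, -1⟩ 5, .tile 0 ⟨1, 1, -2, -1⟩ 0, .tile 0 ⟨1, 1, -2, -1⟩ 0, .tile 0 ⟨1, 1, -2, -1⟩ 10],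
    .corner ⟨0, 0, 0, 0⟩ 11 [.cell 0 ⟨0, 2, 0, -1⟩ 7, .lattice ((1, 0, 3), false), .cell 0 ⟨0, 1, 0, -1⟩ 0, .cell 0 ⟨0, 1, 0, -1⟩ 0, .cell 0 ⟨0, 2, 0, -1⟩ 7, .cell 0 ⟨0, 1, 0, -1⟩ 0, .cell 0 ⟨0, 2, 0, -1⟩ 7, .lattice ((1, 0, 3), true), .cell 10 ⟨0, 0, 0, 1⟩ 1, .cell 0 ⟨0, 2, 0, -1⟩ 7]]
  [⟨[], [(1, 0, 3)], (0, 0, 5) :: (1, -1, 2) :: leftCells⟩] = true := by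
  decide +kernel

lemma refutes_3 : refutes
  [.corner ⟨0, 0, 0, 0⟩ 0 [.lattice ((0, 1, 5), false), .cell 10 ⟨0, 1, 0, 1⟩ 6, .cell 4 ⟨-1, 0, 1, 0⟩ 0, .lattice ((0, 0, 2), false), .lattice ((0, 1, 0), false), .lattice ((-1, 1, 0), true), .lattice ((1, 1, 4), true), .cell 4 ⟨0, 0, 0, 0⟩ 3, .cell 4 ⟨0, 0, 0, 0⟩ 3, .lattice ((0, 0, 1), true)]]
  [⟨[], [(0, 0, 0)], (1, 0, 3) :: (0, 0, 5) :: (1, -1, 2) :: leftCells⟩] = true := by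
  decide +kernel

lemma refutes_4 : refutes
  [.corner ⟨0, 0, 0, 0⟩ 1 [.cell 5 ⟨0, 0, 0, 0⟩ 3, .lattice ((0, 1, 4), false), .cell 5 ⟨0, 0, 0, 0⟩ 3, .cell 4 ⟨-1, 0, 0, 0⟩ 0, .cell 11 ⟨0, 1, 0, 1⟩ 6, .cell 5 ⟨0, 0, 0, 0⟩ 3, .cell 11 ⟨0, 1, 0, 1⟩ 6, .lattice ((0, 1, 4), true), .cell 5 ⟨0, 0, 0, 0⟩ 3, .cell 5 ⟨0, 0, 0, 0⟩ 3]]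
  [⟨[], [(0, 1, 4)], (0, 0, 0) :: (1, 0, 3) :: (0, 0, 5) :: (1, -1, 2) :: leftCells⟩] = true := by
  decide +kernel

lemma refutes_5 : refutes
  [.corner ⟨0, 0, 0, 0⟩ 2 [.lattice ((-1, 1, 0), false), .cell 6 ⟨0, 0, 0, 0⟩ 3, .cell 5 ⟨-1, 0, 0, 0⟩ 0, .lattice ((0, 0, 3), false), .lattice ((-1, 1, 1), false), .lattice ((-1, 0, 1), true), .lattice ((-1, 2, 5), true), .cell 5 ⟨0, 0, 0, 0⟩ 5, .cell 5 ⟨0, 0, 0, 0⟩ 5, .lattice ((0, 0, 2), true)]]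
  [⟨[], [(0, 0, 1)], (0, 1, 4) :: (0, 0, 0) :: (1, 0, 3) :: (0, 0, 5) :: (1, -1, 2) :: leftCells⟩] = true := by
  decide +kernel

namespace Cell

def shift (x y : ℤ) (c : Cell) : Cell := (c.1 + x, c.2.1 + y, c.2.2)

end Cell

lemma frame_shift (x y : ℤ) (c : Cell) (z : ℂ) :
    frame (c.shift x y) (z + (x + y * ω)) = frame c z := by
  simp only [frame, Cell.shift]; push_cast; ring

lemma mem_cellSet_shift {x y : ℤ} {c : Cell} {z : ℂ} :
    z + (x + y * ω) ∈ cellSet (c.shift x y) ↔ z ∈ cellSet c := by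
  simp only [mem_cellSet, locX, locY, frame_shift]

lemma mem_cellInt_shift {x y : ℤ} {c : Cell} {z : ℂ} :
    z + (x + y * ω) ∈ cellInt (c.shift x y) ↔ z ∈ cellInt c := by
  simp only [mem_cellInt, locX, locY, frame_shift]

lemma mem_tileSet_shift {x y : ℤ} {t : Tile} {z : ℂ} :
    z + (x + y * ω) ∈ tileSet (t.1.shift x y, t.2) ↔ z ∈ tileSet t := by
  obtain ⟨c, b⟩ := t
  cases b
  · simp only [mem_tileSet_false, locX, locY, frame_shift]
  · simp only [mem_tileSet_true, locX, locY, frame_shift]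

lemma OffLattice.shift {A : Set (Set ℂ)} {U : Set Cell} (h : OffLattice A U) (x y : ℤ) :
    OffLattice ((fun S => (fun z => z + (x + y * ω)) ⁻¹' S) '' A) (Cell.shift x y ⁻¹' U) := by
  have hpre : ∀ S : Set ℂ, interior ((fun z => z + (x + y * ω)) ⁻¹' S) =
      (fun z => z + (x + y * ω)) ⁻¹' interior S := fun S =>
    ((Homeomorph.addRight (x + y * ω : ℂ)).preimage_interior S).symm
  refine ⟨h.finite.image _, ?_, ?_, ?_, ?_, ?_⟩
  · rintro _ ⟨S, hS, rfl⟩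
    obtain ⟨f, a, b, ha, rfl⟩ := h.copy S hS
    refine ⟨f, a, b - (x + y * ω), ha, ?_⟩
    ext z
    simp only [movedSet, Set.mem_preimage, Set.mem_ofPred_eq]
    ring_nf
  · rintro _ ⟨S, hS, rfl⟩ _ ⟨T, hT, rfl⟩ hne
    have : S ≠ T := fun h => hne (by rw [h])
    simp only [Function.onFun, hpre]
    exact (h.disjoint hS hT this).preimage _
  · rintro _ ⟨S, hS, rfl⟩ t ht
    refine h.off S hS (t.1.shift x y, t.2) ?_
    ext z
    have h1 : z - (x + y * ω) ∈ (fun z => z + (x + y * ω)) ⁻¹' S ↔ z ∈ S := by simp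
    rw [← h1]
    change (z - (x + y * ω) ∈ (fun S => (fun z => z + (x + y * ω)) ⁻¹' S) S) ↔ _
    rw [ht, ← mem_tileSet_shift (x := x) (y := y), sub_add_cancel]
  · intro c hc z hz
    obtain ⟨S, hS, hmem⟩ := h.cover _ hc (mem_cellSet_shift.2 hz)
    exact ⟨_, ⟨S, hS, rfl⟩, hmem⟩
  · rintro c hc _ ⟨S, hS, rfl⟩
    rw [hpre, Set.disjoint_left]
    exact fun z hz hz' => Set.disjoint_left.1 (h.out _ hc S hS) (mem_cellInt_shift.2 hz) hz'

namespace Cell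

/-- Twice the real part of the starting point. -/
def left (c : Cell) : ℤ := 2 * c.1 + c.2.1

end Cell

lemma OffLattice.no_leftmost {A : Set (Set ℂ)} {U : Set Cell} (h : OffLattice A U)
    (hl : ∀ c ∈ U, 0 ≤ c.left ∧ 0 ≤ c.rev.left) {k : Fin 6}
    (hk : (0, 0, k) ∈ U ∨ Cell.rev (0, 0, k) ∈ U) : False := by
  have hout : ∀ c ∈ leftCells, c ∉ U := by
    intro c hc hU
    have := hl c hU
    revert this hc
    have : ∀ c ∈ leftCells, ¬ (0 ≤ c.left ∧ 0 ≤ c.rev.left) := by decide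
    exact fun hc => this c hc
  have key : ∀ (c : Cell) (cs : List Cell) (ss : List Step),
      refutes ss [⟨[], [c], cs ++ leftCells⟩] = true → (∀ d ∈ cs, d ∉ U) → c ∉ U := by
    intro c cs ss hr hcs hc
    refine h.refutes_sound ss _ hr _ List.mem_cons_self ⟨?_, ?_, ?_⟩
    · simp
    · intro d hd; rw [List.mem_singleton.1 hd]; exact hc
    · intro d hd
      rcases List.mem_append.1 hd with hd | hd
      · exact hcs d hd
      · exact hout d hd
  have h0 := key (1, -1, 2) [] _ refutes_0 (by simp)
  have h1 := key (0, 0, 5) [_] _ refutes_1 (by simpa using h0)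
  have h2 := key (1, 0, 3) [_, _] _ refutes_2 (List.forall_mem_cons.2 ⟨h1, by simpa using h0⟩)
  have h3 := key (0, 0, 0) [_, _, _] _ refutes_3
    (List.forall_mem_cons.2 ⟨h2, List.forall_mem_cons.2 ⟨h1, by simpa using h0⟩⟩)
  have h4 := key (0, 1, 4) [_, _, _, _] _ refutes_4 (List.forall_mem_cons.2 ⟨h3,
    List.forall_mem_cons.2 ⟨h2, List.forall_mem_cons.2 ⟨h1, by simpa using h0⟩⟩⟩)
  have h5 := key (0, 0, 1) [_, _, _, _, _] _ refutes_5 (List.forall_mem_cons.2 ⟨h4,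
    List.forall_mem_cons.2 ⟨h3, List.forall_mem_cons.2 ⟨h2, List.forall_mem_cons.2
      ⟨h1, by simpa using h0⟩⟩⟩⟩)
  rcases hk with hk | hk <;> have hl' := hl _ hk <;> fin_cases k
  · exact h3 hk
  · exact h5 hk
  · revert hl'; decide
  · revert hl'; decide
  · revert hl'; decide
  · exact h1 hk
  · exact h2 hk
  · exact h4 hk
  · revert hl'; decide
  · revert hl'; decide
  · revert hl'; decide
  · exact h0 hk

lemma Cell.rev_rev (c : Cell) : c.rev.rev = c := by
  obtain ⟨m, n, k⟩ := c
  fin_cases k <;> simp [Cell.rev, unitX, unitY]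

theorem OffLattice.eq_empty {A : Set (Set ℂ)} {U : Set Cell} (h : OffLattice A U) (hU : U.Finite) :
    U = ∅ := by
  by_contra hne
  obtain ⟨c, hc, hmin⟩ := Set.exists_min_image (U ∪ Cell.rev '' U) Cell.left
    (hU.union (hU.image _)) ((Set.nonempty_iff_ne_empty.2 hne).mono Set.subset_union_left)
  have hleft : ∀ (d : Cell), (d.shift c.1 c.2.1).left = d.left + c.left := by
    intro d; simp only [Cell.left, Cell.shift]; ring
  have hrev : ∀ (d : Cell), (d.shift c.1 c.2.1).rev = d.rev.shift c.1 c.2.1 := by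
    intro d; simp only [Cell.rev, Cell.shift, Prod.mk.injEq, and_true]; constructor <;> ring
  have hc0 : Cell.shift c.1 c.2.1 (0, 0, c.2.2) = c := by simp [Cell.shift]
  refine (h.shift c.1 c.2.1).no_leftmost (k := c.2.2) ?_ ?_
  · intro d hd
    have h1 := hmin _ (Or.inl hd)
    have h2 := hmin _ (Or.inr ⟨_, hd, rfl⟩)
    rw [hleft] at h1
    rw [hrev, hleft] at h2
    exact ⟨by linarith, by linarith⟩
  · rcases hc with hc | ⟨d, hd, hdc⟩
    · exact Or.inl (by rwa [Set.mem_preimage, hc0])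
    · refine Or.inr ?_
      rw [Set.mem_preimage, ← hrev, hc0, ← hdc, Cell.rev_rev]
      exact hd

/-! ### The region as a union of cells -/

/-- In the direction of `u` the region ends at `a + b + c`, and already at `b + c` where the
transversal coordinate `v` is less than `-(a + b)`. -/
def Notch {R : Type*} [Ring R] [LinearOrder R] (a b c u v : R) : Prop :=
  u ≤ a + b + c ∧ (-(a + b) ≤ v ∨ u ≤ b + c)

def StrictNotch (a b c u v : ℝ) : Prop := u < a + b + c ∧ (-(a + b) < v ∨ u < b + c)

/-- The condition obtained from `P` in the six directions of the lattice. -/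
def AllSides (P : ℝ → ℝ → Prop) (z : ℂ) : Prop :=
  P (coX z) (coY z) ∧ P (coX z + coY z) (-coX z) ∧ P (coY z) (-coX z - coY z) ∧
    P (-coX z) (-coY z) ∧ P (-coX z - coY z) (coX z) ∧ P (-coY z) (coX z + coY z)

lemma co_ω_mul (z : ℂ) : coX (ω * z) = -coY z ∧ coY (ω * z) = coX z + coY z := by
  have h : ω * z = ((-coY z : ℝ) : ℂ) + ((coX z + coY z : ℝ) : ℂ) * ω := by
    have h1 := ω_sq
    have h2 := eq_coX_add_coY z
    push_cast
    linear_combination ω * h2 + coY z * h1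
  rw [h]
  exact ⟨coX_combo _ _, coY_combo _ _⟩

lemma allSides_ω_mul {P : ℝ → ℝ → Prop} {z : ℂ} : AllSides P (ω * z) ↔ AllSides P z := by
  have e1 : -coY z + (coX z + coY z) = coX z := by ring
  have e3 : -(coX z + coY z) = -coX z - coY z := by ring
  have e4 : coY z - (coX z + coY z) = -coX z := by ring
  simp only [AllSides, (co_ω_mul z).1, (co_ω_mul z).2, e1, e3, e4, neg_neg]
  tauto

lemma allSides_ω_pow_mul {P : ℝ → ℝ → Prop} {z : ℂ} (i : ℕ) :
    AllSides P (ω ^ i * z) ↔ AllSides P z := by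
  induction i with
  | zero => simp
  | succ i ih => rw [pow_succ', mul_assoc, allSides_ω_mul, ih]

lemma mem_convexHull_zero {v w z : ℂ} : z ∈ convexHull ℝ {0, v, w} ↔
    ∃ s t : ℝ, 0 ≤ s ∧ 0 ≤ t ∧ s + t ≤ 1 ∧ z = s * v + t * w := by
  constructor
  · have hc : Convex ℝ {z : ℂ | ∃ s t : ℝ, 0 ≤ s ∧ 0 ≤ t ∧ s + t ≤ 1 ∧ z = s * v + t * w} := by
      rintro _ ⟨s, t, hs, ht, hst, rfl⟩ _ ⟨s', t', hs', ht', hst', rfl⟩ a b ha hb hab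
      refine ⟨a * s + b * s', a * t + b * t', by positivity, by positivity, by nlinarith, ?_⟩
      simp only [Complex.real_smul]
      push_cast
      ring
    refine fun h => convexHull_min ?_ hc h
    rintro _ (rfl | rfl | rfl)
    · exact ⟨0, 0, le_rfl, le_rfl, by norm_num, by simp⟩
    · exact ⟨1, 0, zero_le_one, le_rfl, by norm_num, by simp⟩
    · exact ⟨0, 1, le_rfl, zero_le_one, by norm_num, by simp⟩
  · rintro ⟨s, t, hs, ht, hst, rfl⟩
    have hsub := subset_convexHull ℝ ({0, v, w} : Set ℂ)
    have hmem : (0 : ℂ) ∈ ({0, v, w} : Set ℂ) ∧ v ∈ ({0, v, w} : Set ℂ) ∧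
        w ∈ ({0, v, w} : Set ℂ) := by simp
    have := (convex_convexHull ℝ ({0, v, w} : Set ℂ)).triple_mem (hsub hmem.1)
      (hsub hmem.2.1) (hsub hmem.2.2) (a := 1 - s - t) (b := s) (c := t)
      (by linarith) hs ht (by ring)
    simpa using this

/-- The oblique coordinates of the vertices `0`, `1`, `2`, `3`. -/
def cornerXY (a b c : ℝ) : ℕ → ℝ × ℝ
  | 0 => (b + c, -(a + b))
  | 1 => (a + b + c, -(a + b))
  | 2 => (a + b + c, -a)
  | _ => (a + b, c - a)

lemma flowerVertex_eq (a b c : ℝ) (i l : ℕ) (hl : l ≤ 3) : flowerVertex a b c (3 * i + l) =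
    ω ^ i * ((cornerXY a b c l).1 + (cornerXY a b c l).2 * ω) := by
  have h := ω_sq
  interval_cases l
  · have e1 : (3 * i + 0) / 3 = i := by omega
    have e2 : (3 * i + 0) % 3 = 0 := by omega
    rw [flowerVertex, e1, e2]; simp only [cornerXY]; push_cast; simp; left; ring
  · have e1 : (3 * i + 1) / 3 = i := by omega
    have e2 : (3 * i + 1) % 3 = 1 := by omega
    rw [flowerVertex, e1, e2]; simp only [cornerXY]; push_cast; simp; left; ring
  · have e1 : (3 * i + 2) / 3 = i := by omega
    have e2 : (3 * i + 2) % 3 = 2 := by omega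
    rw [flowerVertex, e1, e2]; simp only [cornerXY]; push_cast; simp; left; ring
  · have e1 : (3 * i + 3) / 3 = i + 1 := by omega
    have e2 : (3 * i + 3) % 3 = 0 := by omega
    rw [flowerVertex, e1, e2]; simp only [cornerXY]; push_cast
    linear_combination (-(a + b) : ℂ) * ω ^ i * h

lemma mem_flower {a b c : ℝ} {z : ℂ} : z ∈ flower a b c ↔ ∃ i < 6, ∃ l < 3, ∃ s t : ℝ, 0 ≤ s ∧
    0 ≤ t ∧ s + t ≤ 1 ∧
    z = ω ^ i * (((s * (cornerXY a b c l).1 + t * (cornerXY a b c (l + 1)).1 : ℝ) : ℂ) +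
      ((s * (cornerXY a b c l).2 + t * (cornerXY a b c (l + 1)).2 : ℝ) : ℂ) * ω) := by
  simp only [flower, Set.mem_iUnion, mem_convexHull_zero, Finset.mem_range, exists_prop]
  have key : ∀ i l, l < 3 → ∀ s t : ℝ, (s : ℂ) * flowerVertex a b c (3 * i + l) +
      t * flowerVertex a b c (3 * i + l + 1) =
      ω ^ i * (((s * (cornerXY a b c l).1 + t * (cornerXY a b c (l + 1)).1 : ℝ) : ℂ) +
      ((s * (cornerXY a b c l).2 + t * (cornerXY a b c (l + 1)).2 : ℝ) : ℂ) * ω) := by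
    intro i l hl s t
    rw [add_assoc, flowerVertex_eq a b c i l (by omega), flowerVertex_eq a b c i (l + 1) (by omega)]
    push_cast
    ring
  constructor
  · rintro ⟨k, hk, s, t, hs, ht, hst, hz⟩
    refine ⟨k / 3, by omega, k % 3, Nat.mod_lt _ (by norm_num), s, t, hs, ht, hst, ?_⟩
    rw [← key _ _ (Nat.mod_lt _ (by norm_num)), Nat.div_add_mod]
    exact hz
  · rintro ⟨i, hi, l, hl, s, t, hs, ht, hst, hz⟩
    refine ⟨3 * i + l, by omega, s, t, hs, ht, hst, ?_⟩
    rw [key i l hl]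
    exact hz

section

variable {a b c : ℝ}

lemma StrictNotch.combo (ha : 0 < a) (hb : 0 < b) (hc : 0 < c) {u v u' v' p q : ℝ} (hp : 0 ≤ p)
    (hq : 0 ≤ q) (hpq : p + q < 1) (h1 : u ≤ a + b + c) (h2 : u' ≤ a + b + c)
    (h3 : (-(a + b) ≤ v ∧ -(a + b) ≤ v') ∨ (u ≤ b + c ∧ u' ≤ b + c)) :
    StrictNotch a b c (p * u + q * u') (p * v + q * v') := by
  have key : ∀ {x x' m : ℝ}, 0 < m → x ≤ m → x' ≤ m → p * x + q * x' < m := by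
    intro x x' m hm hx hx'
    have := mul_le_mul_of_nonneg_left hx hp
    have := mul_le_mul_of_nonneg_left hx' hq
    nlinarith
  refine ⟨key (by positivity) h1 h2, ?_⟩
  rcases h3 with ⟨h3, h4⟩ | ⟨h3, h4⟩
  · left
    have := key (x := -v) (x' := -v') (m := a + b) (by positivity) (by linarith) (by linarith)
    linarith
  · right
    exact key (by positivity) h3 h4

lemma strictNotch_of_mem_flower (ha : 0 < a) (hb : 0 < b) (hc : 0 < c) {z : ℂ}
    (hz : z ∈ flower a b c) {r : ℝ} (hr0 : 0 ≤ r) (hr : r < 1) :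
    AllSides (StrictNotch a b c) (r * z) := by
  obtain ⟨i, -, l, hl, s, t, hs, ht, hst, rfl⟩ := mem_flower.1 hz
  rw [mul_left_comm, allSides_ω_pow_mul]
  have e : (r : ℂ) * (((s * (cornerXY a b c l).1 + t * (cornerXY a b c (l + 1)).1 : ℝ) : ℂ) +
      ((s * (cornerXY a b c l).2 + t * (cornerXY a b c (l + 1)).2 : ℝ) : ℂ) * ω) =
      ((r * s * (cornerXY a b c l).1 + r * t * (cornerXY a b c (l + 1)).1 : ℝ) : ℂ) +
      ((r * s * (cornerXY a b c l).2 + r * t * (cornerXY a b c (l + 1)).2 : ℝ) : ℂ) * ω := by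
    push_cast; ring
  have hp : 0 ≤ r * s := by positivity
  have hq : 0 ≤ r * t := by positivity
  have hpq : r * s + r * t < 1 := by nlinarith
  rw [e, AllSides, coX_combo, coY_combo]
  have comb : ∀ {u v u' v' U V : ℝ}, U = r * s * u + r * t * u' → V = r * s * v + r * t * v' →
      u ≤ a + b + c → u' ≤ a + b + c →
      ((-(a + b) ≤ v ∧ -(a + b) ≤ v') ∨ (u ≤ b + c ∧ u' ≤ b + c)) → StrictNotch a b c U V := by
    rintro u v u' v' U V rfl rfl h1 h2 h3
    exact StrictNotch.combo ha hb hc hp hq hpq h1 h2 h3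
  generalize hv : cornerXY a b c l = v
  generalize hw : cornerXY a b c (l + 1) = w
  refine ⟨comb (u := v.1) (u' := w.1) (v := v.2) (v' := w.2) (by ring) (by ring) ?_ ?_ ?_,
    comb (u := v.1 + v.2) (u' := w.1 + w.2) (v := -v.1) (v' := -w.1) (by ring) (by ring) ?_ ?_ ?_,
    comb (u := v.2) (u' := w.2) (v := -v.1 - v.2) (v' := -w.1 - w.2) (by ring) (by ring) ?_ ?_ ?_,
    comb (u := -v.1) (u' := -w.1) (v := -v.2) (v' := -w.2) (by ring) (by ring) ?_ ?_ ?_,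
    comb (u := -v.1 - v.2) (u' := -w.1 - w.2) (v := v.1) (v' := w.1) (by ring) (by ring) ?_ ?_ ?_,
    comb (u := -v.2) (u' := -w.2) (v := v.1 + v.2) (v' := w.1 + w.2) (by ring) (by ring) ?_ ?_ ?_⟩ <;>
    subst hv hw <;> interval_cases l <;> simp only [cornerXY] <;>
    first
    | linarith
    | exact Or.inl ⟨by linarith, by linarith⟩
    | exact Or.inr ⟨by linarith, by linarith⟩

lemma exists_sector (a b c : ℝ) (z : ℂ) : ∃ i < 6, ∃ y, z = ω ^ i * y ∧
    0 ≤ (b + c) * coY y + (a + b) * coX y ∧ (a + b) * coY y - (c - a) * coX y ≤ 0 := by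
  set D : ℂ → ℝ := fun y => (b + c) * coY y + (a + b) * coX y with hD
  have hstep : ∀ y, D y = (a + b) * coY (ω * y) - (c - a) * coX (ω * y) := by
    intro y
    rw [(co_ω_mul y).1, (co_ω_mul y).2, hD]
    ring
  have hneg : ∀ y, D (-y) = -D y := by
    intro y; simp [hD, coX, coY]; ring
  have w6 := ω_pow_six
  have w3 : ω ^ 3 = -1 := by
    rw [← ζ_pow_two_mul]; exact ζ_pow_six
  have hz : ∀ i ≤ 6, z = ω ^ i * (ω ^ (6 - i) * z) := by
    intro i hi
    rw [← mul_assoc, ← pow_add, Nat.add_sub_of_le hi, w6, one_mul]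
  by_contra! hcon
  have next : ∀ i < 6, 0 ≤ D (ω ^ (6 - i) * z) → 0 < D (ω ^ (6 - (i + 1)) * z) := by
    intro i hi h
    have := hcon i hi _ (hz i hi.le) h
    rw [hstep, ← mul_assoc, ← pow_succ', show 6 - (i + 1) + 1 = 6 - i by omega]
    exact this
  have h3 : D (ω ^ (6 - 3) * z) = -D (ω ^ (6 - 0) * z) := by
    norm_num
    rw [w3, w6, ← hneg]; ring_nf
  have h06 : ω ^ (6 - 0) * z = ω ^ (6 - 6) * z := by norm_num [w6]
  rcases le_or_gt 0 (D (ω ^ (6 - 0) * z)) with h | h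
  · have := next 2 (by norm_num) (next 1 (by norm_num) (next 0 (by norm_num) h).le).le
    linarith
  · have h4 : 0 ≤ D (ω ^ (6 - 3) * z) := by linarith
    have := next 5 (by norm_num) (next 4 (by norm_num) (next 3 (by norm_num) h4).le).le
    rw [← h06] at this
    linarith

lemma mem_flower_of_notch (ha : 0 < a) (hb : 0 < b) (hc : 0 < c) {z : ℂ}
    (hz : AllSides (Notch a b c) z) : z ∈ flower a b c := by
  obtain ⟨i, hi, w, rfl, h0, h3⟩ := exists_sector a b c z
  rw [allSides_ω_pow_mul] at hz
  obtain ⟨⟨n1, n2⟩, ⟨-, n3⟩, -⟩ := hz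
  rw [mem_flower]
  have hw := eq_coX_add_coY w
  obtain ⟨x, hx⟩ : ∃ x, x = coX w := ⟨_, rfl⟩
  obtain ⟨y, hy⟩ : ∃ y, y = coY w := ⟨_, rfl⟩
  simp only [← hx, ← hy] at hw h0 h3 n1 n2 n3
  refine ⟨i, hi, ?_⟩
  suffices ∃ l < 3, ∃ s t : ℝ, 0 ≤ s ∧ 0 ≤ t ∧ s + t ≤ 1 ∧
      s * (cornerXY a b c l).1 + t * (cornerXY a b c (l + 1)).1 = x ∧
      s * (cornerXY a b c l).2 + t * (cornerXY a b c (l + 1)).2 = y by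
    obtain ⟨l, hl, s, t, hs, ht, hst, e1, e2⟩ := this
    exact ⟨l, hl, s, t, hs, ht, hst, by rw [e1, e2, ← hw]⟩
  rcases le_total ((a + b + c) * y + (a + b) * x) 0 with h1 | h1
  · refine ⟨0, by norm_num, -((a + b + c) * y + (a + b) * x) / ((a + b) * a),
      ((b + c) * y + (a + b) * x) / ((a + b) * a), div_nonneg (by linarith) (by positivity),
      div_nonneg (by linarith) (by positivity), ?_, ?_, ?_⟩
    · rw [← add_div, div_le_one (by positivity)]
      have : -(a + b) ≤ y := by
        by_contra hcon
        push Not at hcon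
        rcases n2 with n2 | n2
        · linarith
        · have := mul_le_mul_of_nonneg_left n2 (by positivity : 0 ≤ a + b)
          have := mul_lt_mul_of_pos_left hcon (by positivity : 0 < b + c)
          nlinarith
      nlinarith
    · simp only [cornerXY]; field_simp; ring
    · simp only [cornerXY]; field_simp; ring
  rcases le_total ((a + b + c) * y + a * x) 0 with h2 | h2
  · refine ⟨1, by norm_num, -((a + b + c) * y + a * x) / ((a + b + c) * b),
      ((a + b + c) * y + (a + b) * x) / ((a + b + c) * b), div_nonneg (by linarith) (by positivity),
      div_nonneg (by linarith) (by positivity), ?_, ?_, ?_⟩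
    · rw [← add_div, div_le_one (by positivity)]
      nlinarith
    · simp only [cornerXY]; field_simp; ring
    · simp only [cornerXY]; field_simp; ring
  · refine ⟨2, by norm_num, -((a + b) * y - (c - a) * x) / (c * (b + c)),
      ((a + b + c) * y + a * x) / (c * (b + c)), div_nonneg (by linarith) (by positivity),
      div_nonneg (by linarith) (by positivity), ?_, ?_, ?_⟩
    · rw [← add_div, div_le_one (by positivity)]
      have : x + y ≤ b + c := by
        by_contra hcon
        push Not at hcon
        rcases n3 with n3 | n3
        · have := mul_le_mul_of_nonneg_left (neg_le_neg_iff.1 n3) (by positivity : 0 ≤ b + c)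
          have := mul_lt_mul_of_pos_left hcon (by positivity : 0 < a + b)
          nlinarith
        · linarith
      nlinarith
    · simp only [cornerXY]; field_simp; ring
    · simp only [cornerXY]; field_simp; ring

end

/-! ### The cells of the region -/

namespace Cell

def parity (c : Cell) : ℤ := ((c.2.2 : ℕ) % 2 : ℕ)

def floorS (c : Cell) : ℤ := c.floorX + c.floorY + c.parity

/-- The cell lies in the region `flower a b c`. -/
def InFlower (a b c : ℤ) (d : Cell) : Prop :=
  Notch a b c (d.floorX + 1) d.floorY ∧ Notch a b c (d.floorS + 1) (-d.floorX - 1) ∧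
    Notch a b c (d.floorY + 1) (-d.floorS - 1) ∧ Notch a b c (-d.floorX) (-d.floorY - 1) ∧
    Notch a b c (-d.floorS) d.floorX ∧ Notch a b c (-d.floorY) d.floorS

end Cell

lemma bounds_of_mem_cellSet {c : Cell} {z : ℂ} (h : z ∈ cellSet c) :
    (c.floorX ≤ coX z ∧ coX z ≤ c.floorX + 1) ∧ (c.floorY ≤ coY z ∧ coY z ≤ c.floorY + 1) ∧
      (c.floorS ≤ coX z + coY z ∧ coX z + coY z ≤ c.floorS + 1) := by
  obtain ⟨m, n, k⟩ := c
  rw [mem_cellSet] at h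
  have ht := loc_table m n k z
  fin_cases k <;> simp [Cell.floorX, Cell.floorY, Cell.floorS, Cell.parity, Prod.ext_iff] at ht h ⊢ <;>
    obtain ⟨h1, h2⟩ := ht <;>
    rw [h1, h2] at h <;> obtain ⟨h3, h4, h5⟩ := h <;>
    refine ⟨⟨?_, ?_⟩, ⟨?_, ?_⟩, ?_, ?_⟩ <;> linarith

lemma exists_mem_cellSet (z : ℂ) : ∃ c, z ∈ cellSet c := by
  have h1 := Int.floor_le (coX z)
  have h2 := Int.lt_floor_add_one (coX z)
  have h3 := Int.floor_le (coY z)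
  have h4 := Int.lt_floor_add_one (coY z)
  rcases le_total (coX z - ⌊coX z⌋ + (coY z - ⌊coY z⌋)) 1 with h | h
  · have ht := loc_table ⌊coX z⌋ ⌊coY z⌋ 0 z
    simp [Prod.ext_iff, -Int.self_sub_floor] at ht
    obtain ⟨c, -, hc⟩ := mem_triangle.1 (show z ∈ triangle (⌊coX z⌋, ⌊coY z⌋, 0) by
      rw [triangle, Set.mem_ofPred_eq, ht.1, ht.2]
      exact ⟨by linarith, by linarith, by linarith⟩)
    exact ⟨c, hc⟩
  · have ht := loc_table (⌊coX z⌋ + 1) ⌊coY z⌋ 1 z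
    simp [Prod.ext_iff, -Int.self_sub_floor] at ht
    obtain ⟨c, -, hc⟩ := mem_triangle.1 (show z ∈ triangle (⌊coX z⌋ + 1, ⌊coY z⌋, 1) by
      rw [triangle, Set.mem_ofPred_eq, ht.1, ht.2]
      exact ⟨by linarith, by linarith, by linarith⟩)
    exact ⟨c, hc⟩

lemma InFlower.bound {a b c : ℤ} {d : Cell} (h : d.InFlower a b c) :
    -(a + b + c) ≤ d.floorX ∧ d.floorX < a + b + c ∧ -(a + b + c) ≤ d.floorY ∧
      d.floorY < a + b + c := by
  obtain ⟨⟨h1, -⟩, -, ⟨h3, -⟩, ⟨h4, -⟩, -, h6, -⟩ := h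
  omega

lemma finite_inFlower (a b c : ℤ) : {d : Cell | d.InFlower a b c}.Finite := by
  refine ((Set.finite_Icc (-(a + b + c) - 1) (a + b + c + 1)).prod
    ((Set.finite_Icc (-(a + b + c) - 1) (a + b + c + 1)).prod (Set.finite_univ (α := Fin 6)))).subset ?_
  rintro ⟨m, n, k⟩ h
  have hb := InFlower.bound h
  have : -1 ≤ Cell.floorX (0, 0, k) ∧ Cell.floorX (0, 0, k) ≤ 0 ∧ -1 ≤ Cell.floorY (0, 0, k) ∧
      Cell.floorY (0, 0, k) ≤ 0 := by
    fin_cases k <;> decide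
  simp only [Cell.floorX, Cell.floorY] at hb this
  simp only [Set.mem_prod, Set.mem_Icc, Set.mem_univ, and_true]
  omega

lemma flower_eq {a b c : ℤ} (ha : 0 < a) (hb : 0 < b) (hc : 0 < c) :
    flower a b c = ⋃ d ∈ {d : Cell | d.InFlower a b c}, cellSet d := by
  have ha' : (0 : ℝ) < a := by exact_mod_cast ha
  have hb' : (0 : ℝ) < b := by exact_mod_cast hb
  have hc' : (0 : ℝ) < c := by exact_mod_cast hc
  apply Set.Subset.antisymm
  · intro z hz
    have hclosed : IsClosed (⋃ d ∈ {d : Cell | d.InFlower a b c}, cellSet d) :=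
      (finite_inFlower a b c).isClosed_biUnion fun d _ => isClosed_polySet _
    have hlim : Tendsto (fun t : ℝ => ((1 - t : ℝ) : ℂ) * z) (𝓝[>] 0) (𝓝 z) := by
      have hcont : Continuous (fun t : ℝ => ((1 - t : ℝ) : ℂ) * z) := by fun_prop
      have h := hcont.tendsto 0
      simp only [sub_zero, Complex.ofReal_one, one_mul] at h
      exact h.mono_left nhdsWithin_le_nhds
    refine hclosed.mem_of_tendsto hlim ?_
    filter_upwards [Ioo_mem_nhdsGT (zero_lt_one' ℝ)] with t ht
    obtain ⟨d, hd⟩ := exists_mem_cellSet (((1 - t : ℝ) : ℂ) * z)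
    have hs := strictNotch_of_mem_flower ha' hb' hc' hz (r := 1 - t) (by linarith [ht.2])
      (by linarith [ht.1])
    generalize ((1 - t : ℝ) : ℂ) * z = w at hd hs ⊢
    refine Set.mem_biUnion (x := d) ?_ hd
    obtain ⟨⟨x1, x2⟩, ⟨y1, y2⟩, s1, s2⟩ := bounds_of_mem_cellSet hd
    have key : ∀ {u v : ℝ} {p q : ℤ}, StrictNotch a b c u v → (p : ℝ) ≤ u → v ≤ q + 1 →
        Notch a b c (p + 1) q := by
      rintro u v p q ⟨h1, h2⟩ hu hv
      refine ⟨?_, ?_⟩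
      · have : (p : ℝ) < (a + b + c : ℤ) := by push_cast; linarith
        have : p < a + b + c := by exact_mod_cast this
        omega
      · rcases h2 with h2 | h2
        · left
          have : ((-(a + b) : ℤ) : ℝ) < ((q + 1 : ℤ) : ℝ) := by push_cast; linarith
          have : -(a + b) < q + 1 := by exact_mod_cast this
          omega
        · right
          have : (p : ℝ) < (b + c : ℤ) := by push_cast; linarith
          have : p < b + c := by exact_mod_cast this
          omega
    obtain ⟨n1, n2, n3, n4, n5, n6⟩ := hs
    refine ⟨key n1 x1 y2, key n2 s1 ?_, key n3 y1 ?_, ?_, ?_, ?_⟩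
    · push_cast; linarith
    · push_cast; linarith
    · have := key (p := -d.floorX - 1) (q := -d.floorY - 1) n4 (by push_cast; linarith)
        (by push_cast; linarith)
      simpa using this
    · have := key (p := -d.floorS - 1) (q := d.floorX) n5 (by push_cast; linarith)
        (by linarith)
      simpa using this
    · have := key (p := -d.floorY - 1) (q := d.floorS) n6 (by push_cast; linarith)
        (by linarith)
      simpa using this
  · intro z hz
    simp only [Set.mem_iUnion, exists_prop] at hz
    obtain ⟨d, hd, hz⟩ := hz
    refine mem_flower_of_notch ha' hb' hc' ?_
    obtain ⟨⟨x1, x2⟩, ⟨y1, y2⟩, s1, s2⟩ := bounds_of_mem_cellSet hz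
    have key : ∀ {u v : ℝ} {p q : ℤ}, Notch a b c p q → u ≤ p → q ≤ v →
        Notch (a : ℝ) b c u v := by
      rintro u v p q ⟨h1, h2⟩ hu hv
      refine ⟨?_, ?_⟩
      · have : (p : ℝ) ≤ (a + b + c : ℤ) := by exact_mod_cast h1
        push_cast at this; linarith
      · rcases h2 with h2 | h2
        · left
          have : ((-(a + b) : ℤ) : ℝ) ≤ q := by exact_mod_cast h2
          push_cast at this; linarith
        · right
          have : (p : ℝ) ≤ (b + c : ℤ) := by exact_mod_cast h2
          push_cast at this; linarith
    obtain ⟨n1, n2, n3, n4, n5, n6⟩ := hd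
    refine ⟨key n1 ?_ ?_, key n2 ?_ ?_, key n3 ?_ ?_, key n4 ?_ ?_, key n5 ?_ ?_, key n6 ?_ ?_⟩ <;>
      push_cast <;> linarith

/-! ### Fillings are tilings by lattice tiles -/

namespace Cell

/-- The unit triangle that contains a cell. -/
def face (c : Cell) : ℤ × ℤ × ℤ := (c.floorX, c.floorY, c.parity)

lemma mem_tri {c d : Cell} : d ∈ c.tri ↔ d.face = c.face := by
  obtain ⟨m, n, k⟩ := c
  obtain ⟨m', n', k'⟩ := d
  fin_cases k <;> fin_cases k' <;>
    simp [tri, next, unitX, unitY, face, floorX, floorY, parity] <;> omega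

lemma face_rev_ne (c : Cell) : c.rev.face ≠ c.face := by
  obtain ⟨m, n, k⟩ := c
  fin_cases k <;> simp [rev, face, floorX, floorY, parity]

lemma face_next (c : Cell) : c.next.face = c.face := by
  rw [← mem_tri, tri]; simp

end Cell

lemma Tile.mem_cells {t : Tile} {d : Cell} :
    d ∈ t.cells ↔ d = t.1 ∨ d.face = t.1.rev.face ∨ d.face = t.wing.face := by
  simp [Tile.cells, Cell.mem_tri]

lemma Tile.face_wing_ne (t : Tile) : t.wing.face ≠ t.1.face := by
  obtain ⟨⟨m, n, k⟩, b⟩ := t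
  cases b <;> fin_cases k <;>
    simp [Tile.wing, Cell.next, Cell.rev, unitX, unitY, Cell.face, Cell.floorX, Cell.floorY,
      Cell.parity]

lemma Tile.wing_not_mem (c : Cell) : Tile.wing (c, true) ∉ Tile.cells (c, false) := by
  rw [Tile.mem_cells]
  obtain ⟨m, n, k⟩ := c
  fin_cases k <;>
    simp [Tile.wing, Cell.next, Cell.rev, unitX, unitY, Cell.face, Cell.floorX, Cell.floorY,
      Cell.parity]

lemma Tile.wing_mem (t : Tile) : t.wing ∈ t.cells := Tile.mem_cells.2 (Or.inr (Or.inr rfl))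

lemma Cell.next_ne (c : Cell) : c.next ≠ c := by
  obtain ⟨m, n, k⟩ := c
  fin_cases k <;> simp [Cell.next]

/-- A cell of a tile is its apex cell, or all the cells of its unit triangle belong to the tile. -/
lemma Tile.next_mem_cells {t : Tile} {d : Cell} (h : d ∈ t.cells) (hne : d ≠ t.1) :
    d.next ∈ t.cells := by
  rw [Tile.mem_cells] at h ⊢
  rw [Cell.face_next]
  exact Or.inr (h.resolve_left hne)

lemma Tile.next_notMem (t : Tile) : t.1.next ∉ t.cells := by
  rw [Tile.mem_cells, Cell.face_next]
  rintro (h | h | h)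
  · exact t.1.next_ne h
  · exact t.1.face_rev_ne h.symm
  · exact t.face_wing_ne h.symm

lemma Tile.fst_mem (t : Tile) : t.1 ∈ t.cells := List.mem_cons_self

lemma Tile.ext_cells {t t' : Tile} (h : ∀ d, d ∈ t.cells ↔ d ∈ t'.cells) : t = t' := by
  have h1 : t.1 = t'.1 := by
    by_contra hne
    exact t.next_notMem ((h _).2 (Tile.next_mem_cells ((h _).1 t.fst_mem) hne))
  obtain ⟨c, b⟩ := t
  obtain ⟨c', b'⟩ := t'
  obtain rfl : c = c' := h1
  cases b <;> cases b'
  · rfl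
  · exact absurd ((h _).2 (Tile.wing_mem _)) (Tile.wing_not_mem c)
  · exact absurd ((h _).1 (Tile.wing_mem _)) (Tile.wing_not_mem c)
  · rfl

lemma cellInt_subset_cellSet (c : Cell) : cellInt c ⊆ cellSet c := polyInt_subset _

lemma isOpen_cellInt (c : Cell) : IsOpen (cellInt c) := isOpen_polyInt _

lemma eq_of_mem_cellInt_cellSet {c d : Cell} {z : ℂ} (hc : z ∈ cellInt c) (hd : z ∈ cellSet d) :
    c = d := by
  obtain ⟨w, hw, hw'⟩ := mem_closure_iff.1 (cellSet_subset_closure d hd) _ (isOpen_cellInt c) hc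
  exact cellInt_inj hw hw'

lemma cellInt_subset_tileSet {t : Tile} {d : Cell} (h : d ∈ t.cells) : cellInt d ⊆ tileSet t :=
  fun _ hz => mem_tileSet.2 ⟨d, h, cellInt_subset_cellSet d hz⟩

lemma mem_cells_of_mem_cellInt {t : Tile} {d : Cell} {z : ℂ} (hz : z ∈ cellInt d)
    (h : z ∈ tileSet t) : d ∈ t.cells := by
  obtain ⟨e, he, hze⟩ := mem_tileSet.1 h
  rwa [eq_of_mem_cellInt_cellSet hz hze]

lemma tileSet_injective : Function.Injective tileSet := by
  intro t t' h
  refine Tile.ext_cells fun d => ?_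
  obtain ⟨z, hz⟩ := cell_center_mem d
  exact ⟨fun hd => mem_cells_of_mem_cellInt hz (h ▸ cellInt_subset_tileSet hd hz),
    fun hd => mem_cells_of_mem_cellInt hz (h ▸ cellInt_subset_tileSet hd hz)⟩

/-- The tiles in `T` cover each cell in `U` exactly once, and no other cells. -/
structure IsTiling (U : Set Cell) (T : Set Tile) : Prop where
  subset : ∀ t ∈ T, ∀ d ∈ t.cells, d ∈ U
  cover : ∀ d ∈ U, ∃ t ∈ T, d ∈ t.cells
  unique : ∀ t ∈ T, ∀ t' ∈ T, ∀ d, d ∈ t.cells → d ∈ t'.cells → t = t'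

/-- The union of a set of cells. -/
def cellRegion (U : Set Cell) : Set ℂ := ⋃ d ∈ U, cellSet d

lemma mem_cellRegion {U : Set Cell} {z : ℂ} : z ∈ cellRegion U ↔ ∃ d ∈ U, z ∈ cellSet d := by
  simp [cellRegion]

lemma mem_of_mem_cellInt {U : Set Cell} {d : Cell} {z : ℂ} (hz : z ∈ cellInt d)
    (h : z ∈ cellRegion U) : d ∈ U := by
  obtain ⟨e, he, hze⟩ := mem_cellRegion.1 h
  rwa [eq_of_mem_cellInt_cellSet hz hze]

lemma exists_isometryEquiv (f : Bool) {a : ℂ} (ha : ‖a‖ = 1) (b : ℂ) :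
    ∃ e : ℂ ≃ᵢ ℂ, ∀ z, e z = b + a * if f then conj z else z := by
  obtain ⟨u, rfl⟩ : ∃ u : Circle, (u : ℂ) = a := ⟨⟨a, mem_sphere_zero_iff_norm.2 ha⟩, rfl⟩
  let r : ℂ ≃ᵢ ℂ := (rotation u).toIsometryEquiv
  cases f
  · exact ⟨r.trans (IsometryEquiv.addLeft b), fun z => by simp [r, rotation_apply]⟩
  · exact ⟨(Complex.conjLIE.toIsometryEquiv.trans r).trans (IsometryEquiv.addLeft b),
      fun z => by simp [r, rotation_apply]⟩

lemma exists_isometry_tileSet (t : Tile) : ∃ e : ℂ ≃ᵢ ℂ, e '' thPentagon = tileSet t := by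
  obtain ⟨e, he⟩ := exists_isometryEquiv t.placement.flip (norm_ζ_pow t.placement.rot)
    t.placement.pos.toC
  refine ⟨e, ?_⟩
  rw [tileSet, ← Placement.image]
  exact Set.image_congr fun z _ => he z

lemma IsTiling.isFilling {U : Set Cell} {T : Set Tile} (h : IsTiling U T) :
    IsFilling (cellRegion U) (tileSet '' T) := by
  refine ⟨?_, ?_, ?_⟩
  · rintro _ ⟨t, -, rfl⟩
    exact exists_isometry_tileSet t
  · rintro _ ⟨t, ht, rfl⟩ _ ⟨t', ht', rfl⟩ hne
    refine Set.disjoint_left.2 fun z hz hz' => hne ?_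
    obtain ⟨d, hd, hzd⟩ := mem_tileSet.1 (interior_subset hz)
    obtain ⟨w, ⟨-, hw⟩, hwd⟩ := mem_closure_iff.1 (cellSet_subset_closure d hzd) _
      (isOpen_interior.inter isOpen_interior) ⟨hz, hz'⟩
    rw [h.unique t ht t' ht' d hd (mem_cells_of_mem_cellInt hwd (interior_subset hw))]
  · ext z
    simp only [Set.mem_sUnion, Set.exists_mem_image, mem_tileSet, mem_cellRegion]
    constructor
    · rintro ⟨t, ht, d, hd, hz⟩
      exact ⟨d, h.subset t ht d hd, hz⟩
    · rintro ⟨d, hd, hz⟩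
      obtain ⟨t, ht, hdt⟩ := h.cover d hd
      exact ⟨t, ht, d, hdt, hz⟩

lemma exists_ball_subset_thPentagon : ∃ x : ℂ, ∃ r > 0, Metric.ball x r ⊆ interior thPentagon := by
  obtain ⟨z, hz⟩ := cell_center_mem (0, 0, 0)
  obtain ⟨e, he⟩ := exists_isometry_tileSet ((0, 0, 0), false)
  have h : z ∈ interior (tileSet ((0, 0, 0), false)) :=
    interior_maximal (cellInt_subset_tileSet (Tile.fst_mem _)) (isOpen_cellInt _) hz
  rw [← he, ← e.coe_toHomeomorph, ← Homeomorph.image_interior] at h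
  obtain ⟨x, hx, -⟩ := h
  obtain ⟨r, hr, hball⟩ := Metric.isOpen_iff.1 isOpen_interior x hx
  exact ⟨x, r, hr, hball⟩

lemma IsFilling.finite {R : Set ℂ} (hR : Bornology.IsBounded R) {F : Set (Set ℂ)}
    (h : IsFilling R F) : F.Finite := by
  obtain ⟨x, r, hr, hball⟩ := exists_ball_subset_thPentagon
  have hex : ∀ S : F, ∃ y : ℂ, Metric.ball y r ⊆ interior S.1 := by
    rintro ⟨S, hS⟩
    obtain ⟨e, rfl⟩ := h.1 S hS
    refine ⟨e x, ?_⟩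
    change _ ⊆ interior (e '' thPentagon)
    rw [← e.image_ball, ← e.coe_toHomeomorph, ← Homeomorph.image_interior]
    exact Set.image_mono hball
  choose y hy using hex
  have hvol : ∀ S : F, MeasureTheory.volume (Metric.ball (y S) r) =
      MeasureTheory.volume (Metric.ball (0 : ℂ) r) := fun S =>
    MeasureTheory.Measure.addHaar_ball_center _ _ _
  have hpos : 0 < MeasureTheory.volume (Metric.ball (0 : ℂ) r) := Metric.measure_ball_pos _ _ hr
  have hfin := MeasureTheory.Measure.finite_const_le_meas_of_disjoint_iUnion
    MeasureTheory.volume (As := fun S : F => Metric.ball (y S) r) hpos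
    (fun S => measurableSet_ball) (fun S S' hne => (h.2.1 S.2 S'.2 fun h => hne (Subtype.ext h)).mono
      (hy S) (hy S')) (by
      refine ((hR.subset ?_).measure_lt_top).ne
      refine Set.iUnion_subset fun S => ((hy S).trans interior_subset).trans ?_
      rw [← h.2.2]
      exact Set.subset_sUnion_of_mem S.2)
  have huniv : {S : F | MeasureTheory.volume (Metric.ball (0 : ℂ) r) ≤
      MeasureTheory.volume (Metric.ball (y S) r)} = Set.univ := by
    ext S; simp [hvol]
  rw [huniv] at hfin
  exact Set.finite_coe_iff.1 (Set.finite_univ_iff.1 hfin)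

lemma isBounded_cellRegion {U : Set Cell} (hU : U.Finite) : Bornology.IsBounded (cellRegion U) := by
  refine (Bornology.isBounded_biUnion hU).2 fun d _ => ?_
  have hsub : cellSet d ⊆ tileSet (d, false) :=
    fun z hz => mem_tileSet.2 ⟨d, Tile.fst_mem _, hz⟩
  refine Bornology.IsBounded.subset ?_ hsub
  obtain ⟨e, he⟩ := exists_isometry_tileSet (d, false)
  rw [← he]
  refine e.isometry.lipschitz.isBounded_image ?_
  rw [thPentagon]
  exact isBounded_convexHull.2 (Set.toFinite _).isBounded

theorem IsFilling.exists_tiling {U : Set Cell} (hU : U.Finite) {F : Set (Set ℂ)}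
    (h : IsFilling (cellRegion U) F) : ∃ T, IsTiling U T ∧ F = tileSet '' T := by
  have hfin := IsFilling.finite (isBounded_cellRegion hU) h
  have hsub : ∀ S ∈ F, S ⊆ cellRegion U := fun S hS => by
    rw [← h.2.2]; exact Set.subset_sUnion_of_mem hS
  have hint : ∀ {t : Tile} {d : Cell}, d ∈ t.cells → cellInt d ⊆ interior (tileSet t) :=
    fun hd => interior_maximal (cellInt_subset_tileSet hd) (isOpen_cellInt _)
  set A : Set (Set ℂ) := {S ∈ F | ∀ t, S ≠ tileSet t} with hA
  set V : Set Cell := {d ∈ U | ¬ ∃ t, tileSet t ∈ F ∧ d ∈ t.cells} with hV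
  have hcopy : ∀ S ∈ F, ∃ (f : Bool) (a b : ℂ), ‖a‖ = 1 ∧ S = movedSet f a b := by
    intro S hS
    obtain ⟨e, rfl⟩ := h.1 S hS
    obtain ⟨f, a, b, ha, he⟩ := exists_isometry_form e
    exact ⟨f, a, b, ha, by rw [← image_thPentagon ha]; exact Set.image_congr fun z _ => he z⟩
  have hclosed : ∀ S ∈ F, IsClosed S := by
    intro S hS
    obtain ⟨f, a, b, -, rfl⟩ := hcopy S hS
    exact (isClosed_polySet (base f)).preimage (by fun_prop)
  have hoff : OffLattice A V := by
    refine ⟨hfin.subset fun S hS => hS.1, fun S hS => hcopy S hS.1,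
      h.2.1.subset fun S hS => hS.1, fun S hS => hS.2, ?_, ?_⟩
    · intro c hc
      have hcl : IsClosed (⋃₀ A) := by
        rw [Set.sUnion_eq_biUnion]
        exact (hfin.subset fun S hS => hS.1).isClosed_biUnion fun S hS => hclosed S hS.1
      refine (cellSet_subset_closure c).trans (hcl.closure_subset_iff.2 fun z hz => ?_)
      have hzR : z ∈ ⋃₀ F := by
        rw [h.2.2]; exact mem_cellRegion.2 ⟨c, hc.1, cellInt_subset_cellSet c hz⟩
      obtain ⟨S, hS, hzS⟩ := hzR
      refine ⟨S, ⟨hS, ?_⟩, hzS⟩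
      rintro t rfl
      exact hc.2 ⟨t, hS, mem_cells_of_mem_cellInt hz hzS⟩
    · intro c hc S hS
      refine Set.disjoint_left.2 fun z hz hzS => hc ?_
      refine ⟨mem_of_mem_cellInt hz (hsub S hS.1 (interior_subset hzS)), ?_⟩
      rintro ⟨t, ht, hct⟩
      exact Set.disjoint_left.1 (h.2.1 hS.1 ht (hS.2 t)) hzS (hint hct hz)
  have hVe := hoff.eq_empty (hU.subset fun d hd => hd.1)
  have hlat : ∀ S ∈ F, ∃ t, S = tileSet t := by
    intro S hS
    by_contra! hcon
    have hSA : S ∈ A := ⟨hS, hcon⟩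
    obtain ⟨x, r, hr, hball⟩ := exists_ball_subset_thPentagon
    obtain ⟨e, rfl⟩ := h.1 S hS
    have hx : e x ∈ interior (e '' thPentagon) := by
      rw [← e.coe_toHomeomorph, ← Homeomorph.image_interior]
      exact Set.mem_image_of_mem _ (hball (Metric.mem_ball_self hr))
    obtain ⟨d, hd, hxd⟩ := mem_cellRegion.1 (hsub _ hS (interior_subset hx))
    obtain ⟨w, hw, hwd⟩ := mem_closure_iff.1 (cellSet_subset_closure d hxd) _ isOpen_interior hx
    exact Set.disjoint_left.1 (hoff.out d (by rw [hVe]; simp) _ hSA) hwd hw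
  refine ⟨{t | tileSet t ∈ F}, ⟨?_, ?_, ?_⟩, ?_⟩
  · intro t ht d hd
    obtain ⟨z, hz⟩ := cell_center_mem d
    exact mem_of_mem_cellInt hz (hsub _ ht (cellInt_subset_tileSet hd hz))
  · intro d hd
    by_contra! hcon
    have : d ∈ V := ⟨hd, fun ⟨t, ht, hdt⟩ => hcon t ht hdt⟩
    rw [hVe] at this
    exact this
  · intro t ht t' ht' d hd hd'
    by_contra hne
    obtain ⟨z, hz⟩ := cell_center_mem d
    exact Set.disjoint_left.1 (h.2.1 ht ht' (tileSet_injective.ne hne)) (hint hd hz) (hint hd' hz)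
  · ext S
    constructor
    · intro hS
      obtain ⟨t, rfl⟩ := hlat S hS
      exact ⟨t, hS, rfl⟩
    · rintro ⟨t, ht, rfl⟩
      exact ht

/-! ### Symmetries -/

/-- Whether some germ belongs to one of two polygons but not to the other. -/
def separates (P Q : List Line) : Bool :=
  ((P ++ Q).map Prod.fst).any fun p => (List.range 12).any fun j => covers P p j != covers Q p j

lemma ne_of_separates {P Q : List Line} (h : separates P Q = true) : polySet P ≠ polySet Q := by
  rintro heq
  obtain ⟨p, -, h⟩ := List.any_eq_true.1 h
  obtain ⟨j, -, h⟩ := List.any_eq_true.1 h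
  obtain ⟨w, hw⟩ := OffLattice.sector_nonempty j
  have key : ∀ {P Q : List Line}, polySet P = polySet Q → covers P p j = true →
      covers Q p j = false → False := by
    intro P Q heq h1 h2
    obtain ⟨t, ht1, ht2⟩ := ((eventually_mem_of_covers h1 hw).and
      (eventually_notMem_of_not_covers h2 hw)).exists
    exact ht2 (heq ▸ polyInt_subset _ ht1)
  cases h1 : covers P p j <;> cases h2 : covers Q p j
  · simp [h1, h2] at h
  · exact key heq.symm h2 h1
  · exact key heq h1 h2
  · simp [h1, h2] at h

def baseCorner (f : Bool) : ℕ := if f then 8 else 0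

lemma covers_baseCorner (f : Bool) : covers (base f) ⟨0, 0, 0, 0⟩ (baseCorner f) = true ∧
    covers (base f) ⟨0, 0, 0, 0⟩ (baseCorner f + 11) = false ∧
    covers (base f) ⟨0, 0, 0, 0⟩ (baseCorner f + 5) = false := by
  cases f <;> decide

lemma base_rigid : ∀ f f' : Bool, (base f).all (fun m =>
    decide (f = f' ∧ m = (⟨0, 0, 0, 0⟩, baseCorner f)) ||
      separates (place f ⟨0, 0, 0, 0⟩ (baseCorner f') m).poly (base f')) = true := by
  decide +kernel

lemma movedSet_eq_polySet_place {f : Bool} {a b : ℂ} {p : Pt} {k : ℕ} {m : Line}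
    (ha : a = ζ ^ k * conj (ζ ^ m.2)) (hb : b = p.toC - a * m.1.toC) :
    movedSet f a b = polySet (place f p k m).poly := by
  have hrot : a = ζ ^ ((k + (12 - m.2 % 12)) % 12) := by
    rw [ζ_pow_mod, pow_add, ← conj_ζ_pow, ha]
  rw [Placement.polySet_poly]
  simp only [place, Pt.toC_sub, Pt.toC_rot]
  rw [← hrot, ← hb]

lemma movedSet_eq_base {f f' : Bool} {a b : ℂ} (ha : ‖a‖ = 1)
    (h : movedSet f a b = polySet (base f')) : f = f' ∧ a = 1 ∧ b = 0 := by
  obtain ⟨c0, c1, c2⟩ := covers_baseCorner f'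
  have h0 : (⟨0, 0, 0, 0⟩ : Pt).toC = 0 := by simp [Pt.toC]
  have hint : movedInt f a b ⊆ polySet (base f') := fun z hz => h ▸ polyInt_subset _ hz
  have hout : ∀ j, covers (base f') ⟨0, 0, 0, 0⟩ j = false → ∀ w ∈ sector j,
      ∃ᶠ t : ℝ in 𝓝[>] 0, (⟨0, 0, 0, 0⟩ : Pt).toC + t * w ∉ movedInt f a b := fun j hj w hw =>
    ((eventually_notMem_of_not_covers hj hw).mono fun t ht hmem => ht (hint hmem)).frequently
  obtain ⟨m, hm, hma, hmb⟩ := corner_core (k := baseCorner f') ha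
    (Eventually.frequently (Eventually.of_forall fun n => by
      rw [h]
      exact (eventually_mem_of_covers c0 ⟨1, 1 / ((n : ℝ) + 1), one_pos, by positivity,
        by simp⟩).mono fun t ht => polyInt_subset _ ht)) (hout _ c1) (hout _ c2)
  have := List.all_eq_true.1 (base_rigid f f') m hm
  rcases Bool.or_eq_true_iff.1 this with h' | h'
  · obtain ⟨rfl, rfl⟩ := of_decide_eq_true h'
    have ha1 : a = 1 := by rw [hma]; exact ζ_pow_mul_conj _
    exact ⟨rfl, ha1, by rw [hmb, h0]; simp⟩
  · exact absurd ((movedSet_eq_polySet_place hma hmb).symm.trans h) (ne_of_separates h')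

lemma movedSet_inj {f f' : Bool} {a b a' b' : ℂ} (ha : ‖a‖ = 1) (ha' : ‖a'‖ = 1)
    (h : movedSet f a b = movedSet f' a' b') : f = f' ∧ a = a' ∧ b = b' := by
  have hu := unit_mul_conj ha'
  have key : movedSet f (conj a' * a) (conj a' * (b - b')) = polySet (base f') := by
    ext w
    have h1 : b' + a' * w ∈ movedSet f a b ↔ b' + a' * w ∈ movedSet f' a' b' := by rw [h]
    simp only [movedSet, Set.mem_ofPred_eq] at h1 ⊢
    have e1 : conj a * (b' + a' * w - b) =
        conj (conj a' * a) * (w - conj a' * (b - b')) := by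
      rw [map_mul, Complex.conj_conj]
      linear_combination conj a * (b - b') * hu
    have e2 : conj a' * (b' + a' * w - b') = w := by linear_combination w * hu
    rwa [e1, e2] at h1
  obtain ⟨h1, h2, h3⟩ := movedSet_eq_base (by rw [norm_mul, RCLike.norm_conj, ha, ha', one_mul]) key
  refine ⟨h1, ?_, ?_⟩
  · linear_combination a' * h2 - a * hu
  · linear_combination a' * h3 - (b - b') * hu

namespace Cell

/-- Rotation by 60°. -/
def turn (c : Cell) : Cell := (-c.2.1, c.1 + c.2.1, c.2.2 + 1)

/-- Reflection in the real axis. -/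
def mirror (c : Cell) : Cell :=
  (c.1 + unitX c.2.2 + (c.2.1 + unitY c.2.2), -(c.2.1 + unitY c.2.2), 3 - c.2.2)

end Cell

namespace Tile

def turn (t : Tile) : Tile := (t.1.turn, t.2)

def mirror (t : Tile) : Tile := (t.1.mirror, !t.2)

/-- The twelve symmetries of the lattice that fix the origin. -/
def sym (g : ℕ) (t : Tile) : Tile := turn^[g % 6] (bif g.blt 6 then t else t.mirror)

end Tile

lemma frame_turn (c : Cell) (z : ℂ) : frame c.turn (ω * z) = frame c z := by
  have h1 := ω_sq
  have h2 : ω * conj ω = 1 := by simpa using ω_pow_mul_conj 1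
  simp only [frame, Cell.turn, ω_pow_fin_add, map_mul]
  push_cast
  simp only [Fin.val_one, pow_one]
  linear_combination (z - (c.1 + c.2.1 * ω)) * conj (ω ^ (c.2.2 : ℕ)) * h2 +
    (c.2.1 : ℂ) * conj (ω ^ (c.2.2 : ℕ)) * conj ω * h1

lemma frame_mirror (c : Cell) (z : ℂ) : frame c.mirror (conj z) = 1 - conj (frame c z) := by
  have h1 : ω ^ ((3 - c.2.2 : Fin 6) : ℕ) = -conj (ω ^ (c.2.2 : ℕ)) := by
    have e : ω ^ ((3 - c.2.2 : Fin 6) : ℕ) * ω ^ (c.2.2 : ℕ) = -1 := by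
      rw [← ω_pow_fin_add, sub_add_cancel, ← ζ_pow_two_mul]; exact ζ_pow_six
    linear_combination conj (ω ^ (c.2.2 : ℕ)) * e -
      ω ^ ((3 - c.2.2 : Fin 6) : ℕ) * ω_pow_mul_conj c.2.2
  have h2 := congrArg conj (unit_eq c.2.2)
  have h3 := congrArg conj (ω_pow_mul_conj c.2.2)
  simp only [frame, Cell.mirror, h1, map_neg, map_mul, map_sub, map_add, Complex.conj_conj,
    map_intCast, map_one, conj_ω] at h2 h3 ⊢
  push_cast
  linear_combination ω ^ (c.2.2 : ℕ) * h2 + h3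

lemma mem_tileSet_turn {t : Tile} {z : ℂ} : ω * z ∈ tileSet t.turn ↔ z ∈ tileSet t := by
  obtain ⟨c, b⟩ := t
  cases b
  · simp only [Tile.turn, mem_tileSet_false, locX, locY, frame_turn]
  · simp only [Tile.turn, mem_tileSet_true, locX, locY, frame_turn]

lemma loc_mirror (c : Cell) (z : ℂ) :
    locX c.mirror (conj z) = 1 - locX c z - locY c z ∧ locY c.mirror (conj z) = locY c z := by
  refine frame_eq_iff ?_
  rw [frame_mirror, frame_eq c z]
  simp only [map_add, map_mul, Complex.conj_ofReal, conj_ω]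
  push_cast
  ring

lemma mem_tileSet_mirror {t : Tile} {z : ℂ} : conj z ∈ tileSet t.mirror ↔ z ∈ tileSet t := by
  obtain ⟨c, b⟩ := t
  cases b
  · simp only [Tile.mirror, Bool.not_false, mem_tileSet_false, mem_tileSet_true, loc_mirror]
    constructor <;> rintro ⟨h1, h2, h3, h4, h5⟩ <;> refine ⟨?_, ?_, ?_, ?_, ?_⟩ <;> linarith
  · simp only [Tile.mirror, Bool.not_true, mem_tileSet_false, mem_tileSet_true, loc_mirror]
    constructor <;> rintro ⟨h1, h2, h3, h4, h5⟩ <;> refine ⟨?_, ?_, ?_, ?_, ?_⟩ <;> linarith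

/-- The symmetries of the lattice as maps of the plane. -/
def symMap (g : ℕ) (z : ℂ) : ℂ := ω ^ (g % 6) * if g < 6 then z else conj z

lemma mem_tileSet_sym {g : ℕ} {t : Tile} {z : ℂ} :
    symMap g z ∈ tileSet (t.sym g) ↔ z ∈ tileSet t := by
  have hiter : ∀ (n : ℕ) (t : Tile) (z : ℂ),
      ω ^ n * z ∈ tileSet (Tile.turn^[n] t) ↔ z ∈ tileSet t := by
    intro n
    induction n with
    | zero => simp
    | succ n ih =>
      intro t z
      rw [Function.iterate_succ', Function.comp_apply, pow_succ', mul_assoc, mem_tileSet_turn, ih]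
  rw [symMap, Tile.sym, hiter]
  by_cases hg : g < 6
  · rw [if_pos hg, show g.blt 6 = true by simpa using hg]; rfl
  · rw [if_neg hg, show g.blt 6 = false by rw [Bool.eq_false_iff, ne_eq, Nat.blt_eq]; exact hg]; exact mem_tileSet_mirror

lemma exists_isometry_symMap (g : ℕ) : ∃ e : ℂ ≃ᵢ ℂ, ∀ z, e z = symMap g z := by
  have hn : ‖ω ^ (g % 6)‖ = 1 := by rw [← ζ_pow_two_mul, norm_ζ_pow]
  obtain ⟨e, he⟩ := exists_isometryEquiv (!decide (g < 6)) hn 0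
  refine ⟨e, fun z => ?_⟩
  rw [he, symMap, zero_add]
  by_cases hg : g < 6 <;> simp [hg]

lemma image_tileSet_sym {g : ℕ} {e : ℂ ≃ᵢ ℂ} (he : ∀ z, e z = symMap g z) (t : Tile) :
    e '' tileSet t = tileSet (t.sym g) := by
  ext z
  constructor
  · rintro ⟨w, hw, rfl⟩
    rw [he]; exact mem_tileSet_sym.2 hw
  · intro hz
    refine ⟨e.symm z, ?_, e.apply_symm_apply z⟩
    rwa [← mem_tileSet_sym (g := g), ← he, e.apply_symm_apply]

lemma sym_injective (g : ℕ) : Function.Injective (Tile.sym g) := by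
  intro t t' h
  obtain ⟨e, he⟩ := exists_isometry_symMap g
  refine tileSet_injective (e.injective.image_injective ?_)
  rw [image_tileSet_sym he, image_tileSet_sym he, h]

lemma isometry_eq_symMap {e : ℂ ≃ᵢ ℂ} (h0 : e 0 = 0) {t t' : Tile}
    (h : e '' tileSet t = tileSet t') : ∃ g < 12, ∀ z, e z = symMap g z := by
  obtain ⟨f, a, b, ha, he⟩ := exists_isometry_form e
  obtain rfl : b = 0 := by
    have := he 0
    cases f <;> simpa [h0] using this.symm
  have hn := norm_ζ_pow
  have hconj : ‖conj (ζ ^ t.placement.rot)‖ = 1 := by rw [RCLike.norm_conj, hn]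
  have himg : e '' tileSet t = movedSet (xor f t.placement.flip)
      (a * if f then conj (ζ ^ t.placement.rot) else ζ ^ t.placement.rot)
      (a * if f then conj t.placement.pos.toC else t.placement.pos.toC) := by
    have hnorm : ‖a * if f then conj (ζ ^ t.placement.rot) else ζ ^ t.placement.rot‖ = 1 := by
      rw [norm_mul, ha, one_mul]; cases f
      · exact hn _
      · exact hconj
    rw [← image_thPentagon hnorm, tileSet, ← Placement.image, Set.image_image]
    refine Set.image_congr fun z _ => ?_
    rw [he, Placement.map]
    cases f <;> cases t.placement.flip <;> simp <;> ring
  rw [himg, tileSet, Placement.polySet_poly] at h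
  obtain ⟨-, h2, -⟩ := movedSet_inj (by
    rw [norm_mul, ha, one_mul]; cases f
    · exact hn _
    · exact hconj) (hn _) h
  have heven : ∀ s : Tile, ∃ j, ζ ^ s.placement.rot = ω ^ j := fun s =>
    ⟨_, ζ_pow_two_mul _⟩
  obtain ⟨j, hj⟩ := heven t
  obtain ⟨j', hj'⟩ := heven t'
  rw [hj, hj'] at h2
  have hu := ω_pow_mul_conj j
  have hc : conj (ω ^ j) = ω ^ (5 * j) := by
    have : ω ^ j * ω ^ (5 * j) = 1 := by
      rw [← pow_add, show j + 5 * j = 6 * j by ring, pow_mul, ω_pow_six, one_pow]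
    linear_combination ω ^ (5 * j) * hu - conj (ω ^ j) * this
  cases f
  · have haj : a = ω ^ ((j' + 5 * j) % 6) := by
      rw [ω_pow_mod, pow_add, ← hc]
      simp only [Bool.false_eq_true, if_false] at h2
      linear_combination conj (ω ^ j) * h2 - a * hu
    refine ⟨(j' + 5 * j) % 6, by omega, fun z => ?_⟩
    rw [he, symMap, if_pos (show (j' + 5 * j) % 6 < 6 by omega), Nat.mod_mod, ← haj]; simp
  · have haj : a = ω ^ ((j' + j) % 6) := by
      rw [ω_pow_mod, pow_add]
      simp only [if_true] at h2
      linear_combination ω ^ j * h2 - a * hu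
    refine ⟨6 + (j' + j) % 6, by omega, fun z => ?_⟩
    rw [he, symMap, if_neg (show ¬ 6 + (j' + j) % 6 < 6 by omega), Nat.add_mod_left, Nat.mod_mod, ← haj]; simp

lemma isometry_fixes_center {R : Set ℂ} (hR : Bornology.IsBounded R) (hne : R.Nonempty)
    (hneg : ∀ z ∈ R, -z ∈ R) {e : ℂ ≃ᵢ ℂ} (he : e '' R = R) : e 0 = 0 := by
  obtain ⟨f, a, b, ha, hform⟩ := exists_isometry_form e
  have hb : e 0 = b := by rw [hform]; cases f <;> simp
  have hrefl : ∀ z, e (-z) = 2 * b - e z := by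
    intro z; rw [hform, hform]; cases f <;> simp <;> ring
  have hstep : ∀ z ∈ R, z + 2 * b ∈ R := by
    intro z hz
    have h1 := hneg z hz
    rw [← he] at h1
    obtain ⟨w, hw, hwz⟩ := h1
    have h2 : e (-w) ∈ R := by rw [← he]; exact Set.mem_image_of_mem _ (hneg w hw)
    rw [hrefl, hwz] at h2
    convert h2 using 1
    ring
  obtain ⟨z, hz⟩ := hne
  have hall : ∀ n : ℕ, z + n * (2 * b) ∈ R := by
    intro n
    induction n with
    | zero => simpa using hz
    | succ n ih =>
      have := hstep _ ih
      push_cast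
      convert this using 1
      ring
  obtain ⟨C, hC⟩ := hR.exists_norm_le
  rw [hb]
  by_contra hb0
  have hpos : 0 < ‖2 * b‖ := by simpa using hb0
  obtain ⟨n, hn⟩ := exists_nat_gt ((C + ‖z‖) / ‖2 * b‖)
  rw [div_lt_iff₀ hpos] at hn
  have h1 := hC _ (hall n)
  have h2 : ‖(n : ℂ) * (2 * b)‖ ≤ ‖z + n * (2 * b)‖ + ‖z‖ := by
    have := norm_sub_le (z + n * (2 * b)) z
    rwa [add_sub_cancel_left] at this
  rw [norm_mul, Complex.norm_natCast] at h2
  linarith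

/-! ### Hubs -/

namespace Cell

def faceCode (c : Cell) : ℕ := (2 * (c.floorX + 12 + 24 * (c.floorY + 12)) + c.parity).toNat

/-- A cell of the face with the given code. -/
def ofCode (j : ℕ) : Cell :=
  ((j / 2 % 24 : ℕ) - 12 + (j % 2 : ℕ), (j / 2 / 24 : ℕ) - 12, if j % 2 = 0 then 0 else 1)

/-- The unit triangle of the cell is near the origin. -/
def Small (c : Cell) : Prop :=
  -9 ≤ c.floorX ∧ c.floorX < 9 ∧ -9 ≤ c.floorY ∧ c.floorY < 9

lemma parity_mem (c : Cell) : c.parity = 0 ∨ c.parity = 1 := by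
  rw [parity]; omega

lemma Small.face_eq {c d : Cell} (hc : c.Small) (hd : d.Small) (h : c.faceCode = d.faceCode) :
    c.face = d.face := by
  have h1 := c.parity_mem
  have h2 := d.parity_mem
  simp only [Small, faceCode, face, Prod.mk.injEq] at *
  omega

lemma Small.code_lt {c : Cell} (hc : c.Small) : c.faceCode < 1152 := by
  have h1 := c.parity_mem
  simp only [Small, faceCode] at *
  omega

lemma face_ofCode (j : ℕ) : (ofCode j).face =
    (((j / 2 % 24 : ℕ) : ℤ) - 12, ((j / 2 / 24 : ℕ) : ℤ) - 12, ((j % 2 : ℕ) : ℤ)) := by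
  rcases Nat.mod_two_eq_zero_or_one j with h | h <;>
    simp [ofCode, h, face, floorX, floorY, parity]

lemma Small.face_ofCode {c : Cell} (hc : c.Small) : (ofCode c.faceCode).face = c.face := by
  have h1 := c.parity_mem
  rw [Cell.face_ofCode, face, Prod.mk.injEq, Prod.mk.injEq]
  simp only [Small, faceCode] at *
  omega

end Cell

/-- The part of a hub that consists of the tiles with apex cells in the unit triangle of `c`, with
orientations given by `e`. -/
def hub (c : Cell) (e : ℕ) : List Tile :=
  [(c, e.testBit 0), (c.next, e.testBit 1), (c.next.next, e.testBit 2)]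

def hubTiles (e : ℕ) : List Tile := hub (Cell.ofCode (e / 8)) e

/-- One cell of each unit triangle that meets the tile. -/
def Tile.faceCells (t : Tile) : List Cell := [t.1, t.1.rev, t.wing]

lemma Tile.faceCells_subset {t : Tile} {f : Cell} (h : f ∈ t.faceCells) : f ∈ t.cells := by
  simp only [Tile.faceCells, List.mem_cons, List.not_mem_nil, or_false] at h
  rw [Tile.mem_cells]
  rcases h with rfl | rfl | rfl
  · exact Or.inl rfl
  · exact Or.inr (Or.inl rfl)
  · exact Or.inr (Or.inr rfl)

lemma Tile.exists_faceCell {t : Tile} {d : Cell} (h : d ∈ t.cells) :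
    ∃ f ∈ t.faceCells, d.face = f.face := by
  simp only [Tile.faceCells, List.exists_mem_cons_iff, List.not_mem_nil, false_and, exists_false,
    or_false]
  rcases Tile.mem_cells.1 h with rfl | h | h
  · exact Or.inl rfl
  · exact Or.inr (Or.inl h)
  · exact Or.inr (Or.inr h)

lemma exists_hub_tile {c d : Cell} {e : ℕ} (h : d.face = c.face) : ∃ t ∈ hub c e, t.1 = d := by
  have := Cell.mem_tri.2 h
  simp only [Cell.tri, List.mem_cons, List.not_mem_nil, or_false] at this
  rcases this with rfl | rfl | rfl <;> simp [hub]

lemma face_of_mem_hub {c : Cell} {e : ℕ} {t : Tile} (h : t ∈ hub c e) : t.1.face = c.face := by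
  simp only [hub, List.mem_cons, List.not_mem_nil, or_false] at h
  rcases h with rfl | rfl | rfl <;> simp [Cell.face_next]

/-- A hub covers the unit triangles of its tiles. -/
lemma exists_hub_cover {c d f : Cell} {e : ℕ} {t : Tile} (ht : t ∈ hub c e) (hf : f ∈ t.faceCells)
    (hd : d.face = f.face) : ∃ t' ∈ hub c e, d ∈ t'.cells := by
  simp only [Tile.faceCells, List.mem_cons, List.not_mem_nil, or_false] at hf
  rcases hf with rfl | rfl | rfl
  · obtain ⟨t', ht', rfl⟩ := exists_hub_tile (e := e) (hd.trans (face_of_mem_hub ht))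
    exact ⟨t', ht', t'.fst_mem⟩
  · exact ⟨t, ht, Tile.mem_cells.2 (Or.inr (Or.inl hd))⟩
  · exact ⟨t, ht, Tile.mem_cells.2 (Or.inr (Or.inr hd))⟩

namespace IsTiling

variable {a b c : ℤ} {T : Set Tile}

lemma inFlower_of_face {d e : Cell} (h : d.face = e.face) (hd : d.InFlower a b c) :
    e.InFlower a b c := by
  simp only [Cell.face, Prod.mk.injEq] at h
  simp only [Cell.InFlower, Cell.floorS, h.1, h.2.1, h.2.2] at hd ⊢
  exact hd

lemma exists_next (h : IsTiling {d | d.InFlower a b c} T) {t : Tile} (ht : t ∈ T) :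
    ∃ t' ∈ T, t'.1 = t.1.next := by
  obtain ⟨t', ht', hmem⟩ := h.cover t.1.next
    (inFlower_of_face t.1.face_next.symm (h.subset t ht _ t.fst_mem))
  refine ⟨t', ht', ?_⟩
  by_contra hne
  have h1 := Tile.next_mem_cells hmem (Ne.symm hne)
  have h2 : t.1 ∈ t'.cells := by
    rw [Tile.mem_cells] at hmem ⊢
    rw [t.1.face_next] at hmem
    exact Or.inr (hmem.resolve_left (Ne.symm hne))
  rw [h.unique t' ht' t ht _ h2 t.fst_mem] at hmem
  exact t.next_notMem hmem

/-- The tiles whose apex cells lie in one unit triangle form a hub. -/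
lemma exists_hub (h : IsTiling {d | d.InFlower a b c} T) {t : Tile} (ht : t ∈ T) :
    ∃ k : Fin 6, k < 2 ∧ ∃ m n : ℤ, ∃ e < 8, (∀ s ∈ hub (m, n, k) e, s ∈ T) ∧ t ∈ hub (m, n, k) e := by
  obtain ⟨⟨c1, b1⟩, h1, e1⟩ := h.exists_next ht
  obtain ⟨⟨c2, b2⟩, h2, e2⟩ := h.exists_next h1
  obtain ⟨d, bd⟩ := t
  simp only at e1 e2
  subst e1 e2
  have hd : d.next.next.next = d := by
    obtain ⟨m, n, k⟩ := d
    fin_cases k <;> simp [Cell.next, unitX, unitY]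
  have bits : ∀ x y z : Bool, ∃ e < 8, e.testBit 0 = x ∧ e.testBit 1 = y ∧ e.testBit 2 = z := by
    decide
  have canon : (d.2.2 < 2 ∨ d.next.2.2 < 2 ∨ d.next.next.2.2 < 2) := by
    have : ∀ k : Fin 6, k < 2 ∨ k + 2 < 2 ∨ k + 2 + 2 < 2 := by decide
    exact this d.2.2
  rcases canon with hk | hk | hk
  · obtain ⟨e, he, x, y, z⟩ := bits bd b1 b2
    refine ⟨_, hk, d.1, d.2.1, e, he, ?_, ?_⟩ <;> simp [hub, x, y, z, ht, h1, h2]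
  · obtain ⟨e, he, x, y, z⟩ := bits b1 b2 bd
    refine ⟨_, hk, d.next.1, d.next.2.1, e, he, ?_, ?_⟩ <;> simp [hub, x, y, z, ht, h1, h2, hd]
  · obtain ⟨e, he, x, y, z⟩ := bits b2 bd b1
    refine ⟨_, hk, d.next.next.1, d.next.next.2.1, e, he, ?_, ?_⟩ <;>
      simp [hub, x, y, z, ht, h1, h2, hd]

end IsTiling

/-! ### Exact covers by hubs -/

/-- The natural number with the given bits. -/
def bitmask (l : List ℕ) : ℕ := l.foldr (fun i m => 2 ^ i ||| m) 0

lemma testBit_bitmask {l : List ℕ} {j : ℕ} : (bitmask l).testBit j = true ↔ j ∈ l := by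
  induction l with
  | nil => simp [bitmask]
  | cons i l ih =>
    rw [bitmask, List.foldr_cons, Nat.testBit_or, Bool.or_eq_true, Nat.testBit_two_pow,
      List.mem_cons]
    exact or_congr (by simpa using eq_comm) ih

/-- The hubs that contain a given upward unit triangle, as the set of their unit triangles and the
code of the hub, relative to a position in which all the codes are nonnegative. -/
def patternsEven : List (ℕ × ℕ) :=
  [(0x100000000001e00000000000c000000000000, 784), (0x100000000001e000000000018000000000000, 785),
    (0x1f00000000000c000000000000, 788), (0x1f000000000018000000000000, 789),
    (0xc00000000001e000000000020000000000000, 792), (0xc00000000003e000000000000000000000000, 793),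
    (0x600000000001e000000000020000000000000, 794), (0x600000000003e000000000000000000000000, 795),
    (0xc00000000001c000000000028000000000000, 796), (0xc00000000003c000000000008000000000000, 797),
    (0x600000000001c000000000028000000000000, 798), (0x600000000003c000000000008000000000000, 799),
    (0x100000000001e000000000018000000000000000000000000, 1169),
    (0x500000000000e000000000018000000000000000000000000, 1171),
    (0x1f000000000018000000000000000000000000, 1173),
    (0x400000000000f000000000018000000000000000000000000, 1175),
    (0x14000000000038000000000030, 418), (0x14000000000038000000000060, 419),
    (0x1000000000003c000000000030, 422), (0x1000000000003c000000000060, 423),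
    (0x30000000000078000000000080, 424), (0x300000000000f8000000000000, 425),
    (0x18000000000078000000000080, 426), (0x180000000000f8000000000000, 427),
    (0x300000000000700000000000a0, 428), (0x300000000000f0000000000020, 429),
    (0x180000000000700000000000a0, 430), (0x180000000000f0000000000020, 431),
    (0x4000000000078000000000030000000000000, 800), (0x4000000000078000000000060000000000000, 801),
    (0x14000000000038000000000030000000000000, 802),
    (0x14000000000038000000000060000000000000, 803), (0x7c000000000030000000000000, 804),
    (0x7c000000000060000000000000, 805), (0x1000000000003c000000000030000000000000, 806),
    (0x1000000000003c000000000060000000000000, 807),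
    (0x30000000000078000000000080000000000000, 808),
    (0x300000000000f8000000000000000000000000, 809),
    (0x18000000000078000000000080000000000000, 810),
    (0x180000000000f8000000000000000000000000, 811),
    (0x300000000000700000000000a0000000000000, 812),
    (0x300000000000f0000000000020000000000000, 813),
    (0x180000000000700000000000a0000000000000, 814),
    (0x180000000000f0000000000020000000000000, 815),
    (0x4000000000078000000000030000000000000000000000000, 1184),
    (0x14000000000038000000000030000000000000000000000000, 1186),
    (0x7c000000000030000000000000000000000000, 1188),
    (0x1000000000003c000000000030000000000000000000000000, 1190),
    (0x100000000001e00000000000c0, 432), (0x100000000001e0000000000180, 433),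
    (0x500000000000e00000000000c0, 434), (0x500000000000e0000000000180, 435),
    (0x1f00000000000c0000000000000, 820), (0x1f0000000000180000000000000, 821),
    (0x400000000000f00000000000c0000000000000, 822),
    (0x400000000000f0000000000180000000000000, 823)]

/-- The hubs that contain a given downward unit triangle. -/
def patternsOdd : List (ℕ × ℕ) :=
  [(0xc00000000003e000000000000000000000000, 793), (0x600000000003e000000000000000000000000, 795),
    (0xc00000000003c000000000008000000000000, 797), (0x600000000003c000000000008000000000000, 799),
    (0xc00000000001e000000000020000000000000000000000000, 1176),
    (0x600000000001e000000000020000000000000000000000000, 1178),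
    (0xc00000000001c000000000028000000000000000000000000, 1180),
    (0x600000000001c000000000028000000000000000000000000, 1182),
    (0x30000000000078000000000080, 424), (0x300000000000f8000000000000, 425),
    (0x300000000000700000000000a0, 428), (0x300000000000f0000000000020, 429),
    (0x4000000000078000000000030000000000000, 800), (0x4000000000078000000000060000000000000, 801),
    (0x14000000000038000000000030000000000000, 802),
    (0x14000000000038000000000060000000000000, 803), (0x7c000000000030000000000000, 804),
    (0x7c000000000060000000000000, 805), (0x1000000000003c000000000030000000000000, 806),
    (0x1000000000003c000000000060000000000000, 807),
    (0x30000000000078000000000080000000000000, 808),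
    (0x300000000000f8000000000000000000000000, 809),
    (0x18000000000078000000000080000000000000, 810),
    (0x180000000000f8000000000000000000000000, 811),
    (0x300000000000700000000000a0000000000000, 812),
    (0x300000000000f0000000000020000000000000, 813),
    (0x180000000000700000000000a0000000000000, 814),
    (0x180000000000f0000000000020000000000000, 815),
    (0x4000000000078000000000030000000000000000000000000, 1184),
    (0x4000000000078000000000060000000000000000000000000, 1185),
    (0x14000000000038000000000030000000000000000000000000, 1186),
    (0x14000000000038000000000060000000000000000000000000, 1187),
    (0x7c000000000030000000000000000000000000, 1188),
    (0x7c000000000060000000000000000000000000, 1189),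
    (0x1000000000003c000000000030000000000000000000000000, 1190),
    (0x1000000000003c000000000060000000000000000000000000, 1191),
    (0x300000000000700000000000a0000000000000000000000000, 1196),
    (0x300000000000f0000000000020000000000000000000000000, 1197),
    (0x180000000000700000000000a0000000000000000000000000, 1198),
    (0x180000000000f0000000000020000000000000000000000000, 1199),
    (0x600000000001e0000000000200, 442), (0x600000000003e0000000000000, 443),
    (0x600000000001c0000000000280, 446), (0x600000000003c0000000000080, 447),
    (0x100000000001e00000000000c0000000000000, 816),
    (0x100000000001e0000000000180000000000000, 817),
    (0x500000000000e00000000000c0000000000000, 818),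
    (0x500000000000e0000000000180000000000000, 819), (0x1f00000000000c0000000000000, 820),
    (0x1f0000000000180000000000000, 821), (0x400000000000f00000000000c0000000000000, 822),
    (0x400000000000f0000000000180000000000000, 823),
    (0xc00000000001e0000000000200000000000000, 824),
    (0xc00000000003e0000000000000000000000000, 825),
    (0x600000000001e0000000000200000000000000, 826),
    (0x600000000003e0000000000000000000000000, 827)]

def hubFaces (c : Cell) (e : ℕ) : List Cell := (hub c e).flatMap Tile.faceCells

lemma mem_hubFaces {c f : Cell} {e : ℕ} :
    f ∈ hubFaces c e ↔ ∃ t ∈ hub c e, f ∈ t.faceCells := by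
  simp [hubFaces]

/-- The face code of `f` relative to a position of the hub where `f₀` has the coordinates `2`, `2`. -/
def relCode (f₀ f : Cell) : ℕ :=
  (2 * (f.floorX - f₀.floorX + 2 + 24 * (f.floorY - f₀.floorY + 2)) + f.parity).toNat

def patterns (o : ℕ) : List (ℕ × ℕ) := bif o.beq 0 then patternsEven else patternsOdd

lemma patterns_complete : ∀ k : Fin 6, k < 2 → ∀ e < 8, ∀ f₀ ∈ hubFaces (0, 0, k) e,
    (∀ f ∈ hubFaces (0, 0, k) e, -2 ≤ f.floorX - f₀.floorX ∧ -2 ≤ f.floorY - f₀.floorY) ∧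
    (bitmask ((hubFaces (0, 0, k) e).map (relCode f₀)), 8 * relCode f₀ (0, 0, k) + e) ∈
      patterns f₀.parity.toNat := by
  decide +kernel

lemma shift_next (x y : ℤ) (c : Cell) : (c.shift x y).next = c.next.shift x y := by
  simp only [Cell.next, Cell.shift, Prod.mk.injEq, and_true]; constructor <;> ring

lemma shift_rev (x y : ℤ) (c : Cell) : (c.shift x y).rev = c.rev.shift x y := by
  simp only [Cell.rev, Cell.shift, Prod.mk.injEq, and_true]; constructor <;> ring

lemma hubFaces_shift (x y : ℤ) (c : Cell) (e : ℕ) :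
    hubFaces (c.shift x y) e = (hubFaces c e).map (Cell.shift x y) := by
  simp only [hubFaces, hub, Tile.faceCells, Tile.wing, shift_next, shift_rev, List.flatMap_cons,
    List.flatMap_nil, List.map_append, List.map_cons, List.map_nil]
  cases e.testBit 0 <;> cases e.testBit 1 <;> cases e.testBit 2 <;> simp

lemma floor_shift (x y : ℤ) (c : Cell) : (c.shift x y).floorX = c.floorX + x ∧
    (c.shift x y).floorY = c.floorY + y ∧ (c.shift x y).parity = c.parity := by
  simp only [Cell.floorX, Cell.floorY, Cell.parity, Cell.shift]
  refine ⟨by ring, by ring, trivial⟩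

lemma exists_pattern {m n : ℤ} {k : Fin 6} (hk : k < 2) {e : ℕ} (he : e < 8) {f₀ : Cell}
    (hf : f₀ ∈ hubFaces (m, n, k) e) (hsmall : f₀.Small) {s : ℕ}
    (hs : (s : ℤ) = f₀.floorX + 10 + 24 * (f₀.floorY + 10)) :
    ∃ p ∈ patterns f₀.parity.toNat, p.2 + 16 * s = 8 * Cell.faceCode (m, n, k) + e ∧
      (∀ f ∈ hubFaces (m, n, k) e, 2 * s ≤ f.faceCode) ∧
      ∀ j, p.1.testBit j = true ↔ ∃ f ∈ hubFaces (m, n, k) e, f.faceCode = j + 2 * s := by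
  have hsh : Cell.shift m n (0, 0, k) = (m, n, k) := by simp [Cell.shift]
  rw [← hsh, hubFaces_shift] at hf ⊢
  obtain ⟨f₁, hf₁, rfl⟩ := List.mem_map.1 hf
  obtain ⟨hrel, hmem⟩ := patterns_complete k hk e he f₁ hf₁
  obtain ⟨sx, sy, sp⟩ := floor_shift m n f₁
  have hcode : ∀ f ∈ hubFaces (0, 0, k) e, (f.shift m n).faceCode = relCode f₁ f + 2 * s := by
    intro f hf
    obtain ⟨fx, fy, fp⟩ := floor_shift m n f
    have h1 := hrel f hf
    have h2 := f.parity_mem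
    simp only [Cell.Small, Cell.faceCode, relCode] at *
    omega
  rw [sp]
  refine ⟨_, hmem, ?_, ?_, fun j => ?_⟩
  · have := hcode (0, 0, k) (mem_hubFaces.2 ⟨_, List.mem_cons_self, List.mem_cons_self⟩)
    simp only
    omega
  · intro f hf
    obtain ⟨f', hf', rfl⟩ := List.mem_map.1 hf
    rw [hcode f' hf']
    omega
  · simp only [testBit_bitmask, List.mem_map, exists_exists_and_eq_and]
    constructor
    · rintro ⟨f, hf, rfl⟩
      exact ⟨f, hf, hcode f hf⟩
    · rintro ⟨f, hf, h⟩
      exact ⟨f, hf, by have := hcode f hf; omega⟩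

lemma ofCode_faceCode {c : Cell} (hk : c.2.2 < 2) (hc : c.Small) : Cell.ofCode c.faceCode = c := by
  obtain ⟨m, n, k⟩ := c
  have hk' : k = 0 ∨ k = 1 := by
    simp only at hk; revert hk; clear hc; revert k; decide
  have e1 : ∃ j : ℕ, j = Cell.faceCode (m, n, k) := ⟨_, rfl⟩
  obtain ⟨j, hj⟩ := e1
  rw [← hj]
  rcases hk' with rfl | rfl <;>
    simp [Cell.Small, Cell.faceCode, Cell.floorX, Cell.floorY, Cell.parity] at hj hc
  · have h2 : j % 2 = 0 := by omega
    simp only [Cell.ofCode, h2, if_true, Prod.mk.injEq, and_true]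
    omega
  · have h2 : j % 2 = 1 := by omega
    simp only [Cell.ofCode, h2, one_ne_zero, if_false, Prod.mk.injEq, and_true]
    omega

lemma hubTiles_code {c : Cell} (hk : c.2.2 < 2) (hc : c.Small) {e : ℕ} (he : e < 8) :
    hubTiles (8 * c.faceCode + e) = hub c e := by
  have h1 : (8 * c.faceCode + e) / 8 = c.faceCode := by omega
  have h2 : ∀ i < 3, (8 * c.faceCode + e).testBit i = e.testBit i := by
    intro i hi
    have := Nat.testBit_two_pow_mul_add c.faceCode (i := 3) he i
    rw [if_pos hi] at this
    exact this
  rw [hubTiles, h1, ofCode_faceCode hk hc, hub, hub, h2 0 (by norm_num), h2 1 (by norm_num),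
    h2 2 (by norm_num)]

/-! ### The search -/

/-- The positions of the search are pairs of the set of the covered unit triangles and the list of
the hubs. -/
def expand (s m : ℕ) (ch : List ℕ) : List (ℕ × ℕ) → List (ℕ × List ℕ) → List (ℕ × List ℕ)
  | [], st => st
  | p :: ps, st => bif ((m >>> (2 * s)) &&& p.1).beq 0
      then expand s m ch ps ((m ||| p.1 <<< (2 * s), (p.2 + 16 * s) :: ch) :: st)
      else expand s m ch ps st

def Tile.code (t : Tile) : ℕ :=
  (12 * (t.1.1 + 12 + 24 * (t.1.2.1 + 12)) + (2 * (t.1.2.2 : ℕ) + t.2.toNat : ℕ)).toNat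

/-- The set of the images of the tiles of a list of hubs under a symmetry. -/
def tileMask (r : List ℕ) (g : ℕ) : ℕ := bitmask ((r.flatMap hubTiles).map fun t => (t.sym g).code)

def matchesRep (reps : List (List ℕ)) (ch : List ℕ) (h : ℕ) : Bool :=
  match reps[h / 12]? with
  | some r => (bitmask ((ch.flatMap hubTiles).map Tile.code)).beq (tileMask r (h % 12))
  | none => false

def fullMask : ℕ := 2 ^ 1152 - 1

/-- The search with the given stack of positions: a number `h < 1052` says that the unit triangle
with face code `h + 100` is to be covered, a larger number says to which hub lists the complete
position is symmetric. -/
def search (reps : List (List ℕ)) : List ℕ → List (ℕ × List ℕ) → Bool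
  | [], st => st.isEmpty
  | _ :: _, [] => true
  | h :: hs, (m, ch) :: st =>
    bif h.blt 1052 then
      !m.testBit (h + 100) && search reps hs (expand (h / 2) m ch (patterns (h % 2)) st)
    else m.beq fullMask && matchesRep reps ch (h - 1052) && search reps hs st

lemma mem_expand_of_mem {s m : ℕ} {ch : List ℕ} {ps : List (ℕ × ℕ)} {st : List (ℕ × List ℕ)}
    {x : ℕ × List ℕ} (hx : x ∈ st) : x ∈ expand s m ch ps st := by
  induction ps generalizing st with
  | nil => exact hx
  | cons p ps ih =>
    rw [expand]
    cases ((m >>> (2 * s)) &&& p.1).beq 0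
    · exact ih hx
    · exact ih (List.mem_cons_of_mem _ hx)

lemma mem_expand {s m : ℕ} {ch : List ℕ} {ps : List (ℕ × ℕ)} {st : List (ℕ × List ℕ)} {p : ℕ × ℕ}
    (hp : p ∈ ps) (h : (m >>> (2 * s)) &&& p.1 = 0) :
    (m ||| p.1 <<< (2 * s), (p.2 + 16 * s) :: ch) ∈ expand s m ch ps st := by
  induction ps generalizing st with
  | nil => cases hp
  | cons q ps ih =>
    rw [expand]
    rcases List.mem_cons.1 hp with rfl | hp
    · rw [h]
      exact mem_expand_of_mem List.mem_cons_self
    · cases ((m >>> (2 * s)) &&& q.1).beq 0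
      · exact ih hp
      · exact ih hp

instance (a b c : ℤ) (d : Cell) : Decidable (d.InFlower a b c) := by
  unfold Cell.InFlower Notch; infer_instance

/-- `blocked` is the set of the unit triangles outside of the region. -/
def IsBlocked (a b c : ℤ) (blocked : ℕ) : Prop :=
  ∀ j < 1152, blocked.testBit j = !decide ((Cell.ofCode j).InFlower a b c)

/-- The hubs of the position consist of tiles in `T`. -/
structure Reaches (blocked : ℕ) (T : Set Tile) (x : ℕ × List ℕ) : Prop where
  tiles : ∀ e ∈ x.2, ∀ t ∈ hubTiles e, t ∈ T
  bits : ∀ j, x.1.testBit j = true ↔ blocked.testBit j = true ∨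
    ∃ e ∈ x.2, ∃ t ∈ hubTiles e, ∃ f ∈ t.faceCells, f.faceCode = j

section

variable {a b c : ℤ} {T : Set Tile} {blocked : ℕ}

lemma small_of_inFlower (habc : a + b + c ≤ 9) {d : Cell} (hd : d.InFlower a b c) : d.Small := by
  have := InFlower.bound hd
  simp only [Cell.Small]
  omega

lemma not_blocked (habc : a + b + c ≤ 9) (hb : IsBlocked a b c blocked) {d : Cell}
    (hd : d.InFlower a b c) : blocked.testBit d.faceCode = false := by
  have hs := small_of_inFlower habc hd
  rw [hb _ hs.code_lt, decide_eq_true (IsTiling.inFlower_of_face hs.face_ofCode.symm hd)]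
  rfl

lemma Reaches.eq_of_full (habc : a + b + c ≤ 9) (hb : IsBlocked a b c blocked)
    (hT : IsTiling {d | d.InFlower a b c} T) {ch : List ℕ}
    (h : Reaches blocked T (fullMask, ch)) (t : Tile) :
    t ∈ T ↔ t ∈ ch.flatMap hubTiles := by
  rw [List.mem_flatMap]
  constructor
  · intro ht
    have hd := hT.subset t ht _ t.fst_mem
    have hs := small_of_inFlower habc hd
    have hbit : fullMask.testBit t.1.faceCode = true := by
      rw [fullMask, Nat.testBit_two_pow_sub_one]
      exact decide_eq_true hs.code_lt
    rcases (h.bits _).1 hbit with h1 | ⟨e, he, s, hse, f, hf, hcode⟩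
    · rw [not_blocked habc hb hd] at h1; cases h1
    · have hfU := hT.subset s (h.tiles e he s hse) f (Tile.faceCells_subset hf)
      have hface := hs.face_eq (small_of_inFlower habc hfU) hcode.symm
      obtain ⟨s', hs', hmem⟩ := exists_hub_cover hse hf hface
      rw [hT.unique t ht s' (h.tiles e he s' hs') _ t.fst_mem hmem]
      exact ⟨e, he, hs'⟩
  · rintro ⟨e, he, ht⟩
    exact h.tiles e he t ht

lemma Reaches.exists_expand (habc : a + b + c ≤ 9) (hb : IsBlocked a b c blocked)
    (hT : IsTiling {d | d.InFlower a b c} T) {m : ℕ} {ch : List ℕ} (h : Reaches blocked T (m, ch))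
    {i : ℕ} (hi : i < 1052) (hbit : m.testBit (i + 100) = false) (st : List (ℕ × List ℕ)) :
    ∃ x ∈ expand (i / 2) m ch (patterns (i % 2)) st, Reaches blocked T x := by
  have hblk : blocked.testBit (i + 100) = false := by
    rw [Bool.eq_false_iff]
    intro h1
    rw [(h.bits _).2 (Or.inl h1)] at hbit
    cases hbit
  set d := Cell.ofCode (i + 100) with hd
  have hdU : d.InFlower a b c := by
    rw [hb _ (by omega)] at hblk
    simpa using hblk
  have hds := small_of_inFlower habc hdU
  have hdface := Cell.face_ofCode (i + 100)
  rw [← hd, Cell.face, Prod.mk.injEq, Prod.mk.injEq] at hdface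
  have hdcode : d.faceCode = i + 100 := by
    rw [Cell.faceCode]; omega
  obtain ⟨t₀, ht₀, hmem₀⟩ := hT.cover d hdU
  obtain ⟨k, hk, p, q, e, he, hhub, ht₀hub⟩ := hT.exists_hub ht₀
  obtain ⟨f₀, hf₀, hface₀⟩ := Tile.exists_faceCell hmem₀
  have hface₀' := hface₀
  simp only [Cell.face, Prod.mk.injEq] at hface₀'
  have hfU : ∀ f ∈ hubFaces (p, q, k) e, f.InFlower a b c := by
    intro f hf
    obtain ⟨t, ht, hft⟩ := mem_hubFaces.1 hf
    exact hT.subset t (hhub t ht) f (Tile.faceCells_subset hft)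
  have hf₀mem : f₀ ∈ hubFaces (p, q, k) e := mem_hubFaces.2 ⟨t₀, ht₀hub, hf₀⟩
  have hcentre : Cell.Small (p, q, k) := small_of_inFlower habc
    (hfU (p, q, k) (mem_hubFaces.2 ⟨_, List.mem_cons_self, List.mem_cons_self⟩))
  obtain ⟨pat, hpat, hcode, hle, hbits⟩ := exists_pattern (s := i / 2) hk he hf₀mem
    (small_of_inFlower habc (hfU _ hf₀mem)) (by omega)
  have hpar : f₀.parity.toNat = i % 2 := by omega
  rw [hpar] at hpat
  refine ⟨_, mem_expand hpat ?_, ?_, ?_⟩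
  · refine Nat.eq_of_testBit_eq fun j => ?_
    rw [Nat.zero_testBit, Nat.testBit_and, Nat.testBit_shiftRight, Bool.and_eq_false_iff]
    by_contra! hcon
    obtain ⟨h1, h2⟩ := hcon
    rw [Bool.ne_false_iff] at h1 h2
    obtain ⟨f, hf, hfj⟩ := (hbits j).1 h2
    rcases (h.bits _).1 h1 with h3 | ⟨e', he', s, hs, f', hf', hcode'⟩
    · rw [add_comm, ← hfj, not_blocked habc hb (hfU f hf)] at h3
      cases h3
    · obtain ⟨t, ht, hft⟩ := mem_hubFaces.1 hf
      have hf'U := hT.subset s (h.tiles e' he' s hs) f' (Tile.faceCells_subset hf')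
      have hff : f.face = f'.face := (small_of_inFlower habc (hfU f hf)).face_eq
        (small_of_inFlower habc hf'U) (by omega)
      obtain ⟨s', hs', hfs'⟩ := exists_hub_cover hs hf' hff
      have hts : t = s' := hT.unique t (hhub t ht) s' (h.tiles e' he' s' hs') f
        (Tile.faceCells_subset hft) hfs'
      have hc1 := face_of_mem_hub ht
      have hc2 := face_of_mem_hub (hts ▸ hs' : t ∈ hubTiles e')
      obtain ⟨u, hu, hu1⟩ := exists_hub_tile (e := e')
        ((face_of_mem_hub ht₀hub).trans (hc1.symm.trans hc2))
      have hut : u = t₀ := hT.unique u (h.tiles e' he' u hu) t₀ ht₀ _ u.fst_mem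
        (hu1 ▸ t₀.fst_mem)
      have : m.testBit (i + 100) = true := by
        refine (h.bits _).2 (Or.inr ⟨e', he', t₀, hut ▸ hu, f₀, hf₀, ?_⟩)
        rw [← hdcode, Cell.faceCode, Cell.faceCode]
        omega
      rw [hbit] at this
      cases this
  · rw [hcode]
    intro e' he' t ht
    rcases List.mem_cons.1 he' with rfl | he'
    · rw [hubTiles_code hk hcentre he] at ht
      exact hhub t ht
    · exact h.tiles e' he' t ht
  · intro j
    have h1 := h.bits j
    simp only at h1
    rw [hcode, Nat.testBit_or, Bool.or_eq_true, h1, Nat.testBit_shiftLeft, Bool.and_eq_true,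
      decide_eq_true_eq, hbits, List.exists_mem_cons_iff, hubTiles_code hk hcentre he, or_assoc,
      or_comm (a := ∃ t ∈ hub (p, q, k) e, _)]
    refine or_congr Iff.rfl (or_congr Iff.rfl ?_)
    constructor
    · rintro ⟨hj, f, hf, hfj⟩
      obtain ⟨t, ht, hft⟩ := mem_hubFaces.1 hf
      exact ⟨t, ht, f, hft, by omega⟩
    · rintro ⟨t, ht, f, hft, hfj⟩
      have hf := mem_hubFaces.2 ⟨t, ht, hft⟩
      have := hle f hf
      exact ⟨by omega, f, hf, by omega⟩

lemma search_sound (habc : a + b + c ≤ 9) (hb : IsBlocked a b c blocked)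
    (hT : IsTiling {d | d.InFlower a b c} T) (reps : List (List ℕ)) (hs : List ℕ)
    (st : List (ℕ × List ℕ)) (h : search reps hs st = true) {x : ℕ × List ℕ} (hx : x ∈ st)
    (hr : Reaches blocked T x) : ∃ r ∈ reps, ∃ g < 12, ∀ j,
      (∃ t ∈ T, t.code = j) ↔ ∃ t ∈ r.flatMap hubTiles, (t.sym g).code = j := by
  induction hs generalizing st x with
  | nil =>
    cases st with
    | nil => cases hx
    | cons => cases h
  | cons i hs ih =>
    cases st with
    | nil => cases hx
    | cons y st =>
      obtain ⟨m, ch⟩ := y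
      rw [search] at h
      cases hi : i.blt 1052
      · rw [hi, cond_false, Bool.and_eq_true, Bool.and_eq_true] at h
        obtain ⟨⟨h1, h2⟩, h3⟩ := h
        rcases List.mem_cons.1 hx with rfl | hx
        · generalize hfull : fullMask = full at h1
          obtain rfl := Nat.eq_of_beq_eq_true h1
          subst hfull
          unfold matchesRep at h2
          split at h2
          · rename_i r hr'
            refine ⟨r, List.mem_of_getElem? hr', (i - 1052) % 12, Nat.mod_lt _ (by norm_num),
              fun j => ?_⟩
            have heq := congrArg (fun n => n.testBit j = true) (Nat.eq_of_beq_eq_true h2)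
            simp only [tileMask, testBit_bitmask, List.mem_map, eq_iff_iff] at heq
            rw [← heq]
            simp only [hr.eq_of_full habc hb hT]
          · cases h2
        · exact ih st h3 hx hr
      · rw [hi, cond_true, Bool.and_eq_true, Bool.not_eq_true'] at h
        rcases List.mem_cons.1 hx with rfl | hx
        · obtain ⟨x, hx, hr'⟩ := hr.exists_expand habc hb hT (by rwa [Nat.blt_eq] at hi) h.1 st
          exact ih _ h.2 hx hr'
        · exact ih _ h.2 (mem_expand_of_mem hx) hr

end

/-! ### Counting the fillings -/

/-- No number occurs twice in the list, and none is a bit of `m`. -/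
def distinctBits : List ℕ → ℕ → Bool
  | [], _ => true
  | j :: js, m => !m.testBit j && distinctBits js (2 ^ j ||| m)

lemma distinctBits_spec {l : List ℕ} {m : ℕ} (h : distinctBits l m = true) :
    l.Nodup ∧ ∀ j ∈ l, m.testBit j = false := by
  induction l generalizing m with
  | nil => simp
  | cons i l ih =>
    rw [distinctBits, Bool.and_eq_true, Bool.not_eq_true'] at h
    obtain ⟨h1, h2⟩ := ih h.2
    simp only [Nat.testBit_or, Bool.or_eq_false_iff, Nat.testBit_two_pow] at h2
    refine ⟨List.nodup_cons.2 ⟨fun hi => ?_, h1⟩, List.forall_mem_cons.2 ⟨h.1, fun j hj => (h2 j hj).2⟩⟩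
    simpa using (h2 i hi).1

/-- The hubs with the given codes form a tiling of the region. -/
def checkRep (a b c : ℤ) (blocked : ℕ) (r : List ℕ) : Bool :=
  (r.flatMap hubTiles).all (fun t => t.faceCells.all fun f => decide (f.InFlower a b c)) &&
  (blocked ||| bitmask (((r.flatMap hubTiles).flatMap Tile.faceCells).map Cell.faceCode)).beq
    fullMask &&
  distinctBits (((r.flatMap hubTiles).flatMap Tile.cells).map fun d => Tile.code (d, false)) 0

/-- No two of the hub lists are symmetric to each other. -/
def separated : List (List ℕ) → Bool
  | [] => true
  | r :: rs => (List.range 12).all (fun g => rs.all fun s => !(tileMask r g).beq (tileMask s 0)) &&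
      separated rs

lemma separated_spec {reps : List (List ℕ)} (h : separated reps = true) :
    reps.Pairwise fun r s => ∀ g < 12, tileMask r g ≠ tileMask s 0 := by
  induction reps with
  | nil => exact List.Pairwise.nil
  | cons r rs ih =>
    rw [separated, Bool.and_eq_true, List.all_eq_true] at h
    refine List.pairwise_cons.2 ⟨fun s hs g hg heq => ?_, ih h.2⟩
    have := List.all_eq_true.1 (h.1 g (List.mem_range.2 hg)) s hs
    rw [heq] at this
    simp at this

/-- The set of the tiles of a list of hubs. -/
def repTiles (r : List ℕ) : Set Tile := {t | t ∈ r.flatMap hubTiles}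

section

variable {a b c : ℤ} {blocked : ℕ} {r : List ℕ}

lemma nodup_cells (h : checkRep a b c blocked r = true) :
    ((r.flatMap hubTiles).flatMap Tile.cells).Nodup := by
  rw [checkRep, Bool.and_eq_true] at h
  exact (distinctBits_spec h.2).1.of_map

lemma nodup_tiles (h : checkRep a b c blocked r = true) : (r.flatMap hubTiles).Nodup := by
  refine (List.nodup_flatMap.1 (nodup_cells h)).2.imp ?_
  rintro t _ hdisj rfl
  exact hdisj t.fst_mem t.fst_mem

lemma isTiling_repTiles (habc : a + b + c ≤ 9) (hb : IsBlocked a b c blocked)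
    (h : checkRep a b c blocked r = true) : IsTiling {d | d.InFlower a b c} (repTiles r) := by
  have hnodup := nodup_cells h
  rw [checkRep, Bool.and_eq_true, Bool.and_eq_true] at h
  have hface : ∀ t ∈ r.flatMap hubTiles, ∀ f ∈ t.faceCells, f.InFlower a b c := fun t ht f hf =>
    of_decide_eq_true (List.all_eq_true.1 (List.all_eq_true.1 h.1.1 t ht) f hf)
  refine ⟨fun t ht d hd => ?_, fun d hd => ?_, fun t ht t' ht' d hd hd' => ?_⟩
  · obtain ⟨f, hf, hdf⟩ := Tile.exists_faceCell hd
    exact IsTiling.inFlower_of_face hdf.symm (hface t ht f hf)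
  · have hs := small_of_inFlower habc hd
    have hbit : (blocked ||| bitmask (((r.flatMap hubTiles).flatMap Tile.faceCells).map
        Cell.faceCode)).testBit d.faceCode = true := by
      rw [Nat.eq_of_beq_eq_true h.1.2, fullMask, Nat.testBit_two_pow_sub_one]
      exact decide_eq_true hs.code_lt
    rw [Nat.testBit_or, not_blocked habc hb hd, Bool.false_or, testBit_bitmask, List.mem_map] at hbit
    obtain ⟨f, hf, hcode⟩ := hbit
    obtain ⟨t, ht, hft⟩ := List.mem_flatMap.1 hf
    obtain ⟨e, he, hte⟩ := List.mem_flatMap.1 ht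
    obtain ⟨t', ht', hdt⟩ := exists_hub_cover hte hft
      (hs.face_eq (small_of_inFlower habc (hface t ht f hft)) hcode.symm)
    exact ⟨t', List.mem_flatMap.2 ⟨e, he, ht'⟩, hdt⟩
  · by_contra hne
    have hpair := (List.nodup_flatMap.1 hnodup).2
    have hsymm : Std.Symm (Function.onFun List.Disjoint Tile.cells) := ⟨fun _ _ h => h.symm⟩
    exact List.Pairwise.forall hpair ht ht' hne hd hd'

/-- The starting point of the edge lies in the hexagon of radius `9`. -/
def Cell.InHexagon (c : Cell) : Prop :=
  (-9 ≤ c.1 ∧ c.1 ≤ 9) ∧ (-9 ≤ c.2.1 ∧ c.2.1 ≤ 9) ∧ -9 ≤ c.1 + c.2.1 ∧ c.1 + c.2.1 ≤ 9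

lemma inHexagon_of_inFlower (habc : a + b + c ≤ 9) {d : Cell} (hd : d.InFlower a b c) :
    d.InHexagon ∧ d.mirror.InHexagon := by
  have h := InFlower.bound hd
  have h' : -(a + b + c) ≤ d.floorS ∧ d.floorS < a + b + c := by
    obtain ⟨-, ⟨h1, -⟩, -, -, ⟨h2, -⟩, -⟩ := hd
    omega
  obtain ⟨m, n, k⟩ := d
  fin_cases k <;>
    simp [Cell.InHexagon, Cell.mirror, Cell.floorS, Cell.floorX, Cell.floorY, Cell.parity, unitX,
      unitY] at h h' ⊢ <;> omega

lemma inHexagon_sym (habc : a + b + c ≤ 9) {t : Tile} (ht : t.1.InFlower a b c) (g : ℕ) :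
    (t.sym g).1.InHexagon := by
  have hiter : ∀ (n : ℕ) (t : Tile), t.1.InHexagon → (Tile.turn^[n] t).1.InHexagon := by
    intro n
    induction n with
    | zero => exact fun t h => h
    | succ n ih =>
      intro t h
      refine ih _ ?_
      simp only [Cell.InHexagon, Tile.turn, Cell.turn] at *
      omega
  refine hiter _ _ ?_
  cases g.blt 6
  · exact (inHexagon_of_inFlower habc ht).2
  · exact (inHexagon_of_inFlower habc ht).1

lemma code_injective {t t' : Tile} (ht : t.1.InHexagon) (ht' : t'.1.InHexagon)
    (h : t.code = t'.code) : t = t' := by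
  obtain ⟨⟨m, n, k⟩, s⟩ := t
  obtain ⟨⟨m', n', k'⟩, s'⟩ := t'
  simp only [Cell.InHexagon, Tile.code] at *
  have h1 := k.2
  have h2 := k'.2
  have h3 := Bool.toNat_le s
  have h4 := Bool.toNat_le s'
  have e1 : m = m' := by omega
  have e2 : n = n' := by omega
  have e3 : k = k' := Fin.ext (by omega)
  have e4 : s = s' := by
    have : s.toNat = s'.toNat := by omega
    cases s <;> cases s' <;> simp_all
  rw [e1, e2, e3, e4]

lemma Tile.sym_zero (t : Tile) : t.sym 0 = t := rfl

lemma mem_tileMask {g j : ℕ} :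
    (tileMask r g).testBit j = true ↔ ∃ t ∈ repTiles r, (t.sym g).code = j := by
  rw [tileMask, testBit_bitmask, List.mem_map]
  rfl

lemma ncard_repTiles (h : checkRep a b c blocked r = true) : (repTiles r).ncard = 3 * r.length := by
  have h1 : (repTiles r).ncard = (r.flatMap hubTiles).length := by
    classical
    have : repTiles r = ((r.flatMap hubTiles).toFinset : Set Tile) := by
      ext t; simp [repTiles]
    rw [this, Set.ncard_coe_finset, List.toFinset_card_of_nodup (nodup_tiles h)]
  rw [h1, List.length_flatMap]
  simp [hubTiles, hub, mul_comm]

lemma inFlower_zero (ha : 0 < a) (hb : 0 < b) (hc : 0 < c) : Cell.InFlower a b c (0, 0, 0) := by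
  simp [Cell.InFlower, Cell.floorS, Cell.floorX, Cell.floorY, Cell.parity, Notch]
  omega

lemma neg_mem_flower {a b c : ℝ} {z : ℂ} (hz : z ∈ flower a b c) : -z ∈ flower a b c := by
  obtain ⟨i, -, l, hl, s, t, hs, ht, hst, rfl⟩ := mem_flower.1 hz
  refine mem_flower.2 ⟨(i + 3) % 6, Nat.mod_lt _ (by norm_num), l, hl, s, t, hs, ht, hst, ?_⟩
  have w3 : ω ^ 3 = -1 := by
    rw [← ζ_pow_two_mul]; exact ζ_pow_six
  rw [ω_pow_mod, pow_add, w3]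
  ring

variable {reps : List (List ℕ)} {hints : List ℕ}

/-- Every tiling of the region is symmetric to one of the given hub lists. -/
lemma exists_rep (habc : a + b + c ≤ 9) (hb : IsBlocked a b c blocked)
    (hcheck : ∀ r ∈ reps, checkRep a b c blocked r = true)
    (hsearch : search reps hints [(blocked, [])] = true) {T : Set Tile}
    (hT : IsTiling {d | d.InFlower a b c} T) : ∃ r ∈ reps, ∃ g < 12, T = Tile.sym g '' repTiles r := by
  obtain ⟨r, hr, g, hg, hcode⟩ := search_sound habc hb hT reps hints _ hsearch
    List.mem_cons_self ⟨by simp, by simp⟩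
  have hrep := isTiling_repTiles habc hb (hcheck r hr)
  have hex1 : ∀ t ∈ T, t.1.InHexagon := fun t ht =>
    (inHexagon_of_inFlower habc (hT.subset t ht _ t.fst_mem)).1
  have hex2 : ∀ t ∈ repTiles r, (t.sym g).1.InHexagon := fun t ht =>
    inHexagon_sym habc (hrep.subset t ht _ t.fst_mem) g
  refine ⟨r, hr, g, hg, Set.ext fun t => ⟨fun ht => ?_, ?_⟩⟩
  · obtain ⟨s, hs, hcode'⟩ := (hcode t.code).1 ⟨t, ht, rfl⟩
    exact ⟨s, hs, code_injective (hex2 s hs) (hex1 t ht) hcode'⟩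
  · rintro ⟨s, hs, rfl⟩
    obtain ⟨t, ht, hcode'⟩ := (hcode (s.sym g).code).2 ⟨s, hs, rfl⟩
    rwa [← code_injective (hex1 t ht) (hex2 s hs) hcode']

lemma image_tileSet_image_sym {g : ℕ} {e : ℂ ≃ᵢ ℂ} (he : ∀ z, e z = symMap g z) (T : Set Tile) :
    (fun S : Set ℂ => e '' S) '' (tileSet '' T) = tileSet '' (Tile.sym g '' T) := by
  simp only [Set.image_image, image_tileSet_sym he]

/-- An isometry between two tilings of the region comes from a symmetry of the lattice. -/
lemma exists_sym (ha : 0 < a) (hb : 0 < b) (hc : 0 < c) {T T' : Set Tile}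
    (hT : IsTiling {d | d.InFlower a b c} T) (hT' : IsTiling {d | d.InFlower a b c} T')
    {e : ℂ ≃ᵢ ℂ} (he : (fun S : Set ℂ => e '' S) '' (tileSet '' T) = tileSet '' T') :
    ∃ g < 12, T' = Tile.sym g '' T := by
  have hR : e '' cellRegion {d | d.InFlower a b c} = cellRegion {d | d.InFlower a b c} := by
    conv_lhs => rw [← hT.isFilling.2.2]
    rw [← hT'.isFilling.2.2, ← he, Set.image_sUnion]
  have hflower : flower a b c = cellRegion {d | d.InFlower a b c} := flower_eq ha hb hc
  have h0 : e 0 = 0 := by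
    refine isometry_fixes_center (isBounded_cellRegion (finite_inFlower a b c)) ?_ ?_ hR
    · obtain ⟨z, hz⟩ := cell_center_mem (0, 0, 0)
      exact ⟨z, mem_cellRegion.2 ⟨_, inFlower_zero ha hb hc, cellInt_subset_cellSet _ hz⟩⟩
    · intro z hz
      rw [← hflower] at hz ⊢
      exact neg_mem_flower hz
  obtain ⟨t, ht, -⟩ := hT.cover (0, 0, 0) (inFlower_zero ha hb hc)
  have hmem : e '' tileSet t ∈ tileSet '' T' := by
    rw [← he]; exact Set.mem_image_of_mem _ (Set.mem_image_of_mem _ ht)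
  obtain ⟨t', -, ht'⟩ := hmem
  obtain ⟨g, hg, hsym⟩ := isometry_eq_symMap h0 ht'.symm
  refine ⟨g, hg, tileSet_injective.image_injective ?_⟩
  rw [← he, image_tileSet_image_sym hsym]

theorem card_pattern (ha : 0 < a) (hb : 0 < b) (hc : 0 < c) (habc : a + b + c ≤ 9)
    (hblocked : IsBlocked a b c blocked) (hcheck : ∀ r ∈ reps, checkRep a b c blocked r = true)
    (hsep : separated reps = true) (hsearch : search reps hints [(blocked, [])] = true) :
    Nat.card (Pattern (flower a b c)) = reps.length := by
  have hflower : flower a b c = cellRegion {d | d.InFlower a b c} := flower_eq ha hb hc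
  rw [hflower]
  have htiling : ∀ i : Fin reps.length, IsTiling {d | d.InFlower a b c} (repTiles (reps.get i)) :=
    fun i => isTiling_repTiles habc hblocked (hcheck _ (List.get_mem _ _))
  let f : Fin reps.length → Pattern (cellRegion {d | d.InFlower a b c}) := fun i =>
    Quotient.mk _ ⟨tileSet '' repTiles (reps.get i), (htiling i).isFilling⟩
  have hlt : ∀ i j : Fin reps.length, i < j → f i ≠ f j := by
    intro i j hij heq
    obtain ⟨e, he⟩ := Quotient.exact heq
    obtain ⟨g, hg, hsym⟩ := exists_sym ha hb hc (htiling i) (htiling j) he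
    refine List.pairwise_iff_get.1 (separated_spec hsep) i j hij g hg
      (Nat.eq_of_testBit_eq fun n => ?_)
    rw [Bool.eq_iff_iff, mem_tileMask, mem_tileMask, hsym]
    simp only [Set.exists_mem_image, Tile.sym_zero]
  have hbij : Function.Bijective f := by
    refine ⟨fun i j heq => ?_, fun q => ?_⟩
    · rcases lt_trichotomy i j with h | h | h
      · exact absurd heq (hlt i j h)
      · exact h
      · exact absurd heq.symm (hlt j i h)
    · obtain ⟨⟨F, hF⟩, rfl⟩ := Quotient.exists_rep q
      obtain ⟨T, hT, rfl⟩ := hF.exists_tiling (finite_inFlower a b c)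
      obtain ⟨r, hr, g, -, rfl⟩ := exists_rep habc hblocked hcheck hsearch hT
      obtain ⟨i, rfl⟩ := List.get_of_mem hr
      obtain ⟨e, he⟩ := exists_isometry_symMap g
      exact ⟨i, Quotient.sound ⟨e, image_tileSet_image_sym he _⟩⟩
  rw [← Nat.card_eq_of_bijective f hbij, Nat.card_fin]

theorem ncard_filling (ha : 0 < a) (hb : 0 < b) (hc : 0 < c) (habc : a + b + c ≤ 9)
    (hblocked : IsBlocked a b c blocked) (hcheck : ∀ r ∈ reps, checkRep a b c blocked r = true)
    (hsearch : search reps hints [(blocked, [])] = true) {n : ℕ} (hlen : ∀ r ∈ reps, r.length = n)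
    {F : Set (Set ℂ)} (hF : IsFilling (flower a b c) F) : F.ncard = 3 * n := by
  have hflower : flower a b c = cellRegion {d | d.InFlower a b c} := flower_eq ha hb hc
  rw [hflower] at hF
  obtain ⟨T, hT, rfl⟩ := hF.exists_tiling (finite_inFlower a b c)
  obtain ⟨r, hr, g, -, rfl⟩ := exists_rep habc hblocked hcheck hsearch hT
  rw [Set.ncard_image_of_injective _ tileSet_injective,
    Set.ncard_image_of_injective _ (sym_injective g), ncard_repTiles (hcheck r hr), hlen r hr]

end

/-! ### The three regions -/

def blocked221 : ℕ :=
  0xffffffffffffffffffffffffffffffffffffffffffffffffffffffffffffffffffffffffffffffffffffffffff83fffffffffe003fffffffe0003fffffff80007fffffff0000ffffffff0000fffffffe0001fffffffc0007fffffffc007fffffffffc1ffffffffffffffffffffffffffffffffffffffffffffffffffffffffffffffffffffffffffffffffffffffffff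

def hints221 : List ℕ :=
  [634, 586, 587, 587, 587, 587, 587, 586, 539, 586, 539, 636, 687, 689, 689, 687, 689, 689, 686,
    590, 593, 593, 492, 397, 397, 397, 397, 494, 398, 493, 351, 398, 398, 398, 398, 398, 686, 643,
    595, 593, 592, 599, 595, 593, 592, 600, 507, 507, 599, 506, 504, 550, 549, 365, 504, 550, 549,
    365, 316, 316, 365, 315, 264, 261, 261, 264, 261, 261, 264, 361, 358, 358, 264, 308, 351, 397,
    397, 351, 397, 397, 351, 356, 401, 401, 351, 445, 447, 542, 542, 542, 495, 593, 402, 359, 500,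
    1052, 453, 359, 549, 402, 495, 592, 495, 543, 543, 401, 543, 594, 401, 357, 594, 503, 358, 453,
    453, 1064, 540, 492, 445, 492, 445]

def reps221 : List (List ℕ) :=
  [[5501, 5908, 6309, 5578, 5230, 4466, 3718, 3305, 2907, 3633, 3987, 4748, 5159, 4399, 5183, 4039,
      4063, 4823],
   [5501, 5908, 6309, 5578, 5230, 4466, 3718, 3305, 2907, 3633, 3987, 4748, 4768, 5160, 4024, 5184,
      4048, 4440]]

lemma isBlocked221 : IsBlocked 2 2 1 blocked221 := by
  rw [IsBlocked]
  decide +kernel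

lemma checkRep221 : ∀ r ∈ reps221, checkRep 2 2 1 blocked221 r = true := by
  decide +kernel

lemma separated221 : separated reps221 = true := by
  decide +kernel

lemma search221 : search reps221 hints221 [(blocked221, [])] = true := by
  decide +kernel

def blocked222 : ℕ :=
  0xffffffffffffffffffffffffffffffffffffffffffffffffffffffffffffffffffffffffffffffe0ffffffffff80ffffffffe0000fffffff80000fffffff00001fffffff00007ffffffe0000fffffff80000fffffff00001fffffff00007ffffffff01ffffffffff07ffffffffffffffffffffffffffffffffffffffffffffffffffffffffffffffffffffffffffffff

def hints222 : List ℕ :=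
  [537, 584, 584, 584, 584, 585, 632, 585, 585, 634, 588, 539, 491, 538, 539, 491, 396, 732, 685,
    399, 352, 305, 305, 352, 689, 306, 215, 310, 267, 318, 647, 554, 599, 412, 542, 495, 593, 402,
    359, 500, 1052, 453, 359, 549, 402, 495, 592, 495, 543, 543, 401, 543, 594, 401, 357, 594, 503,
    358, 453, 453, 1064, 363, 552, 412, 599, 412, 504, 549, 592, 495, 402, 453, 1076, 452, 402, 495,
    592, 409, 549, 549, 363, 412, 646, 648, 601, 648, 601, 364, 413, 413, 318, 647, 554, 412, 599,
    361, 358, 401, 542, 593, 500, 1081, 500, 592, 495, 401, 456, 358, 358, 552, 412, 599, 412, 361,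
    358, 401, 542, 593, 500, 1088, 500, 592, 495, 401, 456, 358, 358, 412, 646, 648, 601, 648, 601,
    364, 267, 265, 266, 266, 265, 263, 266, 266, 215, 647, 646, 554, 265, 311, 311, 311, 311, 356,
    401, 542, 593, 550, 267, 453, 457, 364, 1080, 364, 361, 409, 364, 1093, 364, 453, 549, 592, 495,
    359, 401, 401, 267, 460, 367, 318, 265, 311, 311, 311, 311, 356, 401, 542, 593, 359, 500, 552,
    457, 361, 364, 1100, 364, 457, 500, 267, 552, 409, 364, 1112, 364, 409, 453, 453, 549, 592, 495,
    359, 401, 401, 267, 646, 648, 601, 648, 601, 263, 645, 647, 647, 306, 399, 352, 305, 305, 352,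
    306, 641, 215, 310, 267, 318, 647, 554, 599, 595, 592, 495, 402, 359, 500, 457, 1077, 453, 359,
    402, 495, 549, 592, 592, 552, 412, 599, 595, 592, 495, 402, 359, 500, 457, 1089, 453, 359, 402,
    495, 549, 592, 592, 412, 646, 648, 601, 648, 601, 364, 413, 413, 318, 647, 554, 412, 599, 595,
    592, 495, 402, 501, 453, 1101, 453, 359, 402, 495, 549, 592, 592, 552, 412, 599, 412, 595, 592,
    495, 402, 501, 453, 1113, 453, 359, 402, 495, 549, 592, 592, 412, 646, 648, 601, 648, 601, 364,
    267, 265, 266, 266, 265, 263, 266, 266, 645, 647, 647, 689, 689, 215, 265, 311, 311, 311, 311,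
    356, 401, 542, 267, 359, 318, 363, 456, 499, 641, 596, 647, 504, 1124, 646, 596, 499, 459, 641,
    596, 647, 1136, 646, 596, 499, 499, 460, 363, 453, 499, 499, 318, 412, 410, 410, 410, 410, 359,
    456, 499, 641, 596, 647, 504, 1148, 646, 596, 499, 459, 641, 596, 647, 1160, 646, 596, 499, 499,
    456, 460, 364, 592, 495, 359, 401, 401, 267, 263, 306, 685, 733, 733, 733, 733, 398, 305, 305,
    349, 732, 685, 689, 305, 352, 352, 352, 352, 447, 542, 593, 306, 402, 215, 310, 596, 647, 550,
    507, 501, 267, 453, 554, 457, 364, 1079, 364, 457, 361, 554, 409, 364, 1105, 364, 409, 453, 647,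
    359, 500, 552, 457, 361, 364, 1126, 364, 457, 500, 267, 552, 409, 364, 1141, 364, 409, 453, 453,
    646, 646, 267, 263, 452, 500, 500, 596, 647, 215, 554, 402, 356, 550, 453, 457, 366, 358, 361,
    1092, 360, 364, 311, 267, 409, 364, 1117, 364, 360, 453, 356, 452, 500, 500, 460, 367, 318, 263,
    647, 215, 265, 311, 311, 311, 311, 402, 359, 500, 552, 457, 361, 364, 1153, 364, 457, 500, 267,
    552, 409, 364, 1165, 364, 409, 453, 453, 359, 267, 263, 646, 646, 306, 402, 215, 310, 500, 359,
    359, 359, 359, 267, 263, 452, 500, 500, 215, 647, 646, 549, 500, 500, 549, 646, 596, 596, 648,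
    601, 263, 592, 402, 495, 495, 306, 645, 647, 647, 305, 352, 352, 352, 352, 447, 542, 306, 402,
    215, 310, 267, 359, 318, 363, 456, 499, 641, 596, 647, 504, 1103, 646, 596, 499, 459, 641, 596,
    647, 1150, 646, 596, 499, 499, 460, 363, 453, 499, 499, 318, 412, 410, 410, 410, 410, 359, 456,
    499, 641, 596, 647, 504, 1172, 646, 596, 499, 459, 641, 596, 647, 1184, 646, 596, 499, 499, 456,
    460, 364, 267, 263, 215, 310, 359, 267, 263, 215, 265, 311, 311, 311, 311, 402, 267, 359, 318,
    363, 456, 499, 641, 596, 647, 504, 1139, 646, 596, 499, 459, 641, 596, 647, 1196, 646, 596, 499,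
    499, 460, 363, 453, 499, 499, 318, 412, 410, 410, 410, 410, 359, 456, 499, 641, 596, 647, 504,
    1188, 646, 596, 499, 459, 641, 596, 647, 1208, 646, 596, 499, 499, 456, 460, 364, 359, 267, 263,
    592, 402, 495, 495, 306, 685, 733, 733, 733, 733, 398, 491, 538, 491, 396, 732, 685, 399, 352,
    305, 305, 352, 689, 590, 495, 593, 306, 402, 215, 310, 596, 647, 550, 507, 501, 267, 453, 554,
    457, 364, 1078, 364, 457, 361, 554, 409, 364, 1125, 364, 409, 453, 647, 359, 500, 552, 457, 361,
    364, 1102, 364, 457, 500, 267, 552, 409, 364, 1149, 364, 409, 453, 453, 646, 646, 267, 263, 452,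
    500, 500, 596, 647, 215, 554, 402, 356, 550, 453, 457, 366, 358, 361, 1104, 360, 364, 311, 267,
    409, 364, 1140, 364, 360, 453, 356, 452, 500, 500, 460, 367, 318, 263, 647, 215, 265, 311, 311,
    311, 311, 402, 359, 500, 552, 457, 361, 364, 1173, 364, 457, 500, 267, 552, 409, 364, 1189, 364,
    409, 453, 453, 359, 267, 263, 646, 646, 306, 402, 215, 310, 500, 359, 359, 359, 359, 267, 263,
    452, 500, 500, 215, 647, 646, 549, 500, 500, 549, 646, 596, 596, 648, 601, 263, 402, 495, 592,
    495, 645, 647, 647, 306, 590, 399, 495, 495, 495, 306, 402, 215, 310, 267, 359, 318, 363, 456,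
    499, 641, 596, 647, 504, 1090, 646, 596, 499, 459, 641, 596, 647, 1114, 646, 596, 499, 499, 460,
    363, 453, 499, 499, 318, 412, 410, 410, 410, 410, 359, 456, 499, 641, 596, 647, 504, 1137, 646,
    596, 499, 459, 641, 596, 647, 1161, 646, 596, 499, 499, 456, 460, 364, 267, 263, 215, 310, 359,
    267, 263, 215, 265, 311, 311, 311, 311, 402, 267, 359, 318, 363, 456, 499, 641, 596, 647, 504,
    1151, 646, 596, 499, 459, 641, 596, 647, 1185, 646, 596, 499, 499, 460, 363, 453, 499, 499, 318,
    412, 410, 410, 410, 410, 359, 456, 499, 641, 596, 647, 504, 1197, 646, 596, 499, 459, 641, 596,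
    647, 1209, 646, 596, 499, 499, 456, 460, 364, 359, 267, 263, 402, 306, 495, 592, 495, 685, 733,
    733, 733, 733, 398, 305, 305, 349, 732, 685, 590, 689, 447, 593, 596, 647, 554, 550, 457, 366,
    409, 316, 454, 317, 452, 360, 217, 401, 306, 1091, 306, 215, 352, 306, 215, 311, 1116, 263, 306,
    360, 452, 364, 367, 305, 352, 352, 352, 352, 306, 402, 453, 215, 310, 267, 1152, 360, 263, 452,
    402, 356, 453, 215, 311, 267, 1164, 360, 263, 356, 452, 306, 413, 305, 352, 352, 352, 352, 402,
    453, 453, 452, 452, 306, 460, 367, 318, 647, 305, 352, 352, 352, 352, 306, 402, 215, 310, 359,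
    500, 552, 457, 361, 364, 1138, 364, 457, 500, 267, 552, 409, 364, 1198, 364, 409, 453, 453, 267,
    263, 452, 500, 500, 215, 265, 311, 311, 311, 311, 402, 359, 500, 552, 457, 361, 364, 1187, 364,
    457, 500, 267, 552, 409, 364, 1213, 364, 409, 453, 453, 359, 267, 263, 306, 646, 646, 305, 352,
    352, 352, 352, 306, 402, 215, 310, 500, 359, 359, 359, 359, 267, 263, 452, 500, 500, 215, 647,
    646, 549, 500, 500, 549, 646, 596, 596, 648, 601, 263, 306, 593, 305, 352, 352, 352, 352, 402,
    306, 451, 500, 401, 305, 305, 402, 306, 495, 495, 645, 647, 647, 495, 592, 689, 689, 495, 590,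
    305, 352, 352, 352, 352, 447, 306, 402, 215, 310, 267, 359, 318, 363, 456, 499, 641, 596, 647,
    504, 1115, 646, 596, 499, 459, 641, 596, 647, 1162, 646, 596, 499, 499, 460, 363, 453, 499, 499,
    318, 412, 410, 410, 410, 410, 359, 456, 499, 641, 596, 647, 504, 1186, 646, 596, 499, 459, 641,
    596, 647, 1210, 646, 596, 499, 499, 456, 460, 364, 267, 263, 215, 310, 359, 267, 263, 215, 265,
    311, 311, 311, 311, 402, 267, 359, 318, 363, 456, 499, 641, 596, 647, 504, 1163, 646, 596, 499,
    459, 641, 596, 647, 1211, 646, 596, 499, 499, 460, 363, 453, 499, 499, 318, 412, 410, 410, 410,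
    410, 359, 456, 499, 641, 596, 647, 504, 1212, 646, 596, 499, 459, 641, 596, 647, 1220, 646, 596,
    499, 499, 456, 460, 364, 359, 267, 263, 402, 306, 495, 592, 495, 685, 733, 733, 733, 733, 398,
    491, 539, 539, 539, 539, 684, 732, 732, 684, 732, 732, 538, 444, 349, 349, 587, 634, 634, 634,
    634, 635, 635, 732, 686, 349, 396, 396, 396, 396, 397, 397, 494, 543, 543, 448, 688, 640, 640,
    640, 640, 690, 543, 594, 690, 647, 599, 553, 507, 594, 503, 507, 367, 412, 317, 316, 503, 408,
    408, 450, 450, 450, 315, 305, 356, 356, 215, 215, 1226, 450, 305, 356, 356, 215, 215, 313, 1215,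
    364, 364, 364, 364, 503, 453, 450, 450, 414, 411, 411, 316, 408, 450, 450, 450, 315, 305, 356,
    356, 215, 215, 1216, 450, 305, 356, 356, 215, 215, 313, 1168, 551, 551, 551, 551, 594, 647, 598,
    598, 507, 503, 647, 598, 598, 507, 507, 367, 412, 317, 316, 503, 408, 408, 450, 450, 450, 315,
    305, 356, 356, 215, 215, 1217, 450, 305, 356, 356, 215, 215, 313, 1193, 364, 364, 364, 364, 503,
    453, 450, 450, 414, 411, 411, 316, 408, 450, 450, 450, 315, 305, 356, 356, 215, 215, 1169, 450,
    305, 356, 356, 215, 215, 313, 1120, 494, 543, 543, 305, 401, 401, 305, 261, 215, 215, 543, 401,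
    499, 593, 640, 640, 594, 594, 452, 593, 640, 640, 640, 640, 690, 594, 401, 688, 593, 593, 593,
    593, 690, 690, 647, 599, 215, 262, 262, 357, 357, 452, 452, 216, 216, 309, 309, 594, 452, 500,
    500, 647, 598, 598, 507, 452, 503, 503, 502, 502, 356, 215, 215, 688, 593, 593, 593, 593, 690,
    690, 647, 599, 553, 507, 594, 503, 503, 405, 405, 405, 506, 312, 361, 361, 317, 365, 1214, 405,
    312, 361, 361, 317, 457, 365, 1192, 551, 551, 551, 551, 594, 500, 405, 405, 647, 598, 598, 507,
    503, 405, 405, 405, 506, 312, 361, 361, 317, 365, 1202, 405, 312, 361, 361, 317, 457, 365, 1145,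
    215, 215, 266, 316, 318, 318, 358, 688, 593, 593, 593, 593, 690, 594, 453, 453, 453, 453, 361,
    317, 318, 688, 593, 593, 593, 593, 690, 594, 453, 643, 453, 647, 550, 550, 504, 411, 1167, 453,
    453, 643, 596, 647, 551, 551, 504, 411, 1155, 317, 318, 409, 454, 413, 500, 413, 504, 500, 593,
    595, 643, 550, 599, 599, 1119, 504, 599, 601, 593, 595, 643, 1096, 591, 591, 732, 686, 689, 689,
    349, 396, 396, 396, 396, 397, 397, 494, 543, 543, 448, 543, 639, 690, 594, 639, 690, 690, 647,
    599, 553, 507, 594, 503, 507, 367, 412, 317, 316, 503, 408, 408, 450, 450, 450, 315, 305, 356,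
    356, 215, 215, 1218, 450, 305, 356, 356, 215, 215, 313, 1203, 364, 364, 364, 364, 503, 453, 450,
    450, 414, 411, 411, 316, 408, 450, 450, 450, 315, 305, 356, 356, 215, 215, 1194, 450, 305, 356,
    356, 215, 215, 313, 1156, 551, 551, 551, 551, 594, 647, 598, 598, 507, 503, 647, 598, 598, 507,
    507, 367, 412, 317, 316, 503, 408, 408, 450, 450, 450, 315, 305, 356, 356, 215, 215, 1170, 450,
    305, 356, 356, 215, 215, 313, 1146, 364, 364, 364, 364, 503, 453, 450, 450, 414, 411, 411, 316,
    408, 450, 450, 450, 315, 305, 356, 356, 215, 215, 1121, 450, 305, 356, 356, 215, 215, 313, 1097,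
    494, 543, 543, 305, 401, 401, 543, 639, 690, 594, 639, 690, 305, 261, 215, 215, 401, 690, 647,
    599, 215, 262, 262, 357, 357, 452, 452, 216, 216, 309, 309, 594, 452, 500, 500, 647, 598, 598,
    507, 452, 503, 503, 502, 502, 690, 356, 215, 215, 647, 599, 553, 507, 594, 503, 503, 405, 405,
    405, 506, 312, 361, 361, 317, 365, 1190, 405, 312, 361, 361, 317, 457, 365, 1178, 551, 551, 551,
    551, 215, 215, 647, 599, 266, 316, 318, 318, 594, 500, 405, 405, 358, 453, 453, 550, 504, 506,
    361, 317, 365, 1143, 361, 317, 318, 550, 457, 457, 1107, 596, 596, 594, 500, 452, 405, 647, 598,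
    598, 507, 356, 215, 215, 503, 405, 405, 405, 506, 312, 361, 361, 317, 365, 1158, 405, 312, 361,
    361, 317, 457, 365, 1109, 215, 215, 358, 405, 266, 453, 266, 361, 507, 457, 361, 317, 365, 1131,
    453, 361, 317, 365, 1085, 444, 349, 349, 349, 396, 396, 396, 396, 397, 397, 540, 587, 587, 634,
    634, 635, 635, 732, 686, 688, 640, 640, 640, 640, 690, 591, 495, 495, 594, 495, 448, 690, 647,
    599, 553, 507, 594, 503, 507, 367, 412, 317, 316, 503, 408, 408, 450, 450, 450, 315, 305, 356,
    356, 215, 215, 1219, 450, 305, 356, 356, 215, 215, 313, 1191, 364, 364, 364, 364, 503, 453, 450,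
    450, 414, 411, 411, 316, 408, 450, 450, 450, 315, 305, 356, 356, 215, 215, 1204, 450, 305, 356,
    356, 215, 215, 313, 1144, 551, 551, 551, 551, 594, 647, 598, 598, 507, 503, 647, 598, 598, 507,
    507, 367, 412, 317, 316, 503, 408, 408, 450, 450, 450, 315, 305, 356, 356, 215, 215, 1195, 450,
    305, 356, 356, 215, 215, 313, 1179, 364, 364, 364, 364, 503, 453, 450, 450, 414, 411, 411, 316,
    408, 450, 450, 450, 315, 305, 356, 356, 215, 215, 1157, 450, 305, 356, 356, 215, 215, 313, 1108,
    732, 686, 689, 689, 639, 690, 690, 647, 599, 553, 507, 596, 593, 593, 503, 593, 495, 495, 448,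
    507, 367, 412, 317, 316, 503, 408, 408, 450, 450, 450, 315, 305, 356, 356, 215, 215, 1171, 450,
    305, 356, 356, 215, 215, 313, 1159, 364, 364, 364, 364, 503, 453, 450, 450, 414, 411, 411, 316,
    408, 450, 450, 450, 315, 305, 356, 356, 215, 215, 1147, 450, 305, 356, 356, 215, 215, 313, 1132,
    551, 551, 551, 551, 305, 261, 215, 215, 647, 599, 554, 554, 215, 262, 262, 355, 448, 448, 357,
    448, 543, 543, 594, 594, 500, 405, 405, 598, 507, 503, 405, 405, 405, 506, 312, 361, 361, 317,
    365, 1122, 405, 312, 361, 361, 317, 457, 365, 1098, 355, 448, 448, 357, 266, 266, 448, 543, 543,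
    594, 594, 500, 405, 405, 598, 507, 358, 405, 266, 453, 266, 361, 507, 457, 361, 317, 365, 1110,
    453, 361, 317, 365, 1086, 216, 216, 216, 216, 353, 353, 688, 688, 689, 689, 540, 587, 587, 634,
    634, 635, 635, 732, 686, 305, 261, 215, 215, 688, 640, 640, 640, 640, 690, 591, 542, 542, 594,
    542, 401, 401, 690, 647, 599, 215, 262, 262, 357, 357, 452, 452, 216, 216, 309, 309, 594, 452,
    500, 500, 647, 598, 598, 507, 452, 503, 503, 502, 502, 690, 356, 215, 215, 647, 599, 553, 507,
    594, 503, 503, 405, 405, 405, 506, 312, 361, 361, 317, 365, 1166, 405, 312, 361, 361, 317, 457,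
    365, 1154, 551, 551, 551, 551, 215, 215, 647, 599, 266, 316, 318, 318, 594, 500, 405, 405, 358,
    453, 453, 550, 504, 506, 361, 317, 365, 1118, 361, 317, 318, 550, 457, 457, 1095, 596, 596, 594,
    500, 452, 405, 647, 598, 598, 507, 356, 215, 215, 503, 405, 405, 405, 506, 312, 361, 361, 317,
    365, 1142, 405, 312, 361, 361, 317, 457, 365, 1130, 215, 215, 358, 405, 266, 453, 266, 361, 507,
    457, 361, 317, 365, 1106, 453, 361, 317, 365, 1084, 732, 686, 689, 689, 639, 690, 305, 261, 215,
    215, 690, 647, 599, 215, 262, 262, 553, 507, 596, 593, 593, 503, 593, 542, 542, 401, 401, 357,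
    503, 405, 405, 405, 506, 312, 361, 361, 317, 365, 1123, 405, 312, 361, 361, 317, 457, 365, 1111,
    551, 551, 551, 551, 266, 316, 318, 318, 553, 507, 596, 593, 593, 503, 593, 542, 542, 401, 401,
    357, 358, 453, 507, 457, 361, 317, 365, 1094, 453, 361, 317, 365, 1083, 551, 551, 551, 551, 216,
    216, 216, 216, 647, 599, 554, 554, 215, 262, 262, 598, 507, 507, 367, 412, 312, 316, 317, 360,
    357, 357, 408, 357, 448, 448, 543, 543, 594, 594, 453, 453, 1099, 266, 266, 312, 316, 411, 411,
    414, 317, 317, 411, 360, 357, 357, 408, 357, 448, 448, 543, 543, 594, 594, 453, 453, 1087, 266,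
    266, 553, 553, 554, 507, 598, 507, 266, 316, 318, 318, 507, 319, 317, 317, 457, 503, 408, 503,
    550, 593, 593, 542, 542, 401, 401, 357, 405, 1082, 414, 317, 317, 411, 542, 495, 593, 402, 359,
    500, 1070, 453, 359, 549, 402, 495, 592, 495, 543, 543, 401, 543, 594, 401, 357, 594, 503, 358,
    453, 453, 1058, 553, 553, 554, 507, 216, 216, 216, 216, 688, 688, 689, 689]

def reps222 : List (List ℕ) :=
  [[5485, 5895, 5127, 4367, 3603, 6677, 5919, 3631, 5951, 3271, 2539, 3303, 3327, 3734, 5614, 4855,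
      5591, 4095, 5159, 4399, 5183, 4039, 4063, 4823],
   [5485, 5895, 5127, 4367, 3603, 6677, 5919, 3631, 5951, 3271, 2539, 3303, 3327, 3734, 5614, 4855,
      5591, 4095, 4768, 5160, 4024, 5184, 4048, 4440],
   [5485, 5895, 5127, 4367, 3603, 6677, 5919, 3631, 5951, 3271, 2539, 3303, 3327, 3734, 5614, 4851,
      5590, 4095, 4821, 5183, 5159, 4399, 4039, 4063],
   [5485, 5895, 5127, 4367, 3603, 6677, 5919, 3631, 5951, 3271, 2539, 3303, 3325, 3734, 5614, 4851,
      5590, 4091, 4062, 4039, 4399, 5159, 5183, 4821],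
   [5485, 5895, 5127, 4367, 3603, 6677, 5919, 3631, 5951, 3269, 2539, 5614, 5590, 3299, 4038, 4399,
      5159, 5183, 4063, 4821, 4851, 4095, 3327, 3734],
   [5485, 5895, 5127, 4367, 3603, 6677, 5919, 3631, 5951, 3269, 2539, 5614, 5590, 3299, 4038, 4399,
      5159, 5183, 4062, 4821, 3325, 4851, 4091, 3734],
   [5485, 5895, 5127, 4367, 3603, 6677, 5918, 3631, 3269, 2539, 3299, 4038, 4399, 5159, 3327, 4063,
      3734, 4095, 4823, 5181, 5947, 5591, 5614, 4855],
   [5485, 5895, 5127, 4367, 3603, 6677, 5918, 3631, 3269, 2539, 3299, 4038, 4399, 5159, 3327, 4063,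
      3734, 4095, 4821, 5181, 4851, 5947, 5590, 5614],
   [5485, 5895, 5127, 4367, 3603, 6677, 5918, 3631, 3269, 2539, 3299, 4038, 4399, 5159, 3325, 3734,
      4091, 4062, 4823, 5181, 5947, 5591, 5614, 4855],
   [5485, 5895, 5127, 4367, 3603, 6677, 5918, 3631, 3269, 2539, 3299, 4038, 4399, 5159, 3325, 3734,
      4091, 4062, 4821, 5181, 4851, 5947, 5590, 5614],
   [5485, 5895, 5127, 4366, 3603, 6677, 5918, 3629, 4395, 5159, 3271, 4039, 2539, 3303, 3325, 3734,
      4091, 4062, 4823, 5181, 5947, 5591, 5614, 4855],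
   [5485, 5895, 5127, 4366, 3603, 6677, 5918, 3629, 4395, 5159, 3271, 4039, 2539, 3303, 3325, 3734,
      4091, 4062, 4821, 5181, 4851, 5947, 5590, 5614],
   [5485, 5895, 5127, 4366, 3603, 6677, 5918, 3629, 4395, 5159, 3269, 2539, 3299, 4038, 3327, 4063,
      3734, 4095, 4821, 5181, 4851, 5947, 5590, 5614],
   [5485, 5895, 5127, 4366, 3603, 6677, 5918, 3629, 4395, 5159, 3269, 2539, 3299, 4038, 3325, 3734,
      4091, 4062, 4821, 5181, 4851, 5947, 5590, 5614],
   [5485, 5894, 5125, 4366, 3603, 6677, 5918, 5155, 3629, 4395, 3269, 2539, 3299, 4038, 3325, 3734,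
      4091, 4062, 4821, 5181, 4851, 5947, 5590, 5614]]

lemma isBlocked222 : IsBlocked 2 2 2 blocked222 := by
  rw [IsBlocked]
  decide +kernel

lemma checkRep222 : ∀ r ∈ reps222, checkRep 2 2 2 blocked222 r = true := by
  decide +kernel

lemma separated222 : separated reps222 = true := by
  decide +kernel

lemma search222 : search reps222 hints222 [(blocked222, [])] = true := by
  decide +kernel

def blocked333 : ℕ :=
  0xfffffffffffffffffffffffffffffffffffffffffff80fffffffffe00fffffffff800fffffff8000003ffffe0000003ffff80000003ffff00000007ffff0000001fffff0000007ffffe000000fffff8000000ffffe0000000ffffc0000001ffffc0000007ffffc000001fffffff001fffffffff007fffffffff01fffffffffffffffffffffffffffffffffffffffffff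

def hints333 : List ℕ :=
  [579, 626, 626, 626, 626, 627, 724, 629, 631, 631, 487, 536, 392, 297, 297, 297, 297, 629, 631,
    487, 538, 586, 586, 586, 586, 440, 392, 345, 392, 345, 442, 297, 205, 300, 442, 210, 257, 258,
    258, 258, 258, 119, 73, 73, 167, 167, 305, 351, 351, 351, 351, 165, 212, 212, 212, 212, 213, 73,
    78, 123, 213, 175, 220, 221, 221, 221, 221, 226, 228, 228, 272, 272, 266, 263, 263, 264, 264,
    223, 270, 228, 325, 322, 270, 464, 415, 461, 462, 461, 462, 559, 607, 607, 557, 557, 413, 364,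
    364, 365, 365, 510, 509, 607, 746, 651, 603, 741, 646, 553, 600, 553, 600, 739, 738, 877, 873,
    828, 729, 682, 782, 491, 538, 538, 538, 538, 539, 539, 586, 586, 586, 586, 588, 636, 636, 636,
    636, 492, 351, 307, 263, 314, 364, 459, 553, 644, 687, 637, 542, 495, 593, 402, 359, 500, 1052,
    453, 359, 549, 402, 495, 592, 495, 543, 543, 401, 543, 594, 401, 357, 594, 503, 358, 453, 453,
    1064, 591, 542, 542, 687, 596, 593, 593, 687, 684, 684, 687, 684, 684, 600, 645, 645, 553, 457,
    550, 550, 457, 408, 409, 365, 413, 413, 364, 360, 357, 358, 360, 357, 358, 264, 266, 266, 263,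
    355, 401, 401, 355, 401, 401, 351, 305, 305, 351, 494, 401, 401, 589, 686, 686, 687, 687, 687,
    687, 589, 636, 636, 636, 636, 686, 590, 351, 305, 305, 687, 684, 684, 684, 684, 729, 827, 738,
    830, 786, 786, 786, 786, 832, 877, 877, 877, 877, 832, 877, 877, 877, 877, 507, 412, 365, 411,
    412, 411, 412, 460, 458, 459, 460, 459, 459, 413, 365, 741, 694, 832, 877, 877, 877, 877, 651,
    509, 605, 511, 511, 511, 511, 316, 267, 313, 314, 267, 266, 264, 314, 314, 265, 264, 265, 265,
    265, 265, 464, 415, 559, 607, 607, 557, 557, 322, 270, 274, 224, 224, 224, 224, 261, 306, 307,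
    307, 306, 305, 351, 307, 307, 352, 351, 352, 352, 352, 352, 175, 220, 226, 228, 228, 272, 272,
    123, 213, 121, 444, 491, 492, 492, 491, 538, 538, 492, 492, 539, 539, 586, 586, 586, 586, 210,
    257, 119, 73, 73, 167, 167, 253, 442, 346, 392, 297, 297, 297, 297, 392, 297, 297, 297, 297,
    487, 538, 586, 586, 586, 586, 586, 538, 491, 538, 491, 392, 297, 297, 297, 297, 392, 297, 297,
    297, 297, 487, 536, 392, 297, 297, 297, 297, 724, 677, 582, 487, 392, 297, 297, 297, 297, 392,
    297, 297, 297, 297, 487, 487, 392, 297, 297, 297, 297, 392, 297, 297, 297, 297, 487, 582, 487,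
    392, 297, 297, 297, 297, 392, 297, 297, 297, 297, 487, 584, 487, 677, 725, 725, 725, 725, 627,
    674, 674, 674, 674, 628, 724, 535, 487, 487, 537, 632, 681, 681, 776, 824, 824, 776, 824, 824,
    729, 872, 826, 732, 780, 780, 780, 780, 729, 872, 826, 877, 828, 732, 589, 591, 591, 784, 736,
    689, 736, 689, 784, 736, 736, 736, 736, 734, 734, 828, 780, 733, 632, 681, 681, 776, 824, 824,
    776, 824, 824, 729, 872, 826, 732, 780, 780, 780, 780, 729, 872, 826, 877, 828, 732, 638, 784,
    736, 689, 736, 689, 589, 784, 736, 736, 736, 736, 734, 734, 828, 780, 733, 585, 585, 440, 392,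
    345, 392, 345, 442, 297, 205, 300, 537, 442, 491, 491, 442, 491, 491, 585, 585, 210, 257, 119,
    73, 73, 167, 167, 253, 442, 346, 724, 678, 535, 487, 487, 537, 633, 680, 680, 680, 680, 681,
    681, 776, 824, 824, 776, 824, 824, 729, 872, 826, 732, 780, 780, 780, 780, 729, 872, 826, 877,
    828, 732, 589, 591, 591, 784, 736, 689, 736, 689, 784, 736, 736, 736, 736, 734, 734, 828, 780,
    733, 633, 680, 680, 680, 680, 681, 681, 776, 824, 824, 776, 824, 824, 729, 872, 826, 732, 780,
    780, 780, 780, 729, 872, 826, 877, 828, 732, 638, 784, 736, 689, 736, 689, 589, 784, 736, 736,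
    736, 736, 734, 734, 828, 780, 733, 585, 585, 440, 392, 345, 392, 345, 442, 297, 205, 300, 537,
    442, 491, 491, 442, 491, 491, 585, 585, 210, 257, 119, 73, 73, 167, 167, 253, 442, 346, 628,
    722, 676, 533, 580, 580, 580, 580, 581, 581, 678, 727, 727, 632, 727, 824, 872, 872, 872, 872,
    824, 872, 872, 872, 872, 678, 727, 727, 727, 824, 872, 872, 872, 872, 824, 872, 872, 872, 872,
    727, 824, 872, 872, 872, 872, 824, 872, 872, 872, 872, 722, 580, 629, 679, 633, 585, 585, 635,
    729, 776, 776, 730, 730, 729, 776, 776, 730, 730, 635, 729, 776, 776, 730, 730, 729, 776, 776,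
    730, 730, 633, 585, 585, 536, 489, 440, 297, 205, 300, 348, 348, 253, 396, 350, 256, 304, 304,
    304, 304, 350, 446, 493, 256, 304, 304, 304, 304, 346, 440, 297, 396, 348, 301, 348, 301, 346,
    440, 392, 345, 440, 392, 345, 489, 537, 537, 537, 537, 536, 489, 440, 297, 205, 300, 348, 348,
    253, 396, 350, 256, 304, 304, 304, 304, 350, 493, 446, 256, 304, 304, 304, 304, 446, 346, 440,
    297, 396, 348, 301, 348, 301, 346, 440, 392, 345, 440, 392, 345, 489, 537, 537, 537, 537, 727,
    727, 629, 582, 679, 633, 584, 584, 584, 489, 440, 297, 205, 300, 348, 348, 253, 396, 350, 256,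
    304, 304, 304, 304, 350, 446, 493, 493, 256, 304, 304, 304, 304, 541, 346, 440, 297, 396, 348,
    301, 348, 301, 346, 440, 392, 345, 440, 392, 345, 489, 584, 635, 729, 776, 776, 730, 730, 729,
    776, 776, 730, 730, 489, 633, 584, 584, 584, 489, 440, 297, 205, 300, 348, 348, 253, 396, 350,
    256, 304, 304, 304, 304, 350, 446, 493, 256, 304, 304, 304, 304, 346, 440, 297, 396, 348, 301,
    348, 301, 346, 440, 392, 345, 440, 392, 345, 489, 584, 489, 440, 297, 205, 300, 348, 348, 253,
    396, 350, 256, 304, 304, 304, 304, 350, 493, 446, 256, 304, 304, 304, 304, 446, 346, 440, 297,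
    396, 348, 301, 348, 301, 346, 440, 392, 345, 440, 392, 345, 489, 727, 727, 580, 629, 727, 824,
    872, 872, 872, 872, 680, 583, 727, 824, 872, 872, 872, 872, 680, 681, 681, 681, 681, 586, 634,
    634, 634, 634, 586, 634, 634, 634, 634, 727, 824, 872, 872, 872, 872, 680, 681, 681, 681, 681,
    729, 776, 776, 776, 776, 872, 826, 877, 828, 730, 828, 786, 743, 695, 695, 745, 745, 737, 730,
    684, 635, 586, 634, 636, 636, 635, 636, 589, 586, 587, 587, 587, 587, 587, 786, 743, 695, 695,
    745, 745, 737, 738, 691, 738, 691, 740, 745, 697, 654, 651, 693, 651, 511, 418, 416, 416, 325,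
    325, 556, 693, 645, 690, 687, 689, 643, 643, 690, 643, 642, 687, 688, 641, 688, 641, 688, 511,
    418, 416, 416, 325, 325, 509, 555, 556, 555, 556, 463, 325, 370, 229, 275, 462, 322, 224, 127,
    173, 78, 173, 78, 271, 462, 460, 553, 599, 600, 599, 600, 553, 507, 506, 506, 553, 554, 507,
    506, 505, 224, 175, 78, 125, 74, 122, 221, 123, 165, 208, 205, 205, 205, 205, 214, 171, 267,
    364, 365, 365, 365, 365, 364, 316, 315, 315, 317, 317, 316, 315, 315, 165, 210, 207, 207, 208,
    208, 205, 254, 297, 299, 258, 300, 440, 440, 302, 351, 397, 397, 397, 397, 634, 586, 587, 587,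
    587, 587, 587, 586, 539, 586, 539, 636, 687, 689, 689, 687, 689, 689, 686, 590, 593, 593, 492,
    397, 397, 397, 397, 494, 398, 493, 351, 398, 398, 398, 398, 398, 686, 643, 595, 593, 592, 599,
    595, 593, 592, 600, 507, 507, 599, 506, 504, 550, 549, 365, 504, 550, 549, 365, 316, 316, 365,
    315, 264, 261, 261, 264, 261, 261, 264, 361, 358, 358, 264, 308, 351, 397, 397, 351, 397, 397,
    351, 356, 401, 401, 351, 445, 447, 542, 542, 542, 495, 593, 402, 359, 500, 1070, 453, 359, 549,
    402, 495, 592, 495, 543, 543, 401, 543, 594, 401, 357, 594, 503, 358, 453, 453, 1058, 540, 492,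
    445, 492, 445, 490, 258, 262, 264, 264, 264, 264, 208, 205, 205, 205, 205, 208, 205, 205, 205,
    205, 221, 221, 126, 221, 127, 317, 365, 365, 365, 365, 127, 173, 78, 173, 78, 127, 78, 78, 78,
    78, 462, 464, 464, 464, 464, 554, 600, 600, 599, 599, 693, 741, 741, 741, 741, 689, 687, 687,
    686, 686, 730, 634, 586, 539, 586, 539, 629, 582, 727, 824, 872, 872, 872, 872, 680, 582]

def reps333 : List (List ℕ) :=
  [[5443, 6205, 6612, 5471, 5865, 4712, 3948, 3187, 2459, 3223, 3970, 2864, 2129, 1403, 1814, 2175,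
      2522, 2568, 2601, 3014, 3774, 3751, 3348, 4496, 5266, 6030, 6757, 5999, 5244, 6344, 7082,
      7813, 7405, 7047, 6640, 6689, 5116, 4371, 3617, 3275, 2921, 3702, 4098, 4846, 5594, 5941,
      6292, 5517, 5159, 4399, 5183, 4039, 4063, 4823],
   [5443, 6205, 6612, 5471, 5865, 4712, 3948, 3187, 2459, 3223, 3970, 2864, 2129, 1403, 1814, 2175,
      2522, 2568, 2601, 3014, 3774, 3751, 3348, 4496, 5266, 6030, 6757, 5999, 5244, 6344, 7082,
      7813, 7405, 7047, 6640, 6689, 5116, 4371, 3617, 3275, 2921, 3702, 4098, 4846, 5594, 5941,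
      6292, 5517, 4768, 5160, 4024, 5184, 4048, 4440]]

lemma isBlocked333 : IsBlocked 3 3 3 blocked333 := by
  rw [IsBlocked]
  decide +kernel

lemma checkRep333 : ∀ r ∈ reps333, checkRep 3 3 3 blocked333 r = true := by
  decide +kernel

lemma separated333 : separated reps333 = true := by
  decide +kernel

lemma search333 : search reps333 hints333 [(blocked333, [])] = true := by
  decide +kernel

end THPentagon

end

theorem mainTheorem7 :
    ((∀ F : Set (Set ℂ), THPentagon.IsFilling (THPentagon.hexFlower 2) F → F.ncard = 72) ∧
      Nat.card (THPentagon.Pattern (THPentagon.hexFlower 2)) = 15) ∧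
    ((∀ F : Set (Set ℂ), THPentagon.IsFilling (THPentagon.hexFlower 3) F → F.ncard = 162) ∧
      Nat.card (THPentagon.Pattern (THPentagon.hexFlower 3)) = 2) ∧
    ((∀ F : Set (Set ℂ), THPentagon.IsFilling THPentagon.skewedHexFlower F → F.ncard = 54) ∧
      Nat.card (THPentagon.Pattern THPentagon.skewedHexFlower) = 2) := by
  have e2 : THPentagon.hexFlower 2 =
      THPentagon.flower ((2 : ℤ) : ℝ) ((2 : ℤ) : ℝ) ((2 : ℤ) : ℝ) := by
    norm_num [THPentagon.hexFlower]
  have e3 : THPentagon.hexFlower 3 =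
      THPentagon.flower ((3 : ℤ) : ℝ) ((3 : ℤ) : ℝ) ((3 : ℤ) : ℝ) := by
    norm_num [THPentagon.hexFlower]
  have e1 : THPentagon.skewedHexFlower =
      THPentagon.flower ((2 : ℤ) : ℝ) ((2 : ℤ) : ℝ) ((1 : ℤ) : ℝ) := by
    norm_num [THPentagon.skewedHexFlower]
  rw [e1, e2, e3]
  refine ⟨⟨fun F hF => ?_, ?_⟩, ⟨fun F hF => ?_, ?_⟩, fun F hF => ?_, ?_⟩
  · exact THPentagon.ncard_filling (n := 24) (by norm_num) (by norm_num) (by norm_num)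
      (by norm_num) THPentagon.isBlocked222 THPentagon.checkRep222 THPentagon.search222
      (by decide) hF
  · exact THPentagon.card_pattern (by norm_num) (by norm_num) (by norm_num) (by norm_num)
      THPentagon.isBlocked222 THPentagon.checkRep222 THPentagon.separated222 THPentagon.search222
  · exact THPentagon.ncard_filling (n := 54) (by norm_num) (by norm_num) (by norm_num)
      (by norm_num) THPentagon.isBlocked333 THPentagon.checkRep333 THPentagon.search333
      (by decide) hF
  · exact THPentagon.card_pattern (by norm_num) (by norm_num) (by norm_num) (by norm_num)
      THPentagon.isBlocked333 THPentagon.checkRep333 THPentagon.separated333 THPentagon.search333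
  · exact THPentagon.ncard_filling (n := 18) (by norm_num) (by norm_num) (by norm_num)
      (by norm_num) THPentagon.isBlocked221 THPentagon.checkRep221 THPentagon.search221
      (by decide) hF
  · exact THPentagon.card_pattern (by norm_num) (by norm_num) (by norm_num) (by norm_num)
      THPentagon.isBlocked221 THPentagon.checkRep221 THPentagon.separated221 THPentagon.search221
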